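/- Conventions. For a complete Riemannian manifold $(M,g)$ without conjugate points and a unit tangent vector $v\in SM$, let $\gamma_v$ be the geodesic with $\gamma_v'(0)=v$ and let $R(t)=R(\cdot,\gamma_v'(t))\gamma_v'(t)$ be the Jacobi operator along $\gamma_v$, with $R(X,Y)Z=\nabla_X\nabla_YZ-\nabla_Y\nabla_XZ-\nabla_{[X,Y]}Z$. For $T>0$ let $E_T$ be the solution of $E_T''(t)+R(t)E_T(t)=0$ with $E_T(0)=\mathrm{Id}$ and $E_T(T)=0$. The stable Riccati solution is $U^s(v)=\lim_{T\to\infty}E_T'(0)|_{v^\perp}:v^\perp\to v^\perp$ (the limit exists). $(M,g)$ is called asymptotically harmonic if $\operatorname{tr}U^s(v)$ is constant on $SM$. Lemma. Let $(M_1,g_1)$ and $(M_2,g_2)$ be nonempty complete smooth Riemannian manifolds of positive (finite) dimension, and let $(M,g)=(M_1\times M_2,\,g_1\times g_2)$ be their Riemannian product. Suppose that $(M,g)$, $(M_1,g_1)$ and $(M_2,g_2)$ have no conjugate points, and let $U^s,U^s_1,U^s_2$ be the stable Riccati solutions of $M,M_1,M_2$. If $(M,g)$ is asymptotically harmonic,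 then $(M_1,g_1)$ and $(M_2,g_2)$ are asymptotically harmonic, and $\operatorname{tr}U^s=0$ on $SM$, $\operatorname{tr}U^s_1=0$ on $SM_1$, and $\operatorname{tr}U^s_2=0$ on $SM_2$. -/

import Mathlib

open Manifold Bundle Filter Topology
open scoped ContDiff

noncomputable section

namespace RiemGeom

section Basic

variable {E : Type*} [NormedAddCommGroup E] [NormedSpace ℝ E]
  {H : Type*} [TopologicalSpace H] {I : ModelWithCorners ℝ E H}
  {M : Type*} [TopologicalSpace M] [ChartedSpace H M] [IsManifold I ∞ M]

variable (I M) in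
/-- Smooth Riemannian metrics on `M`. -/
abbrev SmoothMetric : Type _ :=
  ContMDiffRiemannianMetric I ∞ E (fun x : M => TangentSpace I x)

/-- The metric in the preferred chart `φ` at `p`: at a point `y` of the chart domain in `E` this is
the bilinear form `(v, w) ↦ g(d(φ⁻¹)_y v, d(φ⁻¹)_y w)`. -/
def metricInChart (g : SmoothMetric I M) (p : M) (y : E) : E →L[ℝ] E →L[ℝ] ℝ :=
  let A : E →L[ℝ] TangentSpace I ((extChartAt I p).symm y) :=
    mfderiv 𝓘(ℝ, E) I (extChartAt I p).symm y
  (ContinuousLinearMap.precomp ℝ A) ∘L (g.inner ((extChartAt I p).symm y)) ∘L A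

set_option synthInstance.maxHeartbeats 200000 in
/-- The Christoffel symbols of the first kind in the preferred chart at `p`: the linear form
`z ↦ (D_v G(w, z) + D_w G(v, z) - D_z G(v, w)) / 2`, where `G` is the metric in the chart. -/
def christoffelFirst (g : SmoothMetric I M) (p : M) (y v w : E) : E →L[ℝ] ℝ :=
  let D : E →L[ℝ] E →L[ℝ] E →L[ℝ] ℝ := fderiv ℝ (metricInChart g p) y
  (1 / 2 : ℝ) • (D v w + D w v - (D.flip v).flip w)

/-- The Christoffel symbols `Γ(y)(v, w)` of the Levi-Civita connection in the preferred chart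
at `p`, obtained from those of the first kind by raising the index with the metric. -/
def christoffel (g : SmoothMetric I M) (p : M) (y v w : E) : E :=
  (metricInChart g p y).inverse (christoffelFirst g p y v w)

/-- The Riemann curvature tensor `R(u, v) w = ∇_u ∇_v w - ∇_v ∇_u w - ∇_[u,v] w` at `p`. It is
computed at the centre of the preferred chart at `p`, whose differential at `p` is the
identification of `TangentSpace I p` with `E`. -/
def curvature (g : SmoothMetric I M) (p : M) (u v w : TangentSpace I p) : TangentSpace I p :=
  let y : E := extChartAt I p p
  let Γ : E → E → E → E := christoffel g p
  fderiv ℝ (fun x => Γ x v w) y u - fderiv ℝ (fun x => Γ x u w) y v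
    + Γ y u (Γ y v w) - Γ y v (Γ y u w)

/-- The velocity of a curve. -/
def velocity (I : ModelWithCorners ℝ E H) {M : Type*} [TopologicalSpace M] [ChartedSpace H M]
    (γ : ℝ → M) (t : ℝ) : TangentSpace I (γ t) :=
  mfderiv 𝓘(ℝ, ℝ) I γ t (1 : ℝ)

/-- The Levi-Civita covariant derivative of a vector field `Y` along the curve `γ`, at time `t`:
in the preferred chart at `γ t`, if `ξ` is the coordinate representation of `Y`, this is
`ξ' + Γ(γ', ξ)`. -/
def covDeriv (g : SmoothMetric I M) (γ : ℝ → M) (Y : ∀ t, TangentSpace I (γ t)) (t : ℝ) :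
    TangentSpace I (γ t) :=
  let ξ : ℝ → E := fun s => mfderiv I 𝓘(ℝ, E) (extChartAt I (γ t)) (γ s) (Y s)
  deriv ξ t + christoffel g (γ t) (extChartAt I (γ t) (γ t)) (velocity I γ t) (Y t)

/-- A geodesic defined on the whole real line. -/
def IsGeodesic (g : SmoothMetric I M) (γ : ℝ → M) : Prop :=
  ContMDiff 𝓘(ℝ, ℝ) I ∞ γ ∧ ∀ t, covDeriv g γ (velocity I γ) t = 0

/-- A Jacobi field along `γ`: a smooth vector field `Y` along `γ` with `Y'' + R(Y, γ') γ' = 0`. -/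
def IsJacobiField (g : SmoothMetric I M) (γ : ℝ → M) (Y : ∀ t, TangentSpace I (γ t)) : Prop :=
  ContMDiff 𝓘(ℝ, ℝ) I.tangent ∞ (fun t => (⟨γ t, Y t⟩ : TangentBundle I M)) ∧
  ∀ t, covDeriv g γ (covDeriv g γ Y) t
    + curvature g (γ t) (Y t) (velocity I γ t) (velocity I γ t) = 0

/-- Completeness: every tangent vector is the initial velocity of a geodesic that is defined for
all times. -/
def IsComplete (g : SmoothMetric I M) : Prop :=
  ∀ (p : M) (v : TangentSpace I p), ∃ γ : ℝ → M, IsGeodesic g γ ∧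
    (⟨γ 0, velocity I γ 0⟩ : TangentBundle I M) = ⟨p, v⟩

/-- No conjugate points: along a nonconstant geodesic, a Jacobi field that vanishes at two
different times vanishes identically. -/
def NoConjugatePoints (g : SmoothMetric I M) : Prop :=
  ∀ γ : ℝ → M, IsGeodesic g γ → velocity I γ 0 ≠ 0 →
    ∀ Y : ∀ t, TangentSpace I (γ t), IsJacobiField g γ Y →
      ∀ a b : ℝ, a ≠ b → Y a = 0 → Y b = 0 → ∀ t, Y t = 0

/-- The orthogonal complement of `v` in the tangent space at `p`. -/
def perp (g : SmoothMetric I M) (p : M) (v : TangentSpace I p) : Submodule ℝ (TangentSpace I p) :=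
  LinearMap.ker (g.inner p v).toLinearMap

/-- `A` is the Jacobi tensor `E_T` along `γ` which is the identity at time `0` and vanishes at
time `T`. A tensor along `γ` is written as a family of linear maps `A t` from the tangent space at
`p = γ 0` to that at `γ t` (that is, it is composed with parallel transport from `γ 0` to `γ t`),
and it is a Jacobi tensor when all `t ↦ A t w` are Jacobi fields. -/
def IsJacobiTensorTo (g : SmoothMetric I M) (γ : ℝ → M) (p : M) (T : ℝ)
    (A : ∀ t, TangentSpace I p →ₗ[ℝ] TangentSpace I (γ t)) : Prop :=
  (∀ w, IsJacobiField g γ (fun t => A t w)) ∧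
  (∀ w, (⟨γ 0, A 0 w⟩ : TangentBundle I M) = ⟨p, w⟩) ∧
  (∀ w, A T w = 0)

/-- `U` is the limit as `T → ∞` of the endomorphisms `U_T(v) = E_T'(0)` on the orthogonal
complement of `v`. Here `γ` is the geodesic with initial velocity `v`. The derivative `E_T'(0) w`
lies in the tangent space at `γ 0 = p`. -/
def IsStableRiccati (g : SmoothMetric I M) (p : M) (v : TangentSpace I p)
    (U : perp g p v →ₗ[ℝ] perp g p v) : Prop :=
  ∀ γ : ℝ → M, IsGeodesic g γ → (⟨γ 0, velocity I γ 0⟩ : TangentBundle I M) = ⟨p, v⟩ →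
    ∃ A : ℝ → ∀ t, TangentSpace I p →ₗ[ℝ] TangentSpace I (γ t),
      (∀ T > 0, IsJacobiTensorTo g γ p T (A T)) ∧
      ∀ w : perp g p v, Tendsto
        (fun T => (covDeriv g γ (fun t => A T t w) 0 : TangentSpace I p)) atTop
        (𝓝 (U w : TangentSpace I p))

open Classical in
/-- The stable Riccati solution `U^s(v)`, as a function of `v`. On a complete manifold without
conjugate points the limit above exists for each unit vector `v` (by Green), and it is unique
since `γ` and the tensors `E_T` are; the default value `0` is not used there. -/
def stableRiccati (g : SmoothMetric I M) (p : M) (v : TangentSpace I p) :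
    perp g p v →ₗ[ℝ] perp g p v :=
  if h : ∃ U, IsStableRiccati g p v U then h.choose else 0

/-- The trace of the stable Riccati solution. -/
def trStable (g : SmoothMetric I M) (p : M) (v : TangentSpace I p) : ℝ :=
  LinearMap.trace ℝ (perp g p v) (stableRiccati g p v)

/-- A complete manifold without conjugate points is asymptotically harmonic if the trace of
the stable Riccati solution is constant on the unit tangent bundle. -/
def IsAsymptoticallyHarmonic (g : SmoothMetric I M) : Prop :=
  IsComplete g ∧ NoConjugatePoints g ∧
    ∃ α : ℝ, ∀ (p : M) (v : TangentSpace I p), g.inner p v v = 1 → trStable g p v = α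

end Basic

section Prod

variable {E₁ : Type*} [NormedAddCommGroup E₁] [NormedSpace ℝ E₁]
  {H₁ : Type*} [TopologicalSpace H₁] {I₁ : ModelWithCorners ℝ E₁ H₁}
  {M₁ : Type*} [TopologicalSpace M₁] [ChartedSpace H₁ M₁] [IsManifold I₁ ∞ M₁]
  {E₂ : Type*} [NormedAddCommGroup E₂] [NormedSpace ℝ E₂]
  {H₂ : Type*} [TopologicalSpace H₂] {I₂ : ModelWithCorners ℝ E₂ H₂}
  {M₂ : Type*} [TopologicalSpace M₂] [ChartedSpace H₂ M₂] [IsManifold I₂ ∞ M₂]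

/-- The first component of a tangent vector to a product. -/
def tangentFst (x : M₁ × M₂) : TangentSpace (I₁.prod I₂) x →L[ℝ] TangentSpace I₁ x.1 :=
  ContinuousLinearMap.fst ℝ E₁ E₂

/-- The second component of a tangent vector to a product. -/
def tangentSnd (x : M₁ × M₂) : TangentSpace (I₁.prod I₂) x →L[ℝ] TangentSpace I₂ x.2 :=
  ContinuousLinearMap.snd ℝ E₁ E₂

/-- The bilinear form `g₁(v₁, w₁) + g₂(v₂, w₂)`. -/
def prodInner (g₁ : SmoothMetric I₁ M₁) (g₂ : SmoothMetric I₂ M₂) (x : M₁ × M₂) :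
    TangentSpace (I₁.prod I₂) x →L[ℝ] TangentSpace (I₁.prod I₂) x →L[ℝ] ℝ :=
  (ContinuousLinearMap.precomp ℝ (tangentFst x)) ∘L (g₁.inner x.1) ∘L (tangentFst x) +
  (ContinuousLinearMap.precomp ℝ (tangentSnd x)) ∘L (g₂.inner x.2) ∘L (tangentSnd x)

theorem prodInner_apply (g₁ : SmoothMetric I₁ M₁) (g₂ : SmoothMetric I₂ M₂) (x : M₁ × M₂)
    (v w : TangentSpace (I₁.prod I₂) x) :
    prodInner g₁ g₂ x v w = g₁.inner x.1 (tangentFst x v) (tangentFst x w)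
      + g₂.inner x.2 (tangentSnd x v) (tangentSnd x w) := rfl

theorem prod_fderiv_unique {f₁ : E₁ → E₁} {f₂ : E₂ → E₂} {f : E₁ × E₂ → E₁ × E₂}
    {L₁ : E₁ →L[ℝ] E₁} {L₂ : E₂ →L[ℝ] E₂} {L : E₁ × E₂ →L[ℝ] E₁ × E₂} {s₁ : Set E₁} {s₂ : Set E₂}
    {a₁ : E₁} {a₂ : E₂} (d₁ : HasFDerivWithinAt f₁ L₁ s₁ a₁) (d₂ : HasFDerivWithinAt f₂ L₂ s₂ a₂)
    (h₁ : UniqueDiffWithinAt ℝ s₁ a₁) (h₂ : UniqueDiffWithinAt ℝ s₂ a₂)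
    (d : HasFDerivWithinAt f L (s₁ ×ˢ s₂) (a₁, a₂)) (hf : ∀ y, f y = (f₁ y.1, f₂ y.2)) :
    L = L₁.prodMap L₂ := by
  have dd : HasFDerivWithinAt (Prod.map f₁ f₂) (L₁.prodMap L₂) (s₁ ×ˢ s₂) (a₁, a₂) :=
    HasFDerivWithinAt.prodMap (p := (a₁, a₂)) (d₁.mono (Set.fst_image_prod_subset _ _))
      (d₂.mono (Set.snd_image_prod_subset _ _))
  exact (h₁.prod h₂).eq d (dd.congr (fun y _ => hf y) (hf _))

/-- The tangent bundle of a product is trivialized componentwise. -/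
theorem symm_prod (x₀ x : M₁ × M₂) (h1 : x.1 ∈ (chartAt H₁ x₀.1).source)
    (h2 : x.2 ∈ (chartAt H₂ x₀.2).source) (v : E₁ × E₂) :
    tangentFst x ((trivializationAt (E₁ × E₂) (TangentSpace (I₁.prod I₂)) x₀).symm x v) =
      (trivializationAt E₁ (TangentSpace I₁) x₀.1).symm x.1 v.1 ∧
    tangentSnd x ((trivializationAt (E₁ × E₂) (TangentSpace (I₁.prod I₂)) x₀).symm x v) =
      (trivializationAt E₂ (TangentSpace I₂) x₀.2).symm x.2 v.2 := by
  have h : x ∈ (chartAt (ModelProd H₁ H₂) x₀).source := by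
    simp [h1, h2]
  have a := TangentBundle.symmL_trivializationAt_eq_core (I := I₁.prod I₂) h
  have a1 := TangentBundle.symmL_trivializationAt_eq_core (I := I₁) h1
  have a2 := TangentBundle.symmL_trivializationAt_eq_core (I := I₂) h2
  have key : (tangentBundleCore (I₁.prod I₂) (M₁ × M₂)).coordChange
      (achart (ModelProd H₁ H₂) x₀) (achart (ModelProd H₁ H₂) x) x =
      ((tangentBundleCore I₁ M₁).coordChange (achart H₁ x₀.1) (achart H₁ x.1) x.1).prodMap
      ((tangentBundleCore I₂ M₂).coordChange (achart H₂ x₀.2) (achart H₂ x.2) x.2) := by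
    have d1 := hasFDerivWithinAt_tangentCoordChange (I := I₁) (x := x₀.1) (y := x.1) (z := x.1)
      (by simp [h1])
    have d2 := hasFDerivWithinAt_tangentCoordChange (I := I₂) (x := x₀.2) (y := x.2) (z := x.2)
      (by simp [h2])
    have d := hasFDerivWithinAt_tangentCoordChange (I := I₁.prod I₂) (x := x₀) (y := x) (z := x)
      (by simp [h1, h2])
    have hr : Set.range (I₁.prod I₂) = Set.range I₁ ×ˢ Set.range I₂ := I₁.range_prod
    rw [hr] at d
    have hu1 : UniqueDiffWithinAt ℝ (Set.range I₁) (extChartAt I₁ x₀.1 x.1) := by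
      rw [extChartAt_coe]; exact I₁.uniqueDiffWithinAt_image
    have hu2 : UniqueDiffWithinAt ℝ (Set.range I₂) (extChartAt I₂ x₀.2 x.2) := by
      rw [extChartAt_coe]; exact I₂.uniqueDiffWithinAt_image
    have hp : extChartAt (I₁.prod I₂) x₀ x = (extChartAt I₁ x₀.1 x.1, extChartAt I₂ x₀.2 x.2) := by
      simp only [extChartAt_prod, PartialEquiv.prod_coe]
    rw [hp] at d
    refine prod_fderiv_unique d1 d2 hu1 hu2 d ?_
    intro y
    simp only [extChartAt_prod, PartialEquiv.prod_coe, PartialEquiv.prod_coe_symm,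
      Function.comp_apply]
  have b := (DFunLike.congr_fun a v).trans (DFunLike.congr_fun key v)
  have b1 := DFunLike.congr_fun a1 v.1
  have b2 := DFunLike.congr_fun a2 v.2
  rw [Trivialization.symmL_apply _ (by simpa using h)] at b
  rw [Trivialization.symmL_apply _ (by simpa using h1)] at b1
  rw [Trivialization.symmL_apply _ (by simpa using h2)] at b2
  rw [b1, b2, b]
  exact ⟨rfl, rfl⟩

theorem inner_self_nonneg (g : SmoothMetric I₁ M₁) (p : M₁)
    (v : TangentSpace I₁ p) : 0 ≤ g.inner p v v := by
  by_cases h : v = 0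
  · simp [h]
  · exact (g.pos _ _ h).le

/-- The product metric `g₁ × g₂` on `M₁ × M₂`. -/
def prodMetric (g₁ : SmoothMetric I₁ M₁) (g₂ : SmoothMetric I₂ M₂) : SmoothMetric (I₁.prod I₂) (M₁ × M₂) where
  inner := prodInner g₁ g₂
  symm x v w := by
    rw [prodInner_apply, prodInner_apply, g₁.symm, g₂.symm]
  pos x v hv := by
    rw [prodInner_apply]
    have h1 := inner_self_nonneg g₁ x.1
    have h2 := inner_self_nonneg g₂ x.2
    by_cases h : tangentFst x v = 0
    · have h' : tangentSnd x v ≠ 0 := fun h' => hv (Prod.ext h h')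
      have := g₂.pos _ _ h'
      linarith [h1 (tangentFst x v)]
    · have := g₁.pos _ _ h
      linarith [h2 (tangentSnd x v)]
  isVonNBounded x := by
    have h1 : Bornology.IsBounded {v : E₁ | (g₁.inner x.1 v : E₁ →L[ℝ] ℝ) v < 1} :=
      (NormedSpace.isVonNBounded_iff ℝ).1 (g₁.isVonNBounded x.1)
    have h2 : Bornology.IsBounded {v : E₂ | (g₂.inner x.2 v : E₂ →L[ℝ] ℝ) v < 1} :=
      (NormedSpace.isVonNBounded_iff ℝ).1 (g₂.isVonNBounded x.2)
    have h3 : Bornology.IsVonNBounded ℝ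
        {v : E₁ × E₂ | (prodInner g₁ g₂ x v : E₁ × E₂ →L[ℝ] ℝ) v < 1} := by
      refine (NormedSpace.isVonNBounded_iff ℝ).2 ((h1.prod h2).subset ?_)
      intro v hv
      have hv' : g₁.inner x.1 v.1 v.1 + g₂.inner x.2 v.2 v.2 < 1 := hv
      exact ⟨lt_of_le_of_lt (le_add_of_nonneg_right (inner_self_nonneg g₂ _ _)) hv',
        lt_of_le_of_lt (le_add_of_nonneg_left (inner_self_nonneg g₁ _ _)) hv'⟩
    exact h3
  contMDiff := by
    intro x₀
    rw [contMDiffAt_hom_bundle]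
    refine ⟨contMDiffAt_id, ?_⟩
    have s1 := ((contMDiffAt_hom_bundle _).1 (g₁.contMDiff x₀.1)).2
    have s2 := ((contMDiffAt_hom_bundle _).1 (g₂.contMDiff x₀.2)).2
    have t1 := s1.comp x₀ (contMDiffAt_fst (I := I₁) (J := I₂))
    have t2 := s2.comp x₀ (contMDiffAt_snd (I := I₁) (J := I₂))
    have r1 := (contMDiffAt_const (c := ContinuousLinearMap.precomp ℝ
      (ContinuousLinearMap.fst ℝ E₁ E₂))).clm_comp (t1.clm_comp
        (contMDiffAt_const (c := ContinuousLinearMap.fst ℝ E₁ E₂)))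
    have r2 := (contMDiffAt_const (c := ContinuousLinearMap.precomp ℝ
      (ContinuousLinearMap.snd ℝ E₁ E₂))).clm_comp (t2.clm_comp
        (contMDiffAt_const (c := ContinuousLinearMap.snd ℝ E₁ E₂)))
    refine (r1.add r2).congr_of_eventuallyEq ?_
    filter_upwards [(chartAt (ModelProd H₁ H₂) x₀).open_source.mem_nhds
      (mem_chart_source (ModelProd H₁ H₂) x₀)] with x hx
    have hx' : x.1 ∈ (chartAt H₁ x₀.1).source ∧ x.2 ∈ (chartAt H₂ x₀.2).source := by
      simpa using hx
    refine ContinuousLinearMap.ext fun v => ContinuousLinearMap.ext fun w => ?_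
    refine (inCoordinates_apply_eq₂ (by simpa using hx) (by simpa using hx) (by simp)).trans ?_
    have e1 := inCoordinates_apply_eq₂ (ϕ := g₁.inner x.1) (v := v.1) (w := w.1)
      (F₁ := E₁) (F₂ := E₁) (F₃ := ℝ) (E₁ := fun y : M₁ => TangentSpace I₁ y)
      (E₂ := fun y : M₁ => TangentSpace I₁ y) (E₃ := Bundle.Trivial M₁ ℝ) (x₀ := x₀.1)
      (by simpa using hx'.1) (by simpa using hx'.1) (by simp)
    have e2 := inCoordinates_apply_eq₂ (ϕ := g₂.inner x.2) (v := v.2) (w := w.2)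
      (F₁ := E₂) (F₂ := E₂) (F₃ := ℝ) (E₁ := fun y : M₂ => TangentSpace I₂ y)
      (E₂ := fun y : M₂ => TangentSpace I₂ y) (E₃ := Bundle.Trivial M₂ ℝ) (x₀ := x₀.2)
      (by simpa using hx'.2) (by simpa using hx'.2) (by simp)
    refine Eq.trans ?_ (congrArg₂ (· + ·) e1.symm e2.symm)
    simp only [prodInner_apply]
    obtain ⟨a1, a2⟩ := symm_prod (I₁ := I₁) (I₂ := I₂) x₀ x hx'.1 hx'.2 v
    obtain ⟨b1, b2⟩ := symm_prod (I₁ := I₁) (I₂ := I₂) x₀ x hx'.1 hx'.2 w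
    rw [a1, a2, b1, b2]
    exact (congrArg (fun f : ℝ →ₗ[ℝ] ℝ => f _)
      (Bundle.Trivial.linearMapAt_trivialization ℝ (M₁ × M₂) ℝ x)).trans
      (congrArg₂ (· + ·)
      (congrArg (fun f : ℝ →ₗ[ℝ] ℝ => f _)
        (Bundle.Trivial.linearMapAt_trivialization ℝ M₁ ℝ x.1)).symm
      (congrArg (fun f : ℝ →ₗ[ℝ] ℝ => f _)
        (Bundle.Trivial.linearMapAt_trivialization ℝ M₂ ℝ x.2)).symm)

end Prod

end RiemGeom

end

/-!
The proof rests on the splitting of the stable Riccati solution of a Riemannian product. Let `v₁`,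
`v₂` be unit vectors and `a, b > 0` with `a² + b² = 1`. The Christoffel symbols and the curvature of
a product metric split, so a geodesic of the product is a pair of geodesics, and a Jacobi field
along it is a pair of Jacobi fields (`IsGeodesic.fst_snd`, `isJacobiField_prod_iff`). The geodesic
with initial velocity `(a v₁, b v₂)` has the components `γ_{v₁}(a t)` and `γ_{v₂}(b t)`, and
rescaling time by `a` multiplies `E_T'(0)` by `a` and `T` by `1 / a`. Hence
`U^s(a v₁, b v₂) = a U₁^s(v₁) ⊕ b U₂^s(v₂)` (`IsStableLimit.rescale`, `IsStableLimit.prod`), and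
`a tr U₁^s(v₁) + b tr U₂^s(v₂)` does not depend on `(a, b)` if the product is asymptotically
harmonic. This is only possible if both traces, and with them the constant, vanish.

The sum above has to be read on the full tangent spaces: the complement of `(a v₁, b v₂)` is larger
by one dimension than the sum of the complements of `v₁` and `v₂`. The limit of `E_T'(0)` on the
full tangent space is therefore considered (`IsStableLimit`); it takes its values in the complement
of the velocity, so its trace is that of its restriction `U^s` (`trStable_eq_trace`).

For this to be a statement about the limits themselves, and not about the default value of
`stableRiccati`, existence and uniqueness of all the objects involved are needed.
* The metrics in two charts are related by the transition map; this gives the transformation laws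
  of the Christoffel symbols and of the curvature (`chris_transform`, `riem_transform`), so
  that the covariant derivative and the curvature can be computed in any chart (`coords_covDeriv`,
  `dchart_curvature`).
* In a parallel frame (`exists_parallelTransport`) the Jacobi equation becomes `y'' + R y = 0` on
  the fixed vector space `E`, with `R` symmetric for the metric at the initial point
  (`IsParallelTransport.isJacobiField_iff`, `curvature_jacobi_symm`).
* Without conjugate points, `T ↦ E_T'(0)` is increasing as a quadratic form for `T > 0`, and
  bounded above by `E_{-1}'(0)` (`IsTensorTo.form_le`). Hence it converges (Green), see
  `exists_stable_limit`.
* A geodesic is determined by its initial velocity (`IsGeodesic.eq`), and a Jacobi field by its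
  values at two times (`IsJacobiField.eq_of_eq`).
-/


open Manifold Bundle Filter Topology
open scoped ContDiff

noncomputable section

namespace RiemGeom

/-! ### Riemannian metrics on open subsets of a vector space -/

section ChartCalculus

set_option linter.unusedSectionVars false

theorem minSmoothness_two_le_infty : minSmoothness ℝ 2 ≤ (∞ : WithTop ℕ∞) := by
  rw [minSmoothness_of_isRCLikeNormedField]
  exact WithTop.coe_le_coe.2 (le_top : (2 : ℕ∞) ≤ ⊤)

variable {E : Type*} [NormedAddCommGroup E] [NormedSpace ℝ E]

/-- A smooth Riemannian metric on the open subset `U` of a vector space. -/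
structure IsMetricOn (G : E → E →L[ℝ] E →L[ℝ] ℝ) (U : Set E) : Prop where
  isOpen : IsOpen U
  smooth : ContDiffOn ℝ ∞ G U
  symm : ∀ y ∈ U, ∀ v w, G y v w = G y w v
  pos : ∀ y ∈ U, ∀ v, v ≠ 0 → 0 < G y v v

theorem IsMetricOn.contDiffAt {G : E → E →L[ℝ] E →L[ℝ] ℝ} {U : Set E} (h : IsMetricOn G U)
    {y : E} (hy : y ∈ U) : ContDiffAt ℝ ∞ G y :=
  (h.smooth y hy).contDiffAt (h.isOpen.mem_nhds hy)

/-- The product rule for `x ↦ c x (a x) (b x)`. -/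
theorem fderiv_clm_apply₂ {X F₁ F₂ F₃ : Type*} [NormedAddCommGroup X] [NormedSpace ℝ X]
    [NormedAddCommGroup F₁] [NormedSpace ℝ F₁] [NormedAddCommGroup F₂] [NormedSpace ℝ F₂]
    [NormedAddCommGroup F₃] [NormedSpace ℝ F₃] {c : X → F₁ →L[ℝ] F₂ →L[ℝ] F₃} {a : X → F₁}
    {b : X → F₂} {y : X} (hc : DifferentiableAt ℝ c y) (ha : DifferentiableAt ℝ a y)
    (hb : DifferentiableAt ℝ b y) (u : X) :
    fderiv ℝ (fun x => c x (a x) (b x)) y u = fderiv ℝ c y u (a y) (b y)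
      + c y (fderiv ℝ a y u) (b y) + c y (a y) (fderiv ℝ b y u) := by
  rw [((hc.hasFDerivAt.clm_apply ha.hasFDerivAt).clm_apply hb.hasFDerivAt).fderiv]
  simp
  abel

theorem fderiv_clm_apply_const₂ {X F₁ F₂ F₃ : Type*} [NormedAddCommGroup X] [NormedSpace ℝ X]
    [NormedAddCommGroup F₁] [NormedSpace ℝ F₁] [NormedAddCommGroup F₂] [NormedSpace ℝ F₂]
    [NormedAddCommGroup F₃] [NormedSpace ℝ F₃] {c : X → F₁ →L[ℝ] F₂ →L[ℝ] F₃} {y : X}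
    (hc : DifferentiableAt ℝ c y) (u : X) (a : F₁) (b : F₂) :
    fderiv ℝ (fun x => c x a b) y u = fderiv ℝ c y u a b := by
  rw [fderiv_clm_apply₂ hc (differentiableAt_const a) (differentiableAt_const b)]
  simp

theorem differentiableAt_clm_apply₂ {X F₁ F₂ F₃ : Type*} [NormedAddCommGroup X] [NormedSpace ℝ X]
    [NormedAddCommGroup F₁] [NormedSpace ℝ F₁] [NormedAddCommGroup F₂] [NormedSpace ℝ F₂]
    [NormedAddCommGroup F₃] [NormedSpace ℝ F₃] {c : X → F₁ →L[ℝ] F₂ →L[ℝ] F₃} {a : X → F₁}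
    {b : X → F₂} {y : X} (hc : DifferentiableAt ℝ c y) (ha : DifferentiableAt ℝ a y)
    (hb : DifferentiableAt ℝ b y) : DifferentiableAt ℝ (fun x => c x (a x) (b x)) y :=
  (hc.clm_apply ha).clm_apply hb

theorem fderiv_clm_apply₁ {X F₁ F₂ : Type*} [NormedAddCommGroup X] [NormedSpace ℝ X]
    [NormedAddCommGroup F₁] [NormedSpace ℝ F₁] [NormedAddCommGroup F₂] [NormedSpace ℝ F₂]
    {c : X → F₁ →L[ℝ] F₂} {a : X → F₁} {y : X} (hc : DifferentiableAt ℝ c y)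
    (ha : DifferentiableAt ℝ a y) (u : X) :
    fderiv ℝ (fun x => c x (a x)) y u = fderiv ℝ c y u (a y) + c y (fderiv ℝ a y u) := by
  rw [(hc.hasFDerivAt.clm_apply ha.hasFDerivAt).fderiv]
  simp
  abel

theorem fderiv_comp_apply {X Y F : Type*} [NormedAddCommGroup X] [NormedSpace ℝ X]
    [NormedAddCommGroup Y] [NormedSpace ℝ Y] [NormedAddCommGroup F] [NormedSpace ℝ F]
    {c : Y → F} {f : X → Y} {y : X} (hc : DifferentiableAt ℝ c (f y))
    (hf : DifferentiableAt ℝ f y) (u : X) :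
    fderiv ℝ (fun x => c (f x)) y u = fderiv ℝ c (f y) (fderiv ℝ f y u) := by
  have := fderiv_comp y hc hf
  exact DFunLike.congr_fun this u

set_option synthInstance.maxHeartbeats 200000 in
theorem fderiv_clm_comp_apply₂ {X Y F₁ F₂ F₃ : Type*} [NormedAddCommGroup X] [NormedSpace ℝ X]
    [NormedAddCommGroup Y] [NormedSpace ℝ Y] [NormedAddCommGroup F₁] [NormedSpace ℝ F₁]
    [NormedAddCommGroup F₂] [NormedSpace ℝ F₂] [NormedAddCommGroup F₃] [NormedSpace ℝ F₃]
    {c : Y → F₁ →L[ℝ] F₂ →L[ℝ] F₃} {f : X → Y} {a : X → F₁} {b : X → F₂} {y : X}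
    (hc : DifferentiableAt ℝ c (f y)) (hf : DifferentiableAt ℝ f y)
    (ha : DifferentiableAt ℝ a y) (hb : DifferentiableAt ℝ b y) (u : X) :
    fderiv ℝ (fun x => c (f x) (a x) (b x)) y u = fderiv ℝ c (f y) (fderiv ℝ f y u) (a y) (b y)
      + c (f y) (fderiv ℝ a y u) (b y) + c (f y) (a y) (fderiv ℝ b y u) := by
  have e := fderiv_comp_apply (F := F₁ →L[ℝ] F₂ →L[ℝ] F₃) hc hf u
  have hcf : DifferentiableAt ℝ (c ∘ f) y :=
    DifferentiableAt.comp (G := F₁ →L[ℝ] F₂ →L[ℝ] F₃) y hc hf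
  change fderiv ℝ (fun x => (c ∘ f) x (a x) (b x)) y u = _
  rw [fderiv_clm_apply₂ hcf ha hb, ← e]
  rfl

section Trilinear

variable (G : E → E →L[ℝ] E →L[ℝ] ℝ) (y a b v w : E) (c : ℝ)

theorem fderiv_apply_add₁ : fderiv ℝ G y (a + b) v w = fderiv ℝ G y a v w + fderiv ℝ G y b v w := by
  rw [(fderiv ℝ G y).map_add a b]; rfl

theorem fderiv_apply_add₂ : fderiv ℝ G y v (a + b) w = fderiv ℝ G y v a w + fderiv ℝ G y v b w := by
  rw [(fderiv ℝ G y v).map_add a b]; rfl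

theorem fderiv_apply_add₃ : fderiv ℝ G y v w (a + b) = fderiv ℝ G y v w a + fderiv ℝ G y v w b :=
  (fderiv ℝ G y v w).map_add a b

theorem fderiv_apply_smul₁ : fderiv ℝ G y (c • a) v w = c * fderiv ℝ G y a v w := by
  rw [(fderiv ℝ G y).map_smul c a]; rfl

theorem fderiv_apply_smul₂ : fderiv ℝ G y v (c • a) w = c * fderiv ℝ G y v a w := by
  rw [(fderiv ℝ G y v).map_smul c a]; rfl

theorem fderiv_apply_smul₃ : fderiv ℝ G y v w (c • a) = c * fderiv ℝ G y v w a :=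
  (fderiv ℝ G y v w).map_smul c a

end Trilinear

variable [FiniteDimensional ℝ E]

/-- The Christoffel symbols of the first kind. The linear form is bundled by hand, with continuity
from the finite dimension; it is definitionally the form `christoffelFirst` of a metric in a chart. -/
def chrisFirst (G : E → E →L[ℝ] E →L[ℝ] ℝ) (y v w : E) : E →L[ℝ] ℝ :=
  LinearMap.toContinuousLinearMap
    { toFun := fun z =>
        (1 / 2 : ℝ) * (fderiv ℝ G y v w z + fderiv ℝ G y w v z - fderiv ℝ G y z v w)
      map_add' := fun a b => by
        rw [fderiv_apply_add₁, fderiv_apply_add₃, fderiv_apply_add₃]; ring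
      map_smul' := fun c a => by
        rw [fderiv_apply_smul₁, fderiv_apply_smul₃, fderiv_apply_smul₃, RingHom.id_apply]; ring }

theorem chrisFirst_apply (G : E → E →L[ℝ] E →L[ℝ] ℝ) (y v w z : E) :
    chrisFirst G y v w z =
      (1 / 2 : ℝ) * (fderiv ℝ G y v w z + fderiv ℝ G y w v z - fderiv ℝ G y z v w) := rfl

theorem chrisFirst_add_left (G : E → E →L[ℝ] E →L[ℝ] ℝ) (y a b w : E) :
    chrisFirst G y (a + b) w = chrisFirst G y a w + chrisFirst G y b w := by
  ext z
  rw [add_apply, chrisFirst_apply, chrisFirst_apply, chrisFirst_apply, fderiv_apply_add₁,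
    fderiv_apply_add₂, fderiv_apply_add₂]
  ring

theorem chrisFirst_add_right (G : E → E →L[ℝ] E →L[ℝ] ℝ) (y w a b : E) :
    chrisFirst G y w (a + b) = chrisFirst G y w a + chrisFirst G y w b := by
  ext z
  rw [add_apply, chrisFirst_apply, chrisFirst_apply, chrisFirst_apply, fderiv_apply_add₁,
    fderiv_apply_add₂, fderiv_apply_add₃]
  ring

theorem chrisFirst_smul_left (G : E → E →L[ℝ] E →L[ℝ] ℝ) (y : E) (c : ℝ) (a w : E) :
    chrisFirst G y (c • a) w = c • chrisFirst G y a w := by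
  ext z
  rw [smul_apply, chrisFirst_apply, chrisFirst_apply, fderiv_apply_smul₁,
    fderiv_apply_smul₂, fderiv_apply_smul₂, smul_eq_mul]
  ring

theorem chrisFirst_smul_right (G : E → E →L[ℝ] E →L[ℝ] ℝ) (y w : E) (c : ℝ) (a : E) :
    chrisFirst G y w (c • a) = c • chrisFirst G y w a := by
  ext z
  rw [smul_apply, chrisFirst_apply, chrisFirst_apply, fderiv_apply_smul₁,
    fderiv_apply_smul₂, fderiv_apply_smul₃, smul_eq_mul]
  ring

/-- The Christoffel symbols of the second kind as a bundled bilinear map. Where `G y` is not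
invertible its `inverse` is `0`, hence so is `chris G y`. -/
def chris (G : E → E →L[ℝ] E →L[ℝ] ℝ) (y : E) : E →L[ℝ] E →L[ℝ] E :=
  LinearMap.toContinuousLinearMap
    { toFun := fun v => LinearMap.toContinuousLinearMap
        { toFun := fun w => (G y).inverse (chrisFirst G y v w)
          map_add' := fun a b => by rw [chrisFirst_add_right, map_add]
          map_smul' := fun c a => by rw [chrisFirst_smul_right, map_smul, RingHom.id_apply] }
      map_add' := fun a b => by
        ext w
        change (G y).inverse (chrisFirst G y (a + b) w) =
          (G y).inverse (chrisFirst G y a w) + (G y).inverse (chrisFirst G y b w)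
        rw [chrisFirst_add_left, map_add]
      map_smul' := fun c a => by
        ext w
        change (G y).inverse (chrisFirst G y (c • a) w) = c • (G y).inverse (chrisFirst G y a w)
        rw [chrisFirst_smul_left, map_smul] }

/-- The curvature expression `R(u, v) w` of a field of bilinear maps `Γ`. -/
def riem (Γ : E → E →L[ℝ] E →L[ℝ] E) (y u v w : E) : E :=
  fderiv ℝ Γ y u v w - fderiv ℝ Γ y v u w + Γ y u (Γ y v w) - Γ y v (Γ y u w)

theorem chris_apply (G : E → E →L[ℝ] E →L[ℝ] ℝ) (y v w : E) :
    chris G y v w = (G y).inverse (chrisFirst G y v w) := rfl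

/-- A positive definite form on a finite-dimensional space as an isomorphism with the dual. -/
theorem isInvertible_of_pos {B : E →L[ℝ] E →L[ℝ] ℝ}
    (pos : ∀ v, v ≠ 0 → 0 < B v v) : B.IsInvertible := by
  have hinj : Function.Injective (B : E →ₗ[ℝ] (E →L[ℝ] ℝ)) := by
    rw [← LinearMap.ker_eq_bot, LinearMap.ker_eq_bot']
    intro v hv
    by_contra hne
    have := pos v hne
    have hv' : B v = 0 := hv
    rw [hv'] at this
    simp at this
  have hdim : Module.finrank ℝ E = Module.finrank ℝ (E →L[ℝ] ℝ) := by
    rw [← (LinearMap.toContinuousLinearMap (𝕜 := ℝ) (E := E) (F' := ℝ)).finrank_eq]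
    exact (Subspace.dual_finrank_eq (K := ℝ) (V := E)).symm
  let e : E ≃ₗ[ℝ] (E →L[ℝ] ℝ) := LinearEquiv.ofInjectiveOfFinrankEq _ hinj hdim
  exact ⟨e.toContinuousLinearEquiv, by ext v; rfl⟩

theorem inverse_unique {B : E →L[ℝ] E →L[ℝ] ℝ} (hB : B.IsInvertible) {φ : E →L[ℝ] ℝ} {u : E}
    (h : ∀ z, B u z = φ z) : B.inverse φ = u := by
  obtain ⟨e, rfl⟩ := hB
  rw [ContinuousLinearMap.inverse_equiv]
  exact (e.symm_apply_eq).2 (ContinuousLinearMap.ext fun z => (h z).symm)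

theorem inverse_spec {B : E →L[ℝ] E →L[ℝ] ℝ} (hB : B.IsInvertible) (φ : E →L[ℝ] ℝ) :
    B (B.inverse φ) = φ := by
  obtain ⟨e, rfl⟩ := hB
  rw [ContinuousLinearMap.inverse_equiv]
  exact e.apply_symm_apply φ

theorem form_ext {B : E →L[ℝ] E →L[ℝ] ℝ} (pos : ∀ v, v ≠ 0 → 0 < B v v) {u v : E}
    (h : ∀ z, B u z = B v z) : u = v := by
  by_contra hne
  have h1 := pos (u - v) (sub_ne_zero.2 hne)
  have h2 := h (u - v)
  simp only [map_sub, sub_apply] at h1 h2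
  linarith

variable {G : E → E →L[ℝ] E →L[ℝ] ℝ} {U : Set E} {y : E}

theorem IsMetricOn.isInvertible (h : IsMetricOn G U) (hy : y ∈ U) :
    (G y).IsInvertible := isInvertible_of_pos (h.pos y hy)

/-- The Koszul formula in a chart. -/
theorem IsMetricOn.koszul (h : IsMetricOn G U) (hy : y ∈ U) (v w z : E) :
    G y (chris G y v w) z =
      (1 / 2 : ℝ) * (fderiv ℝ G y v w z + fderiv ℝ G y w v z - fderiv ℝ G y z v w) := by
  rw [chris_apply, inverse_spec (h.isInvertible hy), chrisFirst_apply]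

theorem IsMetricOn.fderiv_symm (h : IsMetricOn G U) (hy : y ∈ U) (u v w : E) :
    fderiv ℝ G y u v w = fderiv ℝ G y u w v := by
  have hd : DifferentiableAt ℝ G y := (h.contDiffAt hy).differentiableAt (by simp)
  rw [← fderiv_clm_apply_const₂ hd, ← fderiv_clm_apply_const₂ hd]
  congr 1
  apply Filter.EventuallyEq.fderiv_eq
  filter_upwards [h.isOpen.mem_nhds hy] with x hx using h.symm x hx v w

theorem IsMetricOn.chris_symm (h : IsMetricOn G U) (hy : y ∈ U) (v w : E) :
    chris G y v w = chris G y w v := by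
  refine form_ext (h.pos y hy) fun z => ?_
  rw [h.koszul hy, h.koszul hy, h.fderiv_symm hy z v w]
  ring

/-- Compatibility of the Levi-Civita connection with the metric. -/
theorem IsMetricOn.compat (h : IsMetricOn G U) (hy : y ∈ U) (u v w : E) :
    fderiv ℝ G y u v w = G y (chris G y u v) w + G y v (chris G y u w) := by
  rw [h.symm y hy v, h.koszul hy, h.koszul hy, h.fderiv_symm hy u w v, h.fderiv_symm hy v u w,
    h.fderiv_symm hy w u v]
  ring

theorem contDiffAt_fderiv_apply₂ (h : IsMetricOn G U) (hy : y ∈ U) (a b c : E) :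
    ContDiffAt ℝ ∞ (fun x => fderiv ℝ G x a b c) y := by
  have h1 : ContDiffAt ℝ ∞ (fun x => fderiv ℝ (fun x => G x b c) x a) y := by
    have h2 : ContDiffAt ℝ ∞ (fun x => G x b c) y :=
      ((h.contDiffAt hy).clm_apply contDiffAt_const).clm_apply contDiffAt_const
    exact (h2.fderiv_right (m := ∞) (by simp)).clm_apply contDiffAt_const
  refine h1.congr_of_eventuallyEq ?_
  filter_upwards [h.isOpen.mem_nhds hy] with x hx
  exact (fderiv_clm_apply_const₂ ((h.contDiffAt hx).differentiableAt (by simp)) a b c).symm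

/-- A family of linear maps on a finite-dimensional space is smooth if it is smooth pointwise. -/
theorem contDiffAt_clm_of_apply {X F₁ F₂ : Type*} [NormedAddCommGroup X] [NormedSpace ℝ X]
    [NormedAddCommGroup F₁] [NormedSpace ℝ F₁] [FiniteDimensional ℝ F₁]
    [NormedAddCommGroup F₂] [NormedSpace ℝ F₂] {n : WithTop ℕ∞} {c : X → F₁ →L[ℝ] F₂} {y : X}
    (h : ∀ a, ContDiffAt ℝ n (fun x => c x a) y) : ContDiffAt ℝ n c y := by
  let e : (F₁ →L[ℝ] F₂) ≃L[ℝ] (Fin (Module.finrank ℝ F₁) → F₂) :=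
    (ContinuousLinearEquiv.arrowCongr (ContinuousLinearEquiv.ofFinrankEq (by simp))
      (1 : F₂ ≃L[ℝ] F₂)).trans (ContinuousLinearEquiv.piRing (Fin (Module.finrank ℝ F₁)))
  rw [← Function.id_comp c, ← e.symm_comp_self]
  exact e.symm.contDiff.contDiffAt.comp y (contDiffAt_pi.2 fun i => h _)

theorem contDiffAt_chris (h : IsMetricOn G U) (hy : y ∈ U) :
    ContDiffAt ℝ ∞ (chris G) y := by
  refine contDiffAt_clm_of_apply fun v => contDiffAt_clm_of_apply fun w => ?_
  have h1 : ContDiffAt ℝ ∞ (fun x => chrisFirst G x v w) y := by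
    refine contDiffAt_clm_of_apply fun z => ?_
    exact contDiffAt_const.mul (((contDiffAt_fderiv_apply₂ h hy v w z).add
      (contDiffAt_fderiv_apply₂ h hy w v z)).sub (contDiffAt_fderiv_apply₂ h hy z v w))
  have h2 : ContDiffAt ℝ ∞ (fun x => (G x).inverse) y := by
    have := (h.isInvertible hy).contDiffAt_map_inverse (n := ∞)
    exact this.comp y (h.contDiffAt hy)
  exact h2.clm_apply h1

/-- Change of coordinates for Christoffel symbols. -/
theorem chris_transform {G' : E → E →L[ℝ] E →L[ℝ] ℝ} {U' : Set E}
    (h : IsMetricOn G U) (h' : IsMetricOn G' U') {f : E → E} (hf : ContDiffAt ℝ ∞ f y)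
    (hy : y ∈ U) (hy' : f y ∈ U')
    (hG : ∀ᶠ x in 𝓝 y, ∀ a b, G x a b = G' (f x) (fderiv ℝ f x a) (fderiv ℝ f x b))
    (hsurj : Function.Surjective (fderiv ℝ f y)) (v w : E) :
    chris G' (f y) (fderiv ℝ f y v) (fderiv ℝ f y w) =
      fderiv ℝ f y (chris G y v w) - fderiv ℝ (fderiv ℝ f) y v w := by
  have hdf : DifferentiableAt ℝ f y := hf.differentiableAt (by simp)
  have hd2 : DifferentiableAt ℝ (fderiv ℝ f) y :=
    (hf.fderiv_right (m := ∞) (by simp)).differentiableAt (by simp)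
  have hda : ∀ a, DifferentiableAt ℝ (fun x => fderiv ℝ f x a) y := fun a =>
    hd2.clm_apply (differentiableAt_const a)
  have hfa : ∀ u a, fderiv ℝ (fun x => fderiv ℝ f x a) y u = fderiv ℝ (fderiv ℝ f) y u a := by
    intro u a
    rw [fderiv_clm_apply₁ hd2 (differentiableAt_const a), fderiv_fun_const, Pi.zero_apply,
      zero_apply, map_zero, add_zero]
  have hs : ∀ a b, fderiv ℝ (fderiv ℝ f) y a b = fderiv ℝ (fderiv ℝ f) y b a := fun a b =>
    (hf.isSymmSndFDerivAt minSmoothness_two_le_infty).eq a b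
  have hdG : DifferentiableAt ℝ G y := (h.contDiffAt hy).differentiableAt (by simp)
  have hdG' : DifferentiableAt ℝ G' (f y) := (h'.contDiffAt hy').differentiableAt (by simp)
  have key : ∀ u a b, fderiv ℝ G y u a b =
      fderiv ℝ G' (f y) (fderiv ℝ f y u) (fderiv ℝ f y a) (fderiv ℝ f y b)
      + G' (f y) (fderiv ℝ (fderiv ℝ f) y u a) (fderiv ℝ f y b)
      + G' (f y) (fderiv ℝ f y a) (fderiv ℝ (fderiv ℝ f) y u b) := by
    intro u a b
    rw [← fderiv_clm_apply_const₂ hdG u a b]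
    have h3 : (fun x => G x a b) =ᶠ[𝓝 y]
        fun x => G' (f x) (fderiv ℝ f x a) (fderiv ℝ f x b) := by
      filter_upwards [hG] with x hx using hx a b
    rw [h3.fderiv_eq, fderiv_clm_comp_apply₂ hdG' hdf (hda a) (hda b), hfa, hfa]
  refine form_ext (h'.pos _ hy') fun z' => ?_
  obtain ⟨z, rfl⟩ := hsurj z'
  have e1 := h'.koszul hy' (fderiv ℝ f y v) (fderiv ℝ f y w) (fderiv ℝ f y z)
  have e2 := h.koszul hy v w z
  rw [hG.self_of_nhds, key v w z, key w v z, key z v w] at e2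
  rw [map_sub, sub_apply, e1, e2, hs w v, hs z v, hs z w,
    h'.symm _ hy' (fderiv ℝ f y v) (fderiv ℝ (fderiv ℝ f) y w z),
    h'.symm _ hy' (fderiv ℝ f y w) (fderiv ℝ (fderiv ℝ f) y v z)]
  ring

/-- The curvature is a tensor: it is compatible with changes of coordinates. -/
theorem riem_transform {G' : E → E →L[ℝ] E →L[ℝ] ℝ} {U' : Set E}
    (h : IsMetricOn G U) (h' : IsMetricOn G' U') {f : E → E} (hfe : ∀ᶠ x in 𝓝 y, ContDiffAt ℝ ∞ f x)
    (hy : y ∈ U) (hy' : f y ∈ U')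
    (hG : ∀ᶠ x in 𝓝 y, ∀ a b, G x a b = G' (f x) (fderiv ℝ f x a) (fderiv ℝ f x b))
    (hsurj : ∀ᶠ x in 𝓝 y, Function.Surjective (fderiv ℝ f x)) (u v w : E) :
    riem (chris G') (f y) (fderiv ℝ f y u) (fderiv ℝ f y v) (fderiv ℝ f y w) =
      fderiv ℝ f y (riem (chris G) y u v w) := by
  have hf := hfe.self_of_nhds
  have hdf : DifferentiableAt ℝ f y := hf.differentiableAt (by simp)
  have hf1 : ContDiffAt ℝ ∞ (fderiv ℝ f) y := hf.fderiv_right (m := ∞) (by simp)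
  have hfa : ∀ a, ContDiffAt ℝ ∞ (fun x => fderiv ℝ f x a) y := fun a =>
    hf1.clm_apply contDiffAt_const
  have hd2 : DifferentiableAt ℝ (fderiv ℝ f) y := hf1.differentiableAt (by simp)
  have ev1 : ∀ᶠ x in 𝓝 y, ∀ u a, fderiv ℝ (fun x => fderiv ℝ f x a) x u =
      fderiv ℝ (fderiv ℝ f) x u a := by
    filter_upwards [hfe] with x hx u a
    rw [fderiv_clm_apply₁ ((hx.fderiv_right (m := ∞) (by simp)).differentiableAt (by simp)) (differentiableAt_const a),
      fderiv_fun_const, Pi.zero_apply, zero_apply, map_zero, add_zero]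
  have dfa := ev1.self_of_nhds
  have hs : ∀ a b, fderiv ℝ (fderiv ℝ f) y a b = fderiv ℝ (fderiv ℝ f) y b a := fun a b =>
    (hf.isSymmSndFDerivAt minSmoothness_two_le_infty).eq a b
  have hd3 : ∀ b c, DifferentiableAt ℝ (fun x => fderiv ℝ (fderiv ℝ f) x b c) y := by
    intro b c
    have : DifferentiableAt ℝ (fun x => fderiv ℝ (fun x => fderiv ℝ f x c) x b) y :=
      (((hfa c).fderiv_right (m := ∞) (by simp)).clm_apply contDiffAt_const).differentiableAt
        (by simp)
    refine this.congr_of_eventuallyEq ?_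
    filter_upwards [ev1] with x hx using (hx b c).symm
  -- third derivatives of `f` are symmetric in the first two arguments
  have hs3 : ∀ a b c, fderiv ℝ (fun x => fderiv ℝ (fderiv ℝ f) x b c) y a =
      fderiv ℝ (fun x => fderiv ℝ (fderiv ℝ f) x a c) y b := by
    intro a b c
    have e : ∀ a b, fderiv ℝ (fun x => fderiv ℝ (fderiv ℝ f) x b c) y a =
        fderiv ℝ (fderiv ℝ (fun x => fderiv ℝ f x c)) y a b := by
      intro a b
      have : (fun x => fderiv ℝ (fderiv ℝ f) x b c) =ᶠ[𝓝 y]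
          fun x => fderiv ℝ (fun x => fderiv ℝ f x c) x b := by
        filter_upwards [ev1] with x hx using (hx b c).symm
      rw [this.fderiv_eq, fderiv_clm_apply₁
        (((hfa c).fderiv_right (m := ∞) (by simp)).differentiableAt (by simp))
        (differentiableAt_const b)]
      simp
    rw [e, e]
    exact ((hfa c).isSymmSndFDerivAt minSmoothness_two_le_infty).eq a b
  have hΓ : DifferentiableAt ℝ (chris G) y := (contDiffAt_chris h hy).differentiableAt (by simp)
  have hΓ' : DifferentiableAt ℝ (chris G') (f y) :=
    (contDiffAt_chris h' hy').differentiableAt (by simp)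
  -- the transformation law of the Christoffel symbols holds near `y`; `key` is its derivative at `y`
  have tr : ∀ᶠ x in 𝓝 y, ∀ v w, chris G' (f x) (fderiv ℝ f x v) (fderiv ℝ f x w) =
      fderiv ℝ f x (chris G x v w) - fderiv ℝ (fderiv ℝ f) x v w := by
    filter_upwards [hG.eventually_nhds, hsurj, h.isOpen.mem_nhds hy, hfe,
      hf.continuousAt.preimage_mem_nhds (h'.isOpen.mem_nhds hy')] with x h1 h2 h3 h4 h5 v w
    exact chris_transform h h' h4 h3 h5 h1 h2 v w
  have tr0 := tr.self_of_nhds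
  have key : ∀ a b c,
      fderiv ℝ (chris G') (f y) (fderiv ℝ f y a) (fderiv ℝ f y b) (fderiv ℝ f y c)
      + chris G' (f y) (fderiv ℝ (fderiv ℝ f) y a b) (fderiv ℝ f y c)
      + chris G' (f y) (fderiv ℝ f y b) (fderiv ℝ (fderiv ℝ f) y a c) =
      fderiv ℝ (fderiv ℝ f) y a (chris G y b c) + fderiv ℝ f y (fderiv ℝ (chris G) y a b c)
      - fderiv ℝ (fun x => fderiv ℝ (fderiv ℝ f) x b c) y a := by
    intro a b c
    have h1 : (fun x => chris G' (f x) (fderiv ℝ f x b) (fderiv ℝ f x c)) =ᶠ[𝓝 y]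
        fun x => fderiv ℝ f x (chris G x b c) - fderiv ℝ (fderiv ℝ f) x b c := by
      filter_upwards [tr] with x hx using hx b c
    have h2 := DFunLike.congr_fun (h1.fderiv_eq (𝕜 := ℝ)) a
    have hb : ∀ b, DifferentiableAt ℝ (fun x => fderiv ℝ f x b) y := fun b =>
      (hfa b).differentiableAt (by simp)
    have hc : DifferentiableAt ℝ (fun x => chris G x b c) y :=
      differentiableAt_clm_apply₂ hΓ (differentiableAt_const b) (differentiableAt_const c)
    rw [fderiv_clm_comp_apply₂ hΓ' hdf (hb b) (hb c), dfa, dfa,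
      fderiv_fun_sub (hd2.clm_apply hc) (hd3 b c), _root_.sub_apply,
      fderiv_clm_apply₁ hd2 hc, fderiv_clm_apply_const₂ hΓ] at h2
    exact h2
  have k1 := key u v w
  have k2 := key v u w
  rw [hs v u, hs3 v u] at k2
  have k := congrArg₂ (fun p q : E => p - q) k1 k2
  unfold riem
  rw [tr0 v w, tr0 u w, map_sub, map_sub, tr0 u, tr0 v]
  simp only [map_add, map_sub]
  generalize fderiv ℝ (chris G') (f y) (fderiv ℝ f y u) (fderiv ℝ f y v) (fderiv ℝ f y w) = A1 at *
  generalize fderiv ℝ (chris G') (f y) (fderiv ℝ f y v) (fderiv ℝ f y u) (fderiv ℝ f y w) = A2 at *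
  -- `k` computes `A1 - A2` up to terms which cancel against those from the quadratic part of `riem`
  have k' : A1 - A2 = (A1 + chris G' (f y) (fderiv ℝ (fderiv ℝ f) y u v) (fderiv ℝ f y w)
      + chris G' (f y) (fderiv ℝ f y v) (fderiv ℝ (fderiv ℝ f) y u w)
      - (A2 + chris G' (f y) (fderiv ℝ (fderiv ℝ f) y u v) (fderiv ℝ f y w)
      + chris G' (f y) (fderiv ℝ f y u) (fderiv ℝ (fderiv ℝ f) y v w)))
      - chris G' (f y) (fderiv ℝ f y v) (fderiv ℝ (fderiv ℝ f) y u w)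
      + chris G' (f y) (fderiv ℝ f y u) (fderiv ℝ (fderiv ℝ f) y v w) := by abel
  rw [k', k]
  abel

theorem riem_swap (Γ : E → E →L[ℝ] E →L[ℝ] E) (y u v w : E) :
    riem Γ y u v w = - riem Γ y v u w := by
  unfold riem; abel

/-- The first Bianchi identity, from the symmetry of the Christoffel symbols. -/
theorem riem_bianchi (h : IsMetricOn G U) (hy : y ∈ U) (u v w : E) :
    riem (chris G) y u v w + riem (chris G) y v w u + riem (chris G) y w u v = 0 := by
  have hΓ : DifferentiableAt ℝ (chris G) y := (contDiffAt_chris h hy).differentiableAt (by simp)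
  have ds : ∀ a b c, fderiv ℝ (chris G) y a b c = fderiv ℝ (chris G) y a c b := by
    intro a b c
    rw [← fderiv_clm_apply_const₂ hΓ, ← fderiv_clm_apply_const₂ hΓ]
    congr 1
    apply Filter.EventuallyEq.fderiv_eq
    filter_upwards [h.isOpen.mem_nhds hy] with x hx using h.chris_symm hx b c
  unfold riem
  rw [ds u w v, ds v u w, ds w v u, h.chris_symm hy v w, h.chris_symm hy u w, h.chris_symm hy u v]
  abel

/-- The curvature operator `R(u, v)` is skew-symmetric: the second derivative of `G w z` is symmetric,
and metric compatibility expresses it through the Christoffel symbols and their derivatives. -/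
theorem riem_skew (h : IsMetricOn G U) (hy : y ∈ U) (u v w z : E) :
    G y (riem (chris G) y u v w) z = - G y w (riem (chris G) y u v z) := by
  have hΓ : DifferentiableAt ℝ (chris G) y := (contDiffAt_chris h hy).differentiableAt (by simp)
  have hdG : DifferentiableAt ℝ G y := (h.contDiffAt hy).differentiableAt (by simp)
  set φ : E → ℝ := fun x => G x w z with hφ
  have hφs : ContDiffAt ℝ ∞ φ y :=
    ((h.contDiffAt hy).clm_apply contDiffAt_const).clm_apply contDiffAt_const
  have hs : ∀ a b, fderiv ℝ (fderiv ℝ φ) y a b = fderiv ℝ (fderiv ℝ φ) y b a := fun a b =>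
    (hφs.isSymmSndFDerivAt minSmoothness_two_le_infty).eq a b
  have hc : ∀ b c, DifferentiableAt ℝ (fun x => chris G x b c) y := fun b c =>
    differentiableAt_clm_apply₂ hΓ (differentiableAt_const b) (differentiableAt_const c)
  have key : ∀ a b, fderiv ℝ (fderiv ℝ φ) y a b =
      fderiv ℝ G y a (chris G y b w) z + G y (fderiv ℝ (chris G) y a b w) z
      + (fderiv ℝ G y a w (chris G y b z) + G y w (fderiv ℝ (chris G) y a b z)) := by
    intro a b
    have h0 : fderiv ℝ (fderiv ℝ φ) y a b = fderiv ℝ (fun x => fderiv ℝ φ x b) y a := by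
      rw [fderiv_clm_apply₁ ((hφs.fderiv_right (m := ∞) (by simp)).differentiableAt (by simp))
        (differentiableAt_const b)]
      simp
    have h1 : (fun x => fderiv ℝ φ x b) =ᶠ[𝓝 y]
        fun x => G x (chris G x b w) z + G x w (chris G x b z) := by
      filter_upwards [h.isOpen.mem_nhds hy] with x hx
      rw [hφ, fderiv_clm_apply_const₂ ((h.contDiffAt hx).differentiableAt (by simp)), h.compat hx]
    rw [h0, h1.fderiv_eq, fderiv_fun_add
      (differentiableAt_clm_apply₂ hdG (hc b w) (differentiableAt_const z))
      (differentiableAt_clm_apply₂ hdG (differentiableAt_const w) (hc b z)), add_apply,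
      fderiv_clm_apply₂ hdG (hc b w) (differentiableAt_const z),
      fderiv_clm_apply₂ hdG (differentiableAt_const w) (hc b z), fderiv_clm_apply_const₂ hΓ,
      fderiv_clm_apply_const₂ hΓ]
    simp
  have k1 := key u v
  have k2 := key v u
  rw [hs v u, k1, h.compat hy, h.compat hy, h.compat hy, h.compat hy] at k2
  unfold riem
  simp only [map_add, map_sub, add_apply, sub_apply]
  linarith

/-- The Jacobi operator `w ↦ R(w, v) v` is symmetric. -/
theorem riem_jacobi_symm (h : IsMetricOn G U) (hy : y ∈ U) (v w z : E) :
    G y (riem (chris G) y w v v) z = G y w (riem (chris G) y z v v) := by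
  set R := riem (chris G) y with hR
  have sk : ∀ a b c d, G y (R a b c) d = - G y (R a b d) c := fun a b c d => by
    rw [hR, riem_skew h hy, h.symm y hy c]
  have sw : ∀ a b c d, G y (R a b c) d = - G y (R b a c) d := fun a b c d => by
    rw [hR, riem_swap]; simp
  have bi : ∀ a b c d, G y (R a b c) d + G y (R b c a) d + G y (R c a b) d = 0 := by
    intro a b c d
    have := congrArg (fun x => G y x d) (riem_bianchi h hy a b c)
    simpa using this
  rw [h.symm y hy w]
  -- the pair symmetry of the curvature tensor is a combination of four Bianchi identities
  have b1 := bi w v v z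
  have b2 := bi v v z w
  have b3 := bi v z w v
  have b4 := bi z w v v
  have s1 := sk v v z w
  have s2 := sk z w v v
  have s3 := sw v v w z
  have s4 := sw v v z w
  have s5 := sw w v v z
  have s6 := sk v z w v
  have s7 := sk w v z v
  have s8 := sw z v v w
  have s9 := sk z v v w
  have s10 := sk w v v z
  linarith

end ChartCalculus

/-! ### The metric and the curvature in charts -/

section ManifoldCharts

set_option linter.unusedSectionVars false

variable {E : Type*} [NormedAddCommGroup E] [NormedSpace ℝ E]
  {M : Type*} [TopologicalSpace M] [ChartedSpace E M] [IsManifold 𝓘(ℝ, E) ∞ M]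

theorem contDiffAt_clm_apply₂ {X F₁ F₂ F₃ : Type*} [NormedAddCommGroup X] [NormedSpace ℝ X]
    [NormedAddCommGroup F₁] [NormedSpace ℝ F₁] [NormedAddCommGroup F₂] [NormedSpace ℝ F₂]
    [NormedAddCommGroup F₃] [NormedSpace ℝ F₃] {n : WithTop ℕ∞} {c : X → F₁ →L[ℝ] F₂ →L[ℝ] F₃}
    {a : X → F₁} {b : X → F₂} {y : X} (hc : ContDiffAt ℝ n c y) (ha : ContDiffAt ℝ n a y)
    (hb : ContDiffAt ℝ n b y) : ContDiffAt ℝ n (fun x => c x (a x) (b x)) y :=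
  (hc.clm_apply ha).clm_apply hb

/-- The differential at `x` of the preferred chart at `p`. -/
def dchart (p x : M) : TangentSpace 𝓘(ℝ, E) x →L[ℝ] E :=
  mfderiv 𝓘(ℝ, E) 𝓘(ℝ, E) (extChartAt 𝓘(ℝ, E) p) x

/-- The differential at `y` of the inverse of the preferred chart at `p`. -/
def dsymm (p : M) (y : E) : E →L[ℝ] TangentSpace 𝓘(ℝ, E) ((extChartAt 𝓘(ℝ, E) p).symm y) :=
  mfderiv 𝓘(ℝ, E) 𝓘(ℝ, E) (extChartAt 𝓘(ℝ, E) p).symm y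

/-- The transition map from the preferred chart at `p` to the one at `q`. -/
def transition (p q : M) : E → E :=
  fun y => extChartAt 𝓘(ℝ, E) q ((extChartAt 𝓘(ℝ, E) p).symm y)

theorem dchart_self (p : M) (v : TangentSpace 𝓘(ℝ, E) p) : dchart p p v = v := by
  unfold dchart
  rw [mfderiv_extChartAt_self]
  rfl

theorem isOpen_target (p : M) : IsOpen (extChartAt 𝓘(ℝ, E) p).target :=
  isOpen_extChartAt_target p

theorem dchart_symm {p : M} {y : E} (hy : y ∈ (extChartAt 𝓘(ℝ, E) p).target) (v : E) :
    dchart p ((extChartAt 𝓘(ℝ, E) p).symm y)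
      (dsymm p y v) = v := by
  have h := mfderiv_extChartAt_comp_mfderivWithin_extChartAt_symm (I := 𝓘(ℝ, E)) hy
  simp only [modelWithCornersSelf_coe, Set.range_id, mfderivWithin_univ] at h
  exact DFunLike.congr_fun h v

/-- Both sides belong to `E`, but to tangent spaces at points which are only propositionally equal:
this is why the equality is taken in `E`. -/
theorem symm_dchart {p x : M} (hx : x ∈ (extChartAt 𝓘(ℝ, E) p).source)
    (v : TangentSpace 𝓘(ℝ, E) x) :
    @Eq E (dsymm p (extChartAt 𝓘(ℝ, E) p x) (dchart p x v)) v := by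
  have h := mfderivWithin_extChartAt_symm_comp_mfderiv_extChartAt' (I := 𝓘(ℝ, E)) hx
  simp only [modelWithCornersSelf_coe, Set.range_id, mfderivWithin_univ] at h
  exact DFunLike.congr_fun h v

theorem dchart_injective {p x : M} (hx : x ∈ (extChartAt 𝓘(ℝ, E) p).source) :
    Function.Injective (dchart (E := E) p x) := fun v w h => by
  have h1 := symm_dchart hx v
  rw [h] at h1
  exact h1.symm.trans (symm_dchart hx w)

theorem dchart_surjective {p x : M} (hx : x ∈ (extChartAt 𝓘(ℝ, E) p).source) :
    Function.Surjective (dchart (E := E) p x) := fun v => by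
  have h := dchart_symm ((extChartAt 𝓘(ℝ, E) p).map_source hx) v
  rw [(extChartAt 𝓘(ℝ, E) p).left_inv hx] at h
  exact ⟨_, h⟩

theorem mdifferentiableAt_symm {p : M} {y : E} (hy : y ∈ (extChartAt 𝓘(ℝ, E) p).target) :
    MDifferentiableAt 𝓘(ℝ, E) 𝓘(ℝ, E) (extChartAt 𝓘(ℝ, E) p).symm y :=
  (mdifferentiableOn_extChartAt_symm (I := 𝓘(ℝ, E)) y hy).mdifferentiableAt
    ((isOpen_target p).mem_nhds hy)

theorem contDiffAt_transition {p q : M} {y : E} (hy : y ∈ (extChartAt 𝓘(ℝ, E) p).target)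
    (hq : (extChartAt 𝓘(ℝ, E) p).symm y ∈ (extChartAt 𝓘(ℝ, E) q).source) :
    ContDiffAt ℝ ∞ (transition (E := E) p q) y := by
  rw [← contMDiffAt_iff_contDiffAt]
  have h1 : ContMDiffAt 𝓘(ℝ, E) 𝓘(ℝ, E) ∞ (extChartAt 𝓘(ℝ, E) p).symm y :=
    (contMDiffOn_extChartAt_symm p y hy).contMDiffAt ((isOpen_target p).mem_nhds hy)
  have h2 : ContMDiffAt 𝓘(ℝ, E) 𝓘(ℝ, E) ∞ (extChartAt 𝓘(ℝ, E) q)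
      ((extChartAt 𝓘(ℝ, E) p).symm y) := contMDiffAt_extChartAt' (by simpa using hq)
  exact h2.comp y h1

theorem fderiv_transition {p q : M} {y : E} (hy : y ∈ (extChartAt 𝓘(ℝ, E) p).target)
    (hq : (extChartAt 𝓘(ℝ, E) p).symm y ∈ (extChartAt 𝓘(ℝ, E) q).source) (v : E) :
    fderiv ℝ (transition (E := E) p q) y v = dchart q ((extChartAt 𝓘(ℝ, E) p).symm y)
      (dsymm p y v) := by
  have h := mfderiv_comp y (mdifferentiableAt_extChartAt (I := 𝓘(ℝ, E)) (x := q) (by simpa using hq))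
    (mdifferentiableAt_symm hy)
  rw [← mfderiv_eq_fderiv]
  exact DFunLike.congr_fun h v

theorem fderiv_transition_dchart {p q x : M} (hp : x ∈ (extChartAt 𝓘(ℝ, E) p).source)
    (hq : x ∈ (extChartAt 𝓘(ℝ, E) q).source) (v : TangentSpace 𝓘(ℝ, E) x) :
    fderiv ℝ (transition (E := E) p q) (extChartAt 𝓘(ℝ, E) p x) (dchart p x v) = dchart q x v := by
  have hy := (extChartAt 𝓘(ℝ, E) p).map_source hp
  have hx := (extChartAt 𝓘(ℝ, E) p).left_inv hp
  rw [fderiv_transition hy (by rwa [hx])]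
  have : ∀ x', x' = x → ∀ (u : TangentSpace 𝓘(ℝ, E) x'), @Eq E u v →
      dchart (E := E) q x' u = dchart (E := E) q x v := by
    rintro _ rfl u h; exact congrArg _ h
  exact this _ hx _ (symm_dchart hp v)

theorem transition_apply {p x : M} (q : M) (hp : x ∈ (extChartAt 𝓘(ℝ, E) p).source) :
    transition (E := E) p q (extChartAt 𝓘(ℝ, E) p x) = extChartAt 𝓘(ℝ, E) q x := by
  unfold transition
  rw [(extChartAt 𝓘(ℝ, E) p).left_inv hp]

/-- The overlap of two charts, seen in the first one. -/
theorem eventually_overlap {p q x : M} (hp : x ∈ (extChartAt 𝓘(ℝ, E) p).source)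
    (hq : x ∈ (extChartAt 𝓘(ℝ, E) q).source) :
    ∀ᶠ y in 𝓝 (extChartAt 𝓘(ℝ, E) p x), y ∈ (extChartAt 𝓘(ℝ, E) p).target ∧
      (extChartAt 𝓘(ℝ, E) p).symm y ∈ (extChartAt 𝓘(ℝ, E) q).source := by
  have hy := (extChartAt 𝓘(ℝ, E) p).map_source hp
  have hc : ContinuousAt (extChartAt 𝓘(ℝ, E) p).symm (extChartAt 𝓘(ℝ, E) p x) :=
    (mdifferentiableAt_symm hy).continuousAt
  have h2 := hc.preimage_mem_nhds (t := (extChartAt 𝓘(ℝ, E) q).source) (by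
    rw [(extChartAt 𝓘(ℝ, E) p).left_inv hp]
    exact (isOpen_extChartAt_source q).mem_nhds hq)
  filter_upwards [(isOpen_target p).mem_nhds hy, h2] with y h h' using ⟨h, h'⟩

variable (g : SmoothMetric 𝓘(ℝ, E) M)

theorem metricInChart_apply (p : M) (y v w : E) : metricInChart g p y v w =
    g.inner ((extChartAt 𝓘(ℝ, E) p).symm y)
      (dsymm p y v) (dsymm p y w) := rfl

theorem metricInChart_dchart {p x : M} (hx : x ∈ (extChartAt 𝓘(ℝ, E) p).source)
    (v w : TangentSpace 𝓘(ℝ, E) x) :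
    metricInChart g p (extChartAt 𝓘(ℝ, E) p x) (dchart p x v) (dchart p x w) = g.inner x v w := by
  rw [metricInChart_apply]
  have : ∀ x', x' = x → ∀ u u' : TangentSpace 𝓘(ℝ, E) x', @Eq E u v → @Eq E u' w →
      g.inner x' u u' = g.inner x v w := by
    rintro _ rfl u u' h h'; exact congrArg₂ (fun a b => g.inner _ a b) h h'
  exact this _ ((extChartAt 𝓘(ℝ, E) p).left_inv hx) _ _ (symm_dchart hx v) (symm_dchart hx w)

/-- At the centre of the chart, smoothness is that of the section `g.inner` in the trivialization of
the bundle of bilinear forms which belongs to the chart. -/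
theorem contDiffAt_metricInChart_self (p : M) :
    ContDiffAt ℝ ∞ (metricInChart g p) (extChartAt 𝓘(ℝ, E) p p) := by
  have s1 := ((contMDiffAt_hom_bundle _).1 (g.contMDiff p)).2
  have hy := mem_extChartAt_target (I := 𝓘(ℝ, E)) p
  have h1 : ContMDiffAt 𝓘(ℝ, E) 𝓘(ℝ, E) ∞ (extChartAt 𝓘(ℝ, E) p).symm
      (extChartAt 𝓘(ℝ, E) p p) :=
    (contMDiffOn_extChartAt_symm p _ hy).contMDiffAt ((isOpen_target p).mem_nhds hy)
  have e0 : (extChartAt 𝓘(ℝ, E) p).symm (extChartAt 𝓘(ℝ, E) p p) = p := extChartAt_to_inv p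
  rw [← contMDiffAt_iff_contDiffAt]
  have s2 := ContMDiffAt.comp_of_eq s1 h1 e0
  refine s2.congr_of_eventuallyEq ?_
  filter_upwards [(isOpen_target p).mem_nhds hy] with y hy'
  have hx : (extChartAt 𝓘(ℝ, E) p).symm y ∈ (chartAt E p).source := by
    simpa using (extChartAt 𝓘(ℝ, E) p).map_target hy'
  refine ContinuousLinearMap.ext fun v => ContinuousLinearMap.ext fun w => ?_
  have e1 := inCoordinates_apply_eq₂ (ϕ := g.inner ((extChartAt 𝓘(ℝ, E) p).symm y))
      (v := v) (w := w)
      (F₁ := E) (F₂ := E) (F₃ := ℝ) (E₁ := fun y : M => TangentSpace 𝓘(ℝ, E) y)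
      (E₂ := fun y : M => TangentSpace 𝓘(ℝ, E) y) (E₃ := Bundle.Trivial M ℝ) (x₀ := p)
      (by simpa using hx) (by simpa using hx) (by simp)
  refine Eq.trans ?_ e1.symm
  have hs : ∀ u : E, (trivializationAt E (TangentSpace 𝓘(ℝ, E)) p).symm
      ((extChartAt 𝓘(ℝ, E) p).symm y) u = dsymm p y u := by
    intro u
    have h2 := TangentBundle.symmL_trivializationAt (I := 𝓘(ℝ, E)) hx
    have h3 := DFunLike.congr_fun h2 u
    rw [Trivialization.symmL_apply _ (by simpa using hx)] at h3
    rw [h3, (extChartAt 𝓘(ℝ, E) p).right_inv hy']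
    simp only [modelWithCornersSelf_coe, Set.range_id, mfderivWithin_univ]
    rfl
  rw [hs, hs]
  exact (congrArg (fun f : ℝ →ₗ[ℝ] ℝ => f _)
      (Bundle.Trivial.linearMapAt_trivialization ℝ M ℝ _)).symm

theorem metricInChart_transition {p q : M} {y : E} (hy : y ∈ (extChartAt 𝓘(ℝ, E) p).target)
    (hq : (extChartAt 𝓘(ℝ, E) p).symm y ∈ (extChartAt 𝓘(ℝ, E) q).source) (v w : E) :
    metricInChart g p y v w = metricInChart g q (transition p q y)
      (fderiv ℝ (transition (E := E) p q) y v) (fderiv ℝ (transition (E := E) p q) y w) := by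
  rw [fderiv_transition hy hq, fderiv_transition hy hq]
  exact (metricInChart_dchart g hq _ _).symm

variable [FiniteDimensional ℝ E]

/-- Away from the centre of the chart, the smoothness follows by passing to the chart which is
centred at the point. -/
theorem contDiffAt_metricInChart {p : M} {y : E} (hy : y ∈ (extChartAt 𝓘(ℝ, E) p).target) :
    ContDiffAt ℝ ∞ (metricInChart g p) y := by
  have hsrc : (extChartAt 𝓘(ℝ, E) p).symm y ∈ (extChartAt 𝓘(ℝ, E) p).source :=
    (extChartAt 𝓘(ℝ, E) p).map_target hy
  have hr := (extChartAt 𝓘(ℝ, E) p).right_inv hy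
  generalize (extChartAt 𝓘(ℝ, E) p).symm y = x at hsrc hr
  subst hr
  have ev := eventually_overlap hsrc (mem_extChartAt_source (I := 𝓘(ℝ, E)) x)
  have hf : ContDiffAt ℝ ∞ (transition (E := E) p x) (extChartAt 𝓘(ℝ, E) p x) :=
    contDiffAt_transition ev.self_of_nhds.1 ev.self_of_nhds.2
  have hg : ContDiffAt ℝ ∞ (fun z => metricInChart g x (transition p x z))
      (extChartAt 𝓘(ℝ, E) p x) := by
    refine ContDiffAt.comp (G := E →L[ℝ] E →L[ℝ] ℝ) (g := metricInChart g x) _ ?_ hf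
    rw [transition_apply x hsrc]
    exact contDiffAt_metricInChart_self g x
  have hdf : ∀ v : E, ContDiffAt ℝ ∞ (fun z => fderiv ℝ (transition (E := E) p x) z v)
      (extChartAt 𝓘(ℝ, E) p x) := fun v =>
    (hf.fderiv_right (m := ∞) (by simp)).clm_apply contDiffAt_const
  refine contDiffAt_clm_of_apply fun v => contDiffAt_clm_of_apply fun w => ?_
  refine (contDiffAt_clm_apply₂ hg (hdf v) (hdf w)).congr_of_eventuallyEq ?_
  filter_upwards [ev] with z hz using metricInChart_transition g hz.1 hz.2 v w

theorem isMetricOn_metricInChart (p : M) :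
    IsMetricOn (metricInChart g p) (extChartAt 𝓘(ℝ, E) p).target where
  isOpen := isOpen_target p
  smooth y hy := (contDiffAt_metricInChart g hy).contDiffWithinAt
  symm y _ v w := g.symm _ _ _
  pos y hy v hv := by
    rw [metricInChart_apply]
    refine g.pos _ _ fun h => hv ?_
    rw [← dchart_symm hy v, h, map_zero]

theorem fderiv_transition_surjective {p q : M} {y : E} (hy : y ∈ (extChartAt 𝓘(ℝ, E) p).target)
    (hq : (extChartAt 𝓘(ℝ, E) p).symm y ∈ (extChartAt 𝓘(ℝ, E) q).source) :
    Function.Surjective (fderiv ℝ (transition (E := E) p q) y) := by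
  intro w
  obtain ⟨u, hu⟩ := dchart_surjective hq w
  have hy' := (extChartAt 𝓘(ℝ, E) p).map_target hy
  refine ⟨dchart p _ u, ?_⟩
  have := fderiv_transition_dchart hy' hq u
  rwa [(extChartAt 𝓘(ℝ, E) p).right_inv hy, hu] at this

theorem christoffel_eq_chris {H : Type*} [TopologicalSpace H] {I : ModelWithCorners ℝ E H}
    {M : Type*} [TopologicalSpace M] [ChartedSpace H M] [IsManifold I ∞ M]
    (g : SmoothMetric I M) (p : M) (y v w : E) :
    christoffel g p y v w = chris (metricInChart g p) y v w := rfl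

/-- The transformation law of the Christoffel symbols between two preferred charts. -/
theorem chris_transition {p q x : M} (hp : x ∈ (extChartAt 𝓘(ℝ, E) p).source)
    (hq : x ∈ (extChartAt 𝓘(ℝ, E) q).source) (v w : E) :
    chris (metricInChart g q) (extChartAt 𝓘(ℝ, E) q x)
      (fderiv ℝ (transition (E := E) p q) (extChartAt 𝓘(ℝ, E) p x) v)
      (fderiv ℝ (transition (E := E) p q) (extChartAt 𝓘(ℝ, E) p x) w) =
    fderiv ℝ (transition (E := E) p q) (extChartAt 𝓘(ℝ, E) p x)
      (chris (metricInChart g p) (extChartAt 𝓘(ℝ, E) p x) v w)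
      - fderiv ℝ (fderiv ℝ (transition (E := E) p q)) (extChartAt 𝓘(ℝ, E) p x) v w := by
  have ev := eventually_overlap hp hq
  have h0 := ev.self_of_nhds
  have hf := contDiffAt_transition h0.1 h0.2
  have := chris_transform (isMetricOn_metricInChart g p) (isMetricOn_metricInChart g q) hf h0.1
    (by rw [transition_apply q hp]; exact (extChartAt 𝓘(ℝ, E) q).map_source hq)
    (by filter_upwards [ev] with y hy using metricInChart_transition g hy.1 hy.2)
    (fderiv_transition_surjective h0.1 h0.2) v w
  rwa [transition_apply q hp] at this

/-- The definition of the curvature differentiates the components `Γ(·)(v, w)`; this agrees with the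
derivative of the bundled Christoffel symbols since these are smooth. -/
theorem curvature_eq_riem (p : M) (u v w : E) :
    @Eq E (curvature g p u v w) <| riem (chris (metricInChart g p)) (extChartAt 𝓘(ℝ, E) p p) u v w := by
  have hd : DifferentiableAt ℝ (chris (metricInChart g p)) (extChartAt 𝓘(ℝ, E) p p) :=
    (contDiffAt_chris (isMetricOn_metricInChart g p) (mem_extChartAt_target p)).differentiableAt
      (by simp)
  have e : ∀ v w : E, (fun x => christoffel g p x v w) =
    fun x => chris (metricInChart g p) x v w := fun v w => funext fun x =>
      christoffel_eq_chris g p x v w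
  unfold riem
  rw [← fderiv_clm_apply_const₂ hd, ← fderiv_clm_apply_const₂ hd, ← christoffel_eq_chris,
    ← christoffel_eq_chris, ← christoffel_eq_chris, ← christoffel_eq_chris]
  unfold curvature
  dsimp only
  rw [← e v w, ← e u w]

/-- The curvature tensor computed in another chart. -/
theorem dchart_curvature {p x : M} (hx : x ∈ (extChartAt 𝓘(ℝ, E) p).source)
    (u v w : TangentSpace 𝓘(ℝ, E) x) :
    dchart p x (curvature g x u v w) =
      riem (chris (metricInChart g p)) (extChartAt 𝓘(ℝ, E) p x)
        (dchart p x u) (dchart p x v) (dchart p x w) := by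
  have hx' := mem_extChartAt_source (I := 𝓘(ℝ, E)) x
  have ev := eventually_overlap hx' hx
  have h0 := ev.self_of_nhds
  have := riem_transform (isMetricOn_metricInChart g x) (isMetricOn_metricInChart g p)
    (f := transition (E := E) x p) (y := extChartAt 𝓘(ℝ, E) x x)
    (by filter_upwards [ev] with y hy using contDiffAt_transition hy.1 hy.2) h0.1
    (by rw [transition_apply p hx']; exact (extChartAt 𝓘(ℝ, E) p).map_source hx)
    (by filter_upwards [ev] with y hy using metricInChart_transition g hy.1 hy.2)
    (by filter_upwards [ev] with y hy using fderiv_transition_surjective hy.1 hy.2)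
    (dchart x x u) (dchart x x v) (dchart x x w)
  rw [transition_apply p hx', fderiv_transition_dchart hx' hx, fderiv_transition_dchart hx' hx,
    fderiv_transition_dchart hx' hx, dchart_self, dchart_self, dchart_self] at this
  have h2 := fderiv_transition_dchart hx' hx (curvature g x u v w)
  rw [dchart_self] at h2
  rw [← h2, this]
  exact congrArg _ (curvature_eq_riem g x u v w)

/-- The Jacobi operator is symmetric. -/
theorem curvature_jacobi_symm (p : M) (v w z : TangentSpace 𝓘(ℝ, E) p) :
    g.inner p (curvature g p w v v) z = g.inner p w (curvature g p z v v) := by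
  have hp := mem_extChartAt_source (I := 𝓘(ℝ, E)) p
  rw [← metricInChart_dchart g hp, ← metricInChart_dchart g hp, dchart_curvature g hp,
    dchart_curvature g hp]
  exact riem_jacobi_symm (isMetricOn_metricInChart g p) (mem_extChartAt_target p) _ _ _

theorem curvature_self (p : M) (v w : TangentSpace 𝓘(ℝ, E) p) : curvature g p v v w = 0 := by
  refine (curvature_eq_riem g p v v w).trans ?_
  unfold riem
  abel

end ManifoldCharts

/-! ### Vector fields along curves and their covariant derivatives -/

theorem contDiffAt_infty_deriv {F : Type*} [NormedAddCommGroup F] [NormedSpace ℝ F] {f : ℝ → F}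
    {t : ℝ} (h : ContDiffAt ℝ ∞ f t) : ContDiffAt ℝ ∞ (deriv f) t :=
  (h.fderiv_right (m := ∞) (by simp)).clm_apply contDiffAt_const

set_option synthInstance.maxHeartbeats 200000 in
theorem hasDerivAt_clm_comp_apply₂ {Y F₁ F₂ F₃ : Type*}
    [NormedAddCommGroup Y] [NormedSpace ℝ Y] [NormedAddCommGroup F₁] [NormedSpace ℝ F₁]
    [NormedAddCommGroup F₂] [NormedSpace ℝ F₂] [NormedAddCommGroup F₃] [NormedSpace ℝ F₃]
    {c : Y → F₁ →L[ℝ] F₂ →L[ℝ] F₃} {f : ℝ → Y} {a : ℝ → F₁} {b : ℝ → F₂} {t : ℝ} {f' : Y}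
    {a' : F₁} {b' : F₂} (hc : DifferentiableAt ℝ c (f t)) (hf : HasDerivAt f f' t)
    (ha : HasDerivAt a a' t) (hb : HasDerivAt b b' t) :
    HasDerivAt (fun s => c (f s) (a s) (b s)) (fderiv ℝ c (f t) f' (a t) (b t)
      + c (f t) a' (b t) + c (f t) (a t) b') t := by
  have h1 : HasDerivAt (fun s => c (f s)) (fderiv ℝ c (f t) f') t :=
    HasFDerivAt.comp_hasDerivAt (E := F₁ →L[ℝ] F₂ →L[ℝ] F₃) t hc.hasFDerivAt hf
  have h2 := (h1.clm_apply ha).clm_apply hb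
  simpa only [add_apply] using h2

section Curves

set_option linter.unusedSectionVars false

variable {E : Type*} [NormedAddCommGroup E] [NormedSpace ℝ E]
  {M : Type*} [TopologicalSpace M] [ChartedSpace E M] [IsManifold 𝓘(ℝ, E) ∞ M]

/-- The vector field `Y` along `γ` is smooth at time `t`. -/
def SmoothFieldAt (γ : ℝ → M) (Y : ∀ t, TangentSpace 𝓘(ℝ, E) (γ t)) (t : ℝ) : Prop :=
  ContMDiffAt 𝓘(ℝ, ℝ) 𝓘(ℝ, E).tangent ∞ (fun s => (⟨γ s, Y s⟩ : TangentBundle 𝓘(ℝ, E) M)) t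

/-- The coordinates of the vector field `Y` along `γ` in the preferred chart at `p`. -/
def coords (γ : ℝ → M) (Y : ∀ t, TangentSpace 𝓘(ℝ, E) (γ t)) (p : M) (s : ℝ) : E :=
  dchart p (γ s) (Y s)

/-- The curve `γ` in the preferred chart at `p`. -/
def chartCurve (γ : ℝ → M) (p : M) (s : ℝ) : E := extChartAt 𝓘(ℝ, E) p (γ s)

variable {γ : ℝ → M} {Y Z : ∀ t, TangentSpace 𝓘(ℝ, E) (γ t)} {p : M} {t : ℝ}

theorem eventually_mem_source (hγ : ContinuousAt γ t)
    (hp : γ t ∈ (extChartAt 𝓘(ℝ, E) p).source) :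
    ∀ᶠ s in 𝓝 t, γ s ∈ (extChartAt 𝓘(ℝ, E) p).source :=
  hγ.preimage_mem_nhds ((isOpen_extChartAt_source p).mem_nhds hp)

theorem smoothFieldAt_iff (hγ : ContMDiffAt 𝓘(ℝ, ℝ) 𝓘(ℝ, E) ∞ γ t)
    (hp : γ t ∈ (extChartAt 𝓘(ℝ, E) p).source) :
    SmoothFieldAt γ Y t ↔ ContDiffAt ℝ ∞ (coords γ Y p) t := by
  have h := (trivializationAt E (TangentSpace 𝓘(ℝ, E)) p).contMDiffAt_iff (IB := 𝓘(ℝ, E))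
    (IM := 𝓘(ℝ, ℝ)) (n := ∞)
    (f := fun s => (⟨γ s, Y s⟩ : TangentBundle 𝓘(ℝ, E) M)) (x₀ := t)
    (by rw [Trivialization.mem_source]; simpa using hp)
  unfold SmoothFieldAt
  refine h.trans ((and_iff_right hγ).trans ?_)
  rw [contMDiffAt_iff_contDiffAt]
  suffices hev : (fun s => ((trivializationAt E (TangentSpace 𝓘(ℝ, E)) p)
      (⟨γ s, Y s⟩ : TangentBundle 𝓘(ℝ, E) M)).2) =ᶠ[𝓝 t] coords γ Y p from
    ⟨fun h => h.congr_of_eventuallyEq hev.symm, fun h => h.congr_of_eventuallyEq hev⟩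
  filter_upwards [eventually_mem_source hγ.continuousAt hp] with s hs
  have h2 := TangentBundle.continuousLinearMapAt_trivializationAt (𝕜 := ℝ) (I := 𝓘(ℝ, E))
    (x₀ := p) (x := γ s) (by simpa using hs)
  have h3 := DFunLike.congr_fun h2 (Y s)
  rw [Trivialization.continuousLinearMapAt_apply, Trivialization.linearMapAt_apply,
    if_pos (by simpa using hs)] at h3
  exact h3

theorem contDiffAt_chartCurve (hγ : ContMDiffAt 𝓘(ℝ, ℝ) 𝓘(ℝ, E) ∞ γ t)
    (hp : γ t ∈ (extChartAt 𝓘(ℝ, E) p).source) : ContDiffAt ℝ ∞ (chartCurve (E := E) γ p) t := by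
  rw [← contMDiffAt_iff_contDiffAt]
  exact (contMDiffAt_extChartAt' (I := 𝓘(ℝ, E)) (by simpa using hp)).comp t hγ

theorem hasDerivAt_chartCurve (hγ : MDifferentiableAt 𝓘(ℝ, ℝ) 𝓘(ℝ, E) γ t)
    (hp : γ t ∈ (extChartAt 𝓘(ℝ, E) p).source) :
    HasDerivAt (chartCurve (E := E) γ p) (coords γ (velocity 𝓘(ℝ, E) γ) p t) t := by
  have h1 : HasMFDerivAt 𝓘(ℝ, E) 𝓘(ℝ, E) (extChartAt 𝓘(ℝ, E) p) (γ t) (dchart p (γ t)) :=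
    (mdifferentiableAt_extChartAt (by simpa using hp)).hasMFDerivAt
  have h2 := h1.comp t hγ.hasMFDerivAt
  have h3 : HasFDerivAt (𝕜 := ℝ) (E := ℝ) (F := E) (chartCurve γ p)
    ((dchart p (γ t) : E →L[ℝ] E).comp (mfderiv 𝓘(ℝ, ℝ) 𝓘(ℝ, E) γ t : ℝ →L[ℝ] E)) t :=
    hasMFDerivAt_iff_hasFDerivAt.1 h2
  exact h3.hasDerivAt

theorem smoothFieldAt_velocity (hγ : ContMDiff 𝓘(ℝ, ℝ) 𝓘(ℝ, E) ∞ γ) (t : ℝ) :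
    SmoothFieldAt γ (velocity 𝓘(ℝ, E) γ) t := by
  have hp := mem_extChartAt_source (I := 𝓘(ℝ, E)) (γ t)
  rw [smoothFieldAt_iff (hγ t) hp]
  refine (contDiffAt_infty_deriv (contDiffAt_chartCurve (hγ t) hp)).congr_of_eventuallyEq ?_
  filter_upwards [eventually_mem_source (hγ t).continuousAt hp] with s hs
  exact (hasDerivAt_chartCurve ((hγ s).mdifferentiableAt (by simp)) hs).deriv.symm

theorem coords_transition {q : M} (hp : γ t ∈ (extChartAt 𝓘(ℝ, E) p).source)
    (hq : γ t ∈ (extChartAt 𝓘(ℝ, E) q).source) :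
    coords γ Y q t = fderiv ℝ (transition (E := E) p q) (chartCurve γ p t) (coords γ Y p t) :=
  (fderiv_transition_dchart hp hq _).symm

variable [FiniteDimensional ℝ E] (g : SmoothMetric 𝓘(ℝ, E) M)

theorem covDeriv_eq (γ : ℝ → M) (Y : ∀ t, TangentSpace 𝓘(ℝ, E) (γ t)) (t : ℝ) :
    @Eq E (covDeriv g γ Y t) (deriv (coords γ Y (γ t)) t +
      chris (metricInChart g (γ t)) (chartCurve γ (γ t) t)
        (coords γ (velocity 𝓘(ℝ, E) γ) (γ t) t) (coords γ Y (γ t) t)) := by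
  have h1 : coords γ (velocity 𝓘(ℝ, E) γ) (γ t) t = velocity 𝓘(ℝ, E) γ t := dchart_self _ _
  have h2 : coords γ Y (γ t) t = Y t := dchart_self _ _
  rw [h1, h2]
  exact congrArg (fun e : E => deriv (coords γ Y (γ t)) t + e) (christoffel_eq_chris g _ _ _ _)

/-- The covariant derivative in an arbitrary preferred chart. -/
theorem coords_covDeriv (hγ : ContMDiff 𝓘(ℝ, ℝ) 𝓘(ℝ, E) ∞ γ) (hY : SmoothFieldAt γ Y t)
    (hp : γ t ∈ (extChartAt 𝓘(ℝ, E) p).source) :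
    coords γ (covDeriv g γ Y) p t = deriv (coords γ Y p) t +
      chris (metricInChart g p) (chartCurve γ p t)
        (coords γ (velocity 𝓘(ℝ, E) γ) p t) (coords γ Y p t) := by
  have hq := mem_extChartAt_source (I := 𝓘(ℝ, E)) (γ t)
  have hmd := (hγ t).mdifferentiableAt (by simp)
  have hq2 : coords γ (covDeriv g γ Y) (γ t) t = deriv (coords γ Y (γ t)) t +
      chris (metricInChart g (γ t)) (chartCurve γ (γ t) t)
        (coords γ (velocity 𝓘(ℝ, E) γ) (γ t) t) (coords γ Y (γ t) t) :=
    (dchart_self _ _).trans (covDeriv_eq g γ Y t)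
  have ev := eventually_overlap hq hp
  have h0 := ev.self_of_nhds
  have hf := contDiffAt_transition h0.1 h0.2
  have hd : HasDerivAt (coords γ Y p)
      (fderiv ℝ (fderiv ℝ (transition (E := E) (γ t) p)) (chartCurve γ (γ t) t)
        (coords γ (velocity 𝓘(ℝ, E) γ) (γ t) t) (coords γ Y (γ t) t)
        + fderiv ℝ (transition (E := E) (γ t) p) (chartCurve γ (γ t) t)
          (deriv (coords γ Y (γ t)) t)) t := by
    have hY' := (smoothFieldAt_iff (hγ t) hq).1 hY
    have h1 : HasDerivAt (coords γ Y (γ t)) (deriv (coords γ Y (γ t)) t) t :=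
      (hY'.differentiableAt (by simp)).hasDerivAt
    have h2 : HasFDerivAt (fderiv ℝ (transition (E := E) (γ t) p))
        (fderiv ℝ (fderiv ℝ (transition (E := E) (γ t) p)) (chartCurve γ (γ t) t))
        (chartCurve γ (γ t) t) :=
      ((hf.fderiv_right (m := ∞) (by simp)).differentiableAt (by simp)).hasFDerivAt
    have h3 := (h2.comp_hasDerivAt t (hasDerivAt_chartCurve hmd hq)).clm_apply h1
    refine h3.congr_of_eventuallyEq ?_
    filter_upwards [eventually_mem_source hmd.continuousAt hq,
      eventually_mem_source hmd.continuousAt hp] with s hs hs' using coords_transition hs hs'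
  have ht := chris_transition g hq hp (coords γ (velocity 𝓘(ℝ, E) γ) (γ t) t) (coords γ Y (γ t) t)
  rw [coords_transition hq hp, hq2, hd.deriv, coords_transition (Y := velocity 𝓘(ℝ, E) γ) hq hp,
    coords_transition (Y := Y) hq hp, map_add]
  unfold chartCurve at *
  rw [ht]
  abel

theorem smoothFieldAt_covDeriv (hγ : ContMDiff 𝓘(ℝ, ℝ) 𝓘(ℝ, E) ∞ γ)
    (hY : ∀ᶠ s in 𝓝 t, SmoothFieldAt γ Y s) : SmoothFieldAt γ (covDeriv g γ Y) t := by
  have hq := mem_extChartAt_source (I := 𝓘(ℝ, E)) (γ t)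
  have hcont := (hγ t).continuousAt
  rw [smoothFieldAt_iff (hγ t) hq]
  have hY' := (smoothFieldAt_iff (hγ t) hq).1 hY.self_of_nhds
  have hv := (smoothFieldAt_iff (hγ t) hq).1 (smoothFieldAt_velocity hγ t)
  have hc : ContDiffAt ℝ ∞ (fun s => chris (metricInChart g (γ t)) (chartCurve γ (γ t) s)) t :=
    ContDiffAt.comp (G := E →L[ℝ] E →L[ℝ] E) (g := chris (metricInChart g (γ t))) t
      (contDiffAt_chris (isMetricOn_metricInChart g (γ t)) (mem_extChartAt_target _))
      (contDiffAt_chartCurve (hγ t) hq)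
  have hd : ContDiffAt ℝ ∞ (deriv (coords γ Y (γ t))) t := contDiffAt_infty_deriv hY'
  refine (hd.add (contDiffAt_clm_apply₂ hc hv hY')).congr_of_eventuallyEq ?_
  filter_upwards [hY, eventually_mem_source hcont hq] with s hs hs'
  exact coords_covDeriv g hγ hs hs'

/-- Compatibility of the covariant derivative with the metric. -/
theorem hasDerivAt_inner (hγ : ContMDiff 𝓘(ℝ, ℝ) 𝓘(ℝ, E) ∞ γ) (hY : SmoothFieldAt γ Y t)
    (hZ : SmoothFieldAt γ Z t) :
    HasDerivAt (fun s => g.inner (γ s) (Y s) (Z s))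
      (g.inner (γ t) (covDeriv g γ Y t) (Z t) + g.inner (γ t) (Y t) (covDeriv g γ Z t)) t := by
  have hq := mem_extChartAt_source (I := 𝓘(ℝ, E)) (γ t)
  have hmd := (hγ t).mdifferentiableAt (by simp)
  have hG := isMetricOn_metricInChart g (γ t)
  have hmem := mem_extChartAt_target (I := 𝓘(ℝ, E)) (γ t)
  have h1 := (((smoothFieldAt_iff (hγ t) hq).1 hY).differentiableAt (by simp)).hasDerivAt
  have h2 := (((smoothFieldAt_iff (hγ t) hq).1 hZ).differentiableAt (by simp)).hasDerivAt
  have h4 := hasDerivAt_clm_comp_apply₂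
    ((hG.contDiffAt hmem).differentiableAt (by simp)) (hasDerivAt_chartCurve hmd hq) h1 h2
  have h5 := h4.congr_of_eventuallyEq (f₁ := fun s => g.inner (γ s) (Y s) (Z s)) (by
    filter_upwards [eventually_mem_source hmd.continuousAt hq] with s hs
    exact (metricInChart_dchart g hs (Y s) (Z s)).symm)
  refine h5.congr_deriv (Eq.symm ?_)
  rw [← metricInChart_dchart g hq, ← metricInChart_dchart g hq]
  change metricInChart g (γ t) (chartCurve γ (γ t) t) (coords γ (covDeriv g γ Y) (γ t) t)
    (coords γ Z (γ t) t) + metricInChart g (γ t) (chartCurve γ (γ t) t) (coords γ Y (γ t) t)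
    (coords γ (covDeriv g γ Z) (γ t) t) = _
  have hc : fderiv ℝ (metricInChart g (γ t)) (chartCurve γ (γ t) t)
    (coords γ (velocity 𝓘(ℝ, E) γ) (γ t) t) (coords γ Y (γ t) t) (coords γ Z (γ t) t) = _ :=
    hG.compat hmem _ _ _
  rw [coords_covDeriv g hγ hY hq, coords_covDeriv g hγ hZ hq, hc]
  simp only [map_add, add_apply]
  unfold chartCurve
  ring

end Curves

/-! ### Linear differential equations on the real line -/

section LinearODE

/-- Two curves which agree near every point where they agree, agree on an interval as soon as they
agree somewhere. -/
theorem eqOn_of_eventuallyEq {X : Type*} [TopologicalSpace X] [T2Space X] {f h : ℝ → X} {s : Set ℝ}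
    (hs : IsPreconnected s) (hf : ∀ t ∈ s, ContinuousAt f t) (hh : ∀ t ∈ s, ContinuousAt h t)
    (hloc : ∀ t ∈ s, f t = h t → f =ᶠ[𝓝 t] h) {c : ℝ} (hc : c ∈ s) (hfc : f c = h c) :
    ∀ t ∈ s, f t = h t := by
  have hsub : s ⊆ interior {t | f t = h t} := by
    refine hs.subset_of_closure_inter_subset isOpen_interior ⟨c, hc, ?_⟩ ?_
    · exact mem_interior_iff_mem_nhds.2 (hloc c hc hfc)
    · rintro t ⟨ht, hts⟩
      refine mem_interior_iff_mem_nhds.2 (hloc t hts ?_)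
      have hne : (𝓝[interior {t | f t = h t}] t).NeBot := mem_closure_iff_nhdsWithin_neBot.1 ht
      refine tendsto_nhds_unique_of_eventuallyEq (l := 𝓝[interior {t | f t = h t}] t)
        ((hf t hts).tendsto.mono_left nhdsWithin_le_nhds)
        ((hh t hts).tendsto.mono_left nhdsWithin_le_nhds) ?_
      filter_upwards [self_mem_nhdsWithin] with x hx
      have h1 : x ∈ {t | f t = h t} := interior_subset hx
      exact h1
  intro t ht
  have h1 : t ∈ {t | f t = h t} := interior_subset (hsub ht)
  exact h1

section Gluing

variable {F : Type*} {P : (ℝ → F) → ℝ → Prop}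

/-- One step of the continuation of local solutions: a solution on `(-r, r)` extends to
`(-(r + d / 2), r + d / 2)` if there are solutions on intervals of radius `d` around all points. -/
theorem exists_extension (hcongr : ∀ Y Z t, Y =ᶠ[𝓝 t] Z → P Y t → P Z t)
    (huniq : ∀ Y Z a b c, (∀ s ∈ Set.Ioo a b, P Y s) → (∀ s ∈ Set.Ioo a b, P Z s) →
      c ∈ Set.Ioo a b → Y c = Z c → ∀ s ∈ Set.Ioo a b, Y s = Z s) {r d T : ℝ} (hd : 0 < d)
    (hr : d / 2 ≤ r) (hrT : r ≤ T)
    (hex : ∀ c ∈ Set.Icc (-T) T, ∀ w, ∃ Y, (∀ s ∈ Set.Ioo (c - d) (c + d), P Y s) ∧ Y c = w)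
    {Y : ℝ → F} (hY : ∀ s ∈ Set.Ioo (-r) r, P Y s) :
    ∃ Z, (∀ s ∈ Set.Ioo (-(r + d / 2)) (r + d / 2), P Z s) ∧ Z 0 = Y 0 := by
  obtain ⟨R, hR, hRc⟩ := hex (r - d / 2) ⟨by linarith, by linarith⟩ (Y (r - d / 2))
  obtain ⟨L, hL, hLc⟩ := hex (-(r - d / 2)) ⟨by linarith, by linarith⟩ (Y (-(r - d / 2)))
  have hRY : ∀ s ∈ Set.Ioo (max (-r) (r - d / 2 - d)) r, R s = Y s := by
    refine huniq _ _ _ _ (r - d / 2) ?_ ?_ ?_ hRc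
    · rintro s ⟨h1, h2⟩
      exact hR s ⟨lt_of_le_of_lt (le_max_right _ _) h1, by linarith⟩
    · rintro s ⟨h1, h2⟩
      exact hY s ⟨lt_of_le_of_lt (le_max_left _ _) h1, h2⟩
    · exact ⟨max_lt (by linarith) (by linarith), by linarith⟩
  have hLY : ∀ s ∈ Set.Ioo (-r) (min r (-(r - d / 2) + d)), L s = Y s := by
    refine huniq _ _ _ _ (-(r - d / 2)) ?_ ?_ ?_ hLc
    · rintro s ⟨h1, h2⟩
      exact hL s ⟨by linarith, lt_of_lt_of_le h2 (min_le_right _ _)⟩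
    · rintro s ⟨h1, h2⟩
      exact hY s ⟨h1, lt_of_lt_of_le h2 (min_le_left _ _)⟩
    · exact ⟨by linarith, lt_min (by linarith) (by linarith)⟩
  let Z : ℝ → F := fun s => if r - d / 2 ≤ s then R s else if s ≤ -(r - d / 2) then L s else Y s
  have hZY : ∀ s ∈ Set.Ioo (-r) r, Z s = Y s := by
    rintro s ⟨h1, h2⟩
    simp only [Z]
    split_ifs with h3 h4
    · exact hRY s ⟨max_lt h1 (by linarith), h2⟩
    · exact hLY s ⟨h1, lt_min h2 (by linarith)⟩
    · rfl
  refine ⟨Z, ?_, hZY 0 ⟨by linarith, by linarith⟩⟩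
  rintro s ⟨h1, h2⟩
  rcases lt_or_ge s r with h3 | h3
  · rcases lt_or_ge (-r) s with h4 | h4
    · refine hcongr Y Z s ?_ (hY s ⟨h4, h3⟩)
      filter_upwards [isOpen_Ioo.mem_nhds (⟨h4, h3⟩ : s ∈ Set.Ioo (-r) r)] with x hx
      exact (hZY x hx).symm
    · refine hcongr L Z s ?_ (hL s ⟨by linarith, by linarith⟩)
      filter_upwards [Iio_mem_nhds (show s < -(r - d / 2) by linarith)] with x hx
      have hx' : x < -(r - d / 2) := hx
      simp only [Z]
      rw [if_neg (by linarith), if_pos hx'.le]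
  · refine hcongr R Z s ?_ (hR s ⟨by linarith, by linarith⟩)
    filter_upwards [Ioi_mem_nhds (show r - d / 2 < s by linarith)] with x hx
    have hx' : r - d / 2 < x := hx
    simp only [Z]
    rw [if_pos hx'.le]

/-- Solutions with local existence (with a time span not depending on the initial value) and
uniqueness can be continued to the whole line. -/
theorem exists_global_solution (hcongr : ∀ Y Z t, Y =ᶠ[𝓝 t] Z → P Y t → P Z t)
    (huniq : ∀ Y Z a b c, (∀ s ∈ Set.Ioo a b, P Y s) → (∀ s ∈ Set.Ioo a b, P Z s) →
      c ∈ Set.Ioo a b → Y c = Z c → ∀ s ∈ Set.Ioo a b, Y s = Z s)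
    (hex : ∀ t₀ : ℝ, ∃ ε > 0, ∀ c ∈ Set.Ioo (t₀ - ε) (t₀ + ε), ∀ w, ∃ Y,
      (∀ s ∈ Set.Ioo (t₀ - ε) (t₀ + ε), P Y s) ∧ Y c = w) (w : F) :
    ∃ Y, (∀ s, P Y s) ∧ Y 0 = w := by
  choose ε hε hex using hex
  have key : ∀ T : ℝ, 0 < T → ∃ Y, (∀ s ∈ Set.Ioo (-T) T, P Y s) ∧ Y 0 = w := by
    intro T hT
    obtain ⟨d, hd, hcov⟩ := lebesgue_number_lemma_of_metric (s := Set.Icc (-T) T)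
      (c := fun t : ℝ => Set.Ioo (t - ε t) (t + ε t)) isCompact_Icc (fun _ => isOpen_Ioo)
      (fun t _ => Set.mem_iUnion.2 ⟨t, by linarith [hε t], by linarith [hε t]⟩)
    have hex' : ∀ c ∈ Set.Icc (-T) T, ∀ w, ∃ Y, (∀ s ∈ Set.Ioo (c - d) (c + d), P Y s) ∧
        Y c = w := by
      intro c hc w
      obtain ⟨i, hi⟩ := hcov c hc
      rw [Real.ball_eq_Ioo] at hi
      obtain ⟨Y, hY, hYc⟩ := hex i c (hi ⟨by linarith, by linarith⟩) w
      exact ⟨Y, fun s hs => hY s (hi hs), hYc⟩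
    have step : ∀ k : ℕ, ∃ r, min T ((k + 1) * (d / 2)) ≤ r ∧ ∃ Y, (∀ s ∈ Set.Ioo (-r) r, P Y s) ∧
        Y 0 = w := by
      intro k
      induction k with
      | zero =>
        obtain ⟨Y, hY, hY0⟩ := hex' 0 ⟨by linarith, by linarith⟩ w
        refine ⟨d / 2, by simp, Y, fun s hs => hY s ⟨?_, ?_⟩, hY0⟩
        · linarith [hs.1]
        · linarith [hs.2]
      | succ k ih =>
        obtain ⟨r, hr, Y, hY, hY0⟩ := ih
        rcases le_or_gt T r with hTr | hTr
        · exact ⟨r, (min_le_left _ _).trans hTr, Y, hY, hY0⟩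
        · have hr2 : ((k : ℝ) + 1) * (d / 2) ≤ r := by
            rcases min_le_iff.1 hr with h | h
            · linarith
            · exact h
          have hk : (0 : ℝ) ≤ k * (d / 2) := by positivity
          obtain ⟨Z, hZ, hZ0⟩ := exists_extension hcongr huniq hd (by linarith) hTr.le hex' hY
          refine ⟨r + d / 2, (min_le_right _ _).trans ?_, Z, hZ, hZ0.trans hY0⟩
          push_cast
          linarith
    obtain ⟨k, hk⟩ := exists_nat_gt (T / (d / 2))
    obtain ⟨r, hr, Y, hY, hY0⟩ := step k
    have hTr : T ≤ r := by
      refine le_trans (le_min le_rfl ?_) hr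
      rw [div_lt_iff₀ (by positivity)] at hk
      linarith
    exact ⟨Y, fun s hs => hY s ⟨by linarith [hs.1], by linarith [hs.2]⟩, hY0⟩
  choose Yn hYn hYn0 using fun n : ℕ => key (n + 1) (by positivity)
  have hagree : ∀ m n : ℕ, m ≤ n → ∀ s ∈ Set.Ioo (-(m + 1 : ℝ)) (m + 1), Yn m s = Yn n s := by
    intro m n hmn
    have hmn' : (m : ℝ) ≤ n := by exact_mod_cast hmn
    refine huniq _ _ _ _ 0 (hYn m) (fun s hs => hYn n s
      ⟨by linarith [hs.1], by linarith [hs.2]⟩) ⟨?_, ?_⟩ ((hYn0 m).trans (hYn0 n).symm)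
    · have : (0 : ℝ) ≤ m := by positivity
      linarith
    · positivity
  let Y : ℝ → F := fun s => Yn ⌈|s|⌉₊ s
  have hYeq : ∀ n : ℕ, ∀ s ∈ Set.Ioo (-(n + 1 : ℝ)) (n + 1), Y s = Yn n s := by
    intro n s hs
    have hs' : s ∈ Set.Ioo (-((⌈|s|⌉₊ : ℕ) + 1 : ℝ)) ((⌈|s|⌉₊ : ℕ) + 1) := by
      have := Nat.le_ceil |s|
      constructor
      · linarith [neg_abs_le s]
      · linarith [le_abs_self s]
    rcases le_total ⌈|s|⌉₊ n with h | h
    · exact hagree _ _ h s hs'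
    · exact (hagree _ _ h s hs).symm
  refine ⟨Y, fun s => ?_, ?_⟩
  · obtain ⟨n, hn⟩ := exists_nat_gt |s|
    have hs : s ∈ Set.Ioo (-(n + 1 : ℝ)) (n + 1) := by
      constructor
      · linarith [neg_abs_le s]
      · linarith [le_abs_self s]
    refine hcongr (Yn n) Y s ?_ (hYn n s hs)
    filter_upwards [isOpen_Ioo.mem_nhds hs] with x hx using (hYeq n x hx).symm
  · exact (hYeq 0 0 (by simp)).trans (hYn0 0)

end Gluing

variable {F : Type*} [NormedAddCommGroup F] [NormedSpace ℝ F]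

/-- Solutions of linear differential equations with smooth coefficients are smooth. -/
theorem contDiffOn_of_linear_ode {K : Type*} [NormedAddCommGroup K] [NormedSpace ℝ K]
    {A : ℝ → K →L[ℝ] K} {f : ℝ → K} {s : Set ℝ} (hs : IsOpen s) (hA : ContDiffOn ℝ ∞ A s)
    (hf : ∀ t ∈ s, HasDerivAt f (A t (f t)) t) : ContDiffOn ℝ ∞ f s := by
  rw [contDiffOn_infty]
  intro n
  induction n with
  | zero =>
    rw [Nat.cast_zero, contDiffOn_zero]
    exact fun t ht => (hf t ht).continuousAt.continuousWithinAt
  | succ n ih =>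
    rw [Nat.cast_succ, contDiffOn_succ_iff_deriv_of_isOpen hs]
    refine ⟨fun t ht => (hf t ht).differentiableAt.differentiableWithinAt, by simp, ?_⟩
    refine ((hA.of_le (by exact_mod_cast le_top)).clm_apply ih).congr fun t ht => ?_
    exact (hf t ht).deriv

/-- A local fundamental solution of a linear differential equation. -/
theorem exists_local_fundamental_solution [CompleteSpace F] {A : ℝ → F →L[ℝ] F} {t₀ : ℝ}
    (hA : ∀ᶠ t in 𝓝 t₀, ContDiffAt ℝ ∞ A t) :
    ∃ Φ : ℝ → F →L[ℝ] F, ∃ ε > 0, ∀ t ∈ Set.Ioo (t₀ - ε) (t₀ + ε),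
      ContDiffAt ℝ ∞ Φ t ∧ HasDerivAt Φ (A t ∘L Φ t) t ∧ Function.Surjective (Φ t) := by
  -- the time is added as a variable in order to make the equation autonomous
  let v : ℝ × (F →L[ℝ] F) → ℝ × (F →L[ℝ] F) := fun z => (1, A z.1 ∘L z.2)
  have hv : ContDiffAt ℝ 1 v (t₀, 1) := by
    have h1 : ContDiffAt ℝ 1 (fun z : ℝ × (F →L[ℝ] F) => A z.1) (t₀, 1) :=
      ContDiffAt.comp (g := A) (f := Prod.fst) (t₀, (1 : F →L[ℝ] F))
        (hA.self_of_nhds.of_le (by exact_mod_cast le_top)) contDiffAt_fst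
    exact contDiffAt_const.prodMk (h1.clm_comp contDiffAt_snd)
  obtain ⟨α, hα0, ε, hε, hα⟩ :=
    hv.exists_forall_mem_closedBall_exists_eq_forall_mem_Ioo_hasDerivAt₀ t₀
  have h1 : ∀ t ∈ Set.Ioo (t₀ - ε) (t₀ + ε), (α t).1 = t := by
    have hd : ∀ t ∈ Set.Ioo (t₀ - ε) (t₀ + ε), HasDerivAt (fun t => (α t).1 - t) 0 t := by
      intro t ht
      have h : HasDerivAt (fun t => (α t).1) (1 : ℝ) t :=
        (ContinuousLinearMap.fst ℝ ℝ (F →L[ℝ] F)).hasFDerivAt.comp_hasDerivAt t (hα t ht)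
      exact (h.sub (hasDerivAt_id t)).congr_deriv (sub_self 1)
    intro t ht
    have hc := isOpen_Ioo.is_const_of_deriv_eq_zero isPreconnected_Ioo
      (fun t ht => (hd t ht).differentiableAt.differentiableWithinAt)
      (fun t ht => (hd t ht).deriv) ht (show t₀ ∈ Set.Ioo (t₀ - ε) (t₀ + ε) from
        ⟨by linarith, by linarith⟩)
    simp only [hα0, sub_self] at hc
    linarith
  have h2 : ∀ t ∈ Set.Ioo (t₀ - ε) (t₀ + ε),
      HasDerivAt (fun t => (α t).2) (A t ∘L (α t).2) t := by
    intro t ht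
    have h : HasDerivAt (fun t => (α t).2) (A (α t).1 ∘L (α t).2) t :=
      (ContinuousLinearMap.snd ℝ ℝ (F →L[ℝ] F)).hasFDerivAt.comp_hasDerivAt t (hα t ht)
    rwa [h1 t ht] at h
  -- the solution is the identity at `t₀`, and the units are open
  have hunit : ∀ᶠ t in 𝓝 t₀, IsUnit (α t).2 := by
    have hc := (h2 t₀ ⟨by linarith, by linarith⟩).continuousAt
    refine hc.preimage_mem_nhds (t := {x | IsUnit x}) (Units.isOpen.mem_nhds ?_)
    rw [hα0]
    exact isUnit_one
  obtain ⟨δ, hδ, hδ'⟩ := Metric.eventually_nhds_iff_ball.1 (hunit.and hA)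
  rw [Real.ball_eq_Ioo] at hδ'
  refine ⟨fun t => (α t).2, min ε δ, lt_min hε hδ, ?_⟩
  have hsub : ∀ t ∈ Set.Ioo (t₀ - min ε δ) (t₀ + min ε δ),
      t ∈ Set.Ioo (t₀ - ε) (t₀ + ε) ∧ t ∈ Set.Ioo (t₀ - δ) (t₀ + δ) := by
    rintro t ⟨ht1, ht2⟩
    have := min_le_left ε δ
    have := min_le_right ε δ
    exact ⟨⟨by linarith, by linarith⟩, ⟨by linarith, by linarith⟩⟩
  have hsm : ContDiffOn ℝ ∞ (fun t => (α t).2) (Set.Ioo (t₀ - min ε δ) (t₀ + min ε δ)) := by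
    refine contDiffOn_of_linear_ode (A := fun t => ContinuousLinearMap.compL ℝ F F F (A t))
      isOpen_Ioo ?_ (fun t ht => h2 t (hsub t ht).1)
    intro t ht
    have := (hδ' t (hsub t ht).2).2
    exact ((ContinuousLinearMap.compL ℝ F F F).contDiff.contDiffAt.comp t this).contDiffWithinAt
  intro t ht
  refine ⟨(hsm t ht).contDiffAt (isOpen_Ioo.mem_nhds ht), h2 t (hsub t ht).1, ?_⟩
  obtain ⟨u, hu⟩ := (hδ' t (hsub t ht).2).1
  intro w
  refine ⟨(↑u⁻¹ : F →L[ℝ] F) w, ?_⟩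
  change (α t).2 _ = w
  rw [← hu]
  have := DFunLike.congr_fun u.mul_inv w
  exact this

/-- Local uniqueness for linear differential equations. -/
theorem linear_ode_unique {A : ℝ → F →L[ℝ] F} {t₀ : ℝ} (hA : ContinuousAt A t₀) {f h : ℝ → F}
    (hf : ∀ᶠ t in 𝓝 t₀, HasDerivAt f (A t (f t)) t)
    (hh : ∀ᶠ t in 𝓝 t₀, HasDerivAt h (A t (h t)) t) (heq : f t₀ = h t₀) : f =ᶠ[𝓝 t₀] h := by
  refine ODE_solution_unique_of_eventually (v := fun t => A t) (s := fun _ => Set.univ)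
    (K := ‖A t₀‖₊ + 1) ?_ (by simpa using hf) (by simpa using hh) heq
  have : ∀ᶠ t in 𝓝 t₀, ‖A t‖₊ < ‖A t₀‖₊ + 1 :=
    hA.nnnorm.eventually_lt continuousAt_const (by simp)
  filter_upwards [this] with t ht
  exact ((A t).lipschitz.weaken ht.le).lipschitzOnWith

/-- Linear differential equations with smooth coefficients have global solutions. -/
theorem exists_global_linear_ode [FiniteDimensional ℝ F] {A : ℝ → F →L[ℝ] F}
    (hA : ContDiff ℝ ∞ A) (w : F) :
    ∃ f : ℝ → F, (∀ t, HasDerivAt f (A t (f t)) t) ∧ f 0 = w := by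
  have := FiniteDimensional.complete ℝ F
  suffices h : ∃ Y : ℝ → F, (∀ t, ∀ᶠ s in 𝓝 t, HasDerivAt Y (A s (Y s)) s) ∧ Y 0 = w by
    obtain ⟨Y, hY, hY0⟩ := h
    exact ⟨Y, fun t => (hY t).self_of_nhds, hY0⟩
  refine exists_global_solution (F := F)
    (P := fun f t => ∀ᶠ s in 𝓝 t, HasDerivAt f (A s (f s)) s) ?_ ?_ ?_ w
  · intro Y Z t h hY
    filter_upwards [eventually_eventually_nhds.2 h, hY] with s hs hs'
    have hs1 : Y s = Z s := hs.self_of_nhds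
    rw [← hs1]
    exact hs'.congr_of_eventuallyEq (EventuallyEq.symm hs)
  · intro Y Z a b c hY hZ hc h
    exact eqOn_of_eventuallyEq isPreconnected_Ioo
      (fun t ht => (hY t ht).self_of_nhds.continuousAt)
      (fun t ht => (hZ t ht).self_of_nhds.continuousAt)
      (fun t ht => linear_ode_unique hA.continuous.continuousAt (hY t ht) (hZ t ht)) hc h
  · intro t₀
    obtain ⟨Φ, ε, hε, hΦ⟩ := exists_local_fundamental_solution (A := A) (t₀ := t₀)
      (Eventually.of_forall fun t => hA.contDiffAt)
    refine ⟨ε, hε, fun c hc w => ?_⟩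
    obtain ⟨u, hu⟩ := (hΦ c hc).2.2 w
    refine ⟨fun t => Φ t u, fun s hs => ?_, hu⟩
    filter_upwards [isOpen_Ioo.mem_nhds hs] with x hx
    exact ((hΦ x hx).2.1.clm_apply (hasDerivAt_const x u)).congr_deriv (by simp)

/-- A solution of a linear differential equation is determined by its value at one time. -/
theorem linear_ode_unique_global {A : ℝ → F →L[ℝ] F} (hA : Continuous A) {f h : ℝ → F}
    (hf : ∀ t, HasDerivAt f (A t (f t)) t) (hh : ∀ t, HasDerivAt h (A t (h t)) t) {c : ℝ}
    (hc : f c = h c) (t : ℝ) : f t = h t :=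
  eqOn_of_eventuallyEq isPreconnected_univ (fun t _ => (hf t).continuousAt)
    (fun t _ => (hh t).continuousAt) (fun _ _ h => linear_ode_unique hA.continuousAt
      (Eventually.of_forall hf) (Eventually.of_forall hh) h) (Set.mem_univ c) hc t (Set.mem_univ t)

end LinearODE

/-! ### Parallel frames -/

section ParallelFrames

set_option linter.unusedSectionVars false

variable {E : Type*} [NormedAddCommGroup E] [NormedSpace ℝ E] [FiniteDimensional ℝ E]
  {M : Type*} [TopologicalSpace M] [ChartedSpace E M] [IsManifold 𝓘(ℝ, E) ∞ M]
  {γ : ℝ → M} {Y Z : ∀ t, TangentSpace 𝓘(ℝ, E) (γ t)} {t : ℝ} (g : SmoothMetric 𝓘(ℝ, E) M)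

theorem coords_congr (h : ∀ᶠ s in 𝓝 t, Y s = Z s) (p : M) :
    coords γ Y p =ᶠ[𝓝 t] coords γ Z p := by
  filter_upwards [h] with s hs
  exact congrArg (dchart p (γ s)) hs

theorem SmoothFieldAt.congr (hY : SmoothFieldAt γ Y t) (h : ∀ᶠ s in 𝓝 t, Y s = Z s) :
    SmoothFieldAt γ Z t := by
  refine ContMDiffAt.congr_of_eventuallyEq hY ?_
  filter_upwards [h] with s hs
  rw [hs]

theorem covDeriv_congr (h : ∀ᶠ s in 𝓝 t, Y s = Z s) : covDeriv g γ Y t = covDeriv g γ Z t := by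
  refine (covDeriv_eq g γ Y t).trans (Eq.trans ?_ (covDeriv_eq g γ Z t).symm)
  rw [(coords_congr h (γ t)).deriv_eq, (coords_congr h (γ t)).self_of_nhds]

/-- The vector field `Y` along `γ` is smooth and parallel at time `t`. -/
def ParallelAt (γ : ℝ → M) (Y : ∀ t, TangentSpace 𝓘(ℝ, E) (γ t)) (t : ℝ) : Prop :=
  SmoothFieldAt γ Y t ∧ covDeriv g γ Y t = 0

variable {g}

theorem parallelAt_iff (hγ : ContMDiff 𝓘(ℝ, ℝ) 𝓘(ℝ, E) ∞ γ) (hY : SmoothFieldAt γ Y t) {p : M}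
    (hp : γ t ∈ (extChartAt 𝓘(ℝ, E) p).source) :
    ParallelAt g γ Y t ↔ HasDerivAt (coords γ Y p)
      (-chris (metricInChart g p) (chartCurve γ p t) (coords γ (velocity 𝓘(ℝ, E) γ) p t)
        (coords γ Y p t)) t := by
  have hd := (((smoothFieldAt_iff (hγ t) hp).1 hY).differentiableAt (by simp)).hasDerivAt
  have hc := coords_covDeriv g hγ hY hp
  have h0 : covDeriv g γ Y t = 0 ↔ coords γ (covDeriv g γ Y) p t = 0 := by
    constructor
    · intro h
      exact (congrArg (dchart p (γ t)) h).trans (map_zero _)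
    · intro h
      exact dchart_injective hp (h.trans (map_zero (dchart p (γ t))).symm)
  constructor
  · rintro ⟨-, h⟩
    have h1 := h0.1 h
    rw [hc] at h1
    exact hd.congr_deriv (eq_neg_of_add_eq_zero_left h1)
  · intro h
    refine ⟨hY, h0.2 ?_⟩
    rw [hc, h.deriv]
    exact neg_add_cancel _

theorem ParallelAt.inner_const (hγ : ContMDiff 𝓘(ℝ, ℝ) 𝓘(ℝ, E) ∞ γ) {s : Set ℝ}
    (hs : IsOpen s) (hs' : IsPreconnected s) (hY : ∀ t ∈ s, ParallelAt g γ Y t)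
    (hZ : ∀ t ∈ s, ParallelAt g γ Z t) {a b : ℝ} (ha : a ∈ s) (hb : b ∈ s) :
    g.inner (γ a) (Y a) (Z a) = g.inner (γ b) (Y b) (Z b) := by
  have hd : ∀ t ∈ s, HasDerivAt (fun t => g.inner (γ t) (Y t) (Z t)) 0 t := by
    intro t ht
    refine (hasDerivAt_inner g hγ (hY t ht).1 (hZ t ht).1).congr_deriv ?_
    rw [(hY t ht).2, (hZ t ht).2]
    simp
  exact hs.is_const_of_deriv_eq_zero hs'
    (fun t ht => (hd t ht).differentiableAt.differentiableWithinAt) (fun t ht => (hd t ht).deriv)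
    ha hb

theorem SmoothFieldAt.add (hγ : ContMDiff 𝓘(ℝ, ℝ) 𝓘(ℝ, E) ∞ γ) (hY : SmoothFieldAt γ Y t)
    (hZ : SmoothFieldAt γ Z t) : SmoothFieldAt γ (fun s => Y s + Z s) t := by
  have hp := mem_extChartAt_source (I := 𝓘(ℝ, E)) (γ t)
  rw [smoothFieldAt_iff (hγ t) hp] at *
  exact (hY.add hZ).congr_of_eventuallyEq (Eventually.of_forall fun s => map_add _ _ _)

theorem SmoothFieldAt.smul (hγ : ContMDiff 𝓘(ℝ, ℝ) 𝓘(ℝ, E) ∞ γ) (c : ℝ)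
    (hY : SmoothFieldAt γ Y t) : SmoothFieldAt γ (fun s => c • Y s) t := by
  have hp := mem_extChartAt_source (I := 𝓘(ℝ, E)) (γ t)
  rw [smoothFieldAt_iff (hγ t) hp] at *
  exact (contDiffAt_const (c := c) |>.smul hY).congr_of_eventuallyEq
    (Eventually.of_forall fun s => map_smul _ _ _)

theorem ParallelAt.add (hγ : ContMDiff 𝓘(ℝ, ℝ) 𝓘(ℝ, E) ∞ γ) (hY : ParallelAt g γ Y t)
    (hZ : ParallelAt g γ Z t) : ParallelAt g γ (fun s => Y s + Z s) t := by
  have hp := mem_extChartAt_source (I := 𝓘(ℝ, E)) (γ t)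
  rw [parallelAt_iff hγ (hY.1.add hγ hZ.1) hp]
  have h1 := (parallelAt_iff hγ hY.1 hp).1 hY
  have h2 := (parallelAt_iff hγ hZ.1 hp).1 hZ
  have e : coords γ (fun s => Y s + Z s) (γ t) = coords γ Y (γ t) + coords γ Z (γ t) :=
    funext fun s => map_add _ _ _
  rw [e]
  refine (h1.add h2).congr_deriv ?_
  rw [Pi.add_apply, map_add, neg_add]

theorem ParallelAt.smul (hγ : ContMDiff 𝓘(ℝ, ℝ) 𝓘(ℝ, E) ∞ γ) (c : ℝ) (hY : ParallelAt g γ Y t) :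
    ParallelAt g γ (fun s => c • Y s) t := by
  have hp := mem_extChartAt_source (I := 𝓘(ℝ, E)) (γ t)
  rw [parallelAt_iff hγ (hY.1.smul hγ c) hp]
  have h1 := (parallelAt_iff hγ hY.1 hp).1 hY
  have e : coords γ (fun s => c • Y s) (γ t) = c • coords γ Y (γ t) :=
    funext fun s => map_smul _ _ _
  rw [e]
  refine (h1.const_smul c).congr_deriv ?_
  rw [Pi.smul_apply, map_smul, smul_neg]

/-- Parallel fields are determined by one value, since the difference has constant length. -/
theorem ParallelAt.eq_of_eq (hγ : ContMDiff 𝓘(ℝ, ℝ) 𝓘(ℝ, E) ∞ γ) {s : Set ℝ}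
    (hs : IsOpen s) (hs' : IsPreconnected s) (hY : ∀ t ∈ s, ParallelAt g γ Y t)
    (hZ : ∀ t ∈ s, ParallelAt g γ Z t) {a b : ℝ} (ha : a ∈ s) (hb : b ∈ s) (h : Y a = Z a) :
    Y b = Z b := by
  have hW : ∀ t ∈ s, ParallelAt g γ (fun t => Y t + (-1 : ℝ) • Z t) t := fun t ht =>
    (hY t ht).add hγ ((hZ t ht).smul hγ (-1))
  have := ParallelAt.inner_const hγ hs hs' hW hW ha hb
  rw [h] at this
  have h0 : Y b + (-1 : ℝ) • Z b = 0 := by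
    by_contra hne
    have hpos := g.pos _ _ hne
    rw [← this] at hpos
    simp at hpos
  rw [neg_one_smul, ← sub_eq_add_neg, sub_eq_zero] at h0
  exact h0

theorem ParallelAt.congr (hY : ParallelAt g γ Y t) (h : ∀ᶠ s in 𝓝 t, Y s = Z s) :
    ParallelAt g γ Z t :=
  ⟨hY.1.congr h, (covDeriv_congr g h).symm.trans hY.2⟩

/-- Local existence of parallel fields, with prescribed value at any point of an interval around `t₀`
which does not depend on that value. -/
theorem exists_local_parallel (g : SmoothMetric 𝓘(ℝ, E) M) (hγ : ContMDiff 𝓘(ℝ, ℝ) 𝓘(ℝ, E) ∞ γ)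
    (t₀ : ℝ) :
    ∃ ε > 0, ∀ c ∈ Set.Ioo (t₀ - ε) (t₀ + ε), ∀ w : E, ∃ Y : ∀ t, TangentSpace 𝓘(ℝ, E) (γ t),
      (∀ s ∈ Set.Ioo (t₀ - ε) (t₀ + ε), ParallelAt g γ Y s) ∧ Y c = w := by
  have hp := mem_extChartAt_source (I := 𝓘(ℝ, E)) (γ t₀)
  have ev := eventually_mem_source (hγ t₀).continuousAt hp
  have hA : ∀ᶠ t in 𝓝 t₀, ContDiffAt ℝ ∞ (fun t => -chris (metricInChart g (γ t₀))
      (chartCurve γ (γ t₀) t) (coords γ (velocity 𝓘(ℝ, E) γ) (γ t₀) t)) t := by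
    filter_upwards [ev] with t ht
    have hc : ContDiffAt ℝ ∞ (fun s => chris (metricInChart g (γ t₀)) (chartCurve γ (γ t₀) s)) t :=
      ContDiffAt.comp (G := E →L[ℝ] E →L[ℝ] E) (g := chris (metricInChart g (γ t₀))) t
        (contDiffAt_chris (isMetricOn_metricInChart g (γ t₀))
          ((extChartAt 𝓘(ℝ, E) (γ t₀)).map_source ht))
        (contDiffAt_chartCurve (hγ t) ht)
    exact (hc.clm_apply ((smoothFieldAt_iff (hγ t) ht).1 (smoothFieldAt_velocity hγ t))).neg
  have := FiniteDimensional.complete ℝ E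
  obtain ⟨Φ, ε, hε, hΦ⟩ := exists_local_fundamental_solution hA
  obtain ⟨δ, hδ, hδ'⟩ := Metric.eventually_nhds_iff_ball.1 ev
  rw [Real.ball_eq_Ioo] at hδ'
  have hsub : ∀ t ∈ Set.Ioo (t₀ - min ε δ) (t₀ + min ε δ),
      t ∈ Set.Ioo (t₀ - ε) (t₀ + ε) ∧ t ∈ Set.Ioo (t₀ - δ) (t₀ + δ) := by
    rintro t ⟨ht1, ht2⟩
    have := min_le_left ε δ
    have := min_le_right ε δ
    exact ⟨⟨by linarith, by linarith⟩, ⟨by linarith, by linarith⟩⟩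
  refine ⟨min ε δ, lt_min hε hδ, fun c hc w => ?_⟩
  obtain ⟨u, hu⟩ := (hΦ c (hsub c hc).1).2.2 (dchart (γ t₀) (γ c) w)
  -- the field with coordinates `Φ t u`; the value of `invFun` matters only where `γ t` is in the
  -- chart domain
  let Y : ∀ t, TangentSpace 𝓘(ℝ, E) (γ t) := fun t =>
    Function.invFun (dchart (E := E) (γ t₀) (γ t)) (Φ t u)
  have hcoord : ∀ t ∈ Set.Ioo (t₀ - min ε δ) (t₀ + min ε δ), coords γ Y (γ t₀) t = Φ t u :=
    fun t ht => Function.invFun_eq (dchart_surjective (hδ' t (hsub t ht).2) (Φ t u))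
  have hev : ∀ t ∈ Set.Ioo (t₀ - min ε δ) (t₀ + min ε δ),
      coords γ Y (γ t₀) =ᶠ[𝓝 t] fun t => Φ t u := fun t ht => by
    filter_upwards [isOpen_Ioo.mem_nhds ht] with s hs using hcoord s hs
  refine ⟨Y, fun t ht => ?_, dchart_injective (hδ' c (hsub c hc).2) ((hcoord c hc).trans hu)⟩
  obtain ⟨h1, h2, -⟩ := hΦ t (hsub t ht).1
  have hsm : SmoothFieldAt γ Y t := by
    rw [smoothFieldAt_iff (hγ t) (hδ' t (hsub t ht).2)]
    exact (h1.clm_apply contDiffAt_const).congr_of_eventuallyEq (hev t ht)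
  rw [parallelAt_iff hγ hsm (hδ' t (hsub t ht).2)]
  refine ((h2.clm_apply (hasDerivAt_const t u)).congr_of_eventuallyEq (hev t ht)).congr_deriv ?_
  rw [hcoord t ht]
  simp

/-- Parallel fields exist globally. -/
theorem exists_parallel (g : SmoothMetric 𝓘(ℝ, E) M) (hγ : ContMDiff 𝓘(ℝ, ℝ) 𝓘(ℝ, E) ∞ γ) (w : E) :
    ∃ Y : ∀ t, TangentSpace 𝓘(ℝ, E) (γ t), (∀ s, ParallelAt g γ Y s) ∧ Y 0 = w := by
  -- the property is required near each time, so that it can be transferred to fields with equal germs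
  refine exists_global_solution (F := E) (P := fun Y t => ∀ᶠ s in 𝓝 t, ParallelAt g γ Y s)
    ?_ ?_ ?_ w |>.imp fun Y h => ⟨fun s => (h.1 s).self_of_nhds, h.2⟩
  · intro Y Z t h hY
    filter_upwards [eventually_eventually_nhds.2 h, hY] with s hs hs'
    exact ParallelAt.congr hs' hs
  · intro Y Z a b c hY hZ hc h t ht
    exact ParallelAt.eq_of_eq hγ isOpen_Ioo isPreconnected_Ioo (fun t ht => (hY t ht).self_of_nhds)
      (fun t ht => (hZ t ht).self_of_nhds) hc ht h
  · intro t₀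
    obtain ⟨ε, hε, h⟩ := exists_local_parallel g hγ t₀
    refine ⟨ε, hε, fun c hc w => ?_⟩
    obtain ⟨Y, hY, hYc⟩ := h c hc w
    refine ⟨Y, fun s hs => ?_, hYc⟩
    filter_upwards [isOpen_Ioo.mem_nhds hs] with x hx using hY x hx

variable (g) in
/-- A family of linear maps `P t : T_{γ 0} M → T_{γ t} M` (all tangent spaces being copies of `E`)
is the parallel transport along `γ`. -/
structure IsParallelTransport (γ : ℝ → M) (P : ℝ → E →L[ℝ] E) : Prop where
  zero : ∀ w, P 0 w = w
  parallel : ∀ w t, ParallelAt g γ (fun s => P s w) t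

theorem exists_parallelTransport (g : SmoothMetric 𝓘(ℝ, E) M)
    (hγ : ContMDiff 𝓘(ℝ, ℝ) 𝓘(ℝ, E) ∞ γ) : ∃ P, IsParallelTransport g γ P := by
  choose Y hY hY0 using exists_parallel g hγ
  have huniq : ∀ Z : ∀ t, TangentSpace 𝓘(ℝ, E) (γ t), (∀ t, ParallelAt g γ Z t) →
      ∀ t, Z t = Y (Z 0) t := fun Z hZ t =>
    ParallelAt.eq_of_eq hγ isOpen_univ isPreconnected_univ (fun t _ => hZ t) (fun t _ => hY _ t)
      (Set.mem_univ 0) (Set.mem_univ t) (hY0 _).symm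
  let P : ℝ → E →ₗ[ℝ] E := fun t =>
    { toFun := fun w => Y w t
      map_add' := fun a b => by
        have h := huniq _ (fun t => (hY a t).add hγ (hY b t)) t
        have h0 : Y a 0 + Y b 0 = a + b := congrArg₂ (fun x y : E => x + y) (hY0 a) (hY0 b)
        rw [h0] at h
        exact h.symm
      map_smul' := fun c a => by
        have h := huniq _ (fun t => (hY a t).smul hγ c) t
        have h0 : c • Y a 0 = c • a := congrArg (fun x : E => c • x) (hY0 a)
        rw [h0] at h
        exact h.symm }
  exact ⟨fun t => LinearMap.toContinuousLinearMap (P t), hY0, hY⟩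

end ParallelFrames

/-! ### The Jacobi equation in a parallel frame -/

section ParallelFrames

set_option linter.unusedSectionVars false

theorem contDiffAt_fderiv_comp_apply {X W : Type*}
    [NormedAddCommGroup X] [NormedSpace ℝ X] [NormedAddCommGroup W] [NormedSpace ℝ W]
    {c : X → W} {x u : ℝ → X} {t : ℝ}
    (hc : ContDiffAt ℝ ∞ c (x t)) (hx : ContDiffAt ℝ ∞ x t) (hu : ContDiffAt ℝ ∞ u t) :
    ContDiffAt ℝ ∞ (fun s => fderiv ℝ c (x s) (u s)) t :=
  ((hc.fderiv_right (m := ∞) (by simp)).comp t hx).clm_apply hu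

theorem clm_smul_add {X W : Type*}
    [NormedAddCommGroup X] [NormedSpace ℝ X] [NormedAddCommGroup W] [NormedSpace ℝ W]
    (L : X →L[ℝ] W) (c : ℝ) (x y : X) : L (c • x + y) = c • L x + L y := by
  rw [map_add, map_smul]

theorem fderiv_smul_add {X W : Type*}
    [NormedAddCommGroup X] [NormedSpace ℝ X] [NormedAddCommGroup W] [NormedSpace ℝ W]
    (f : X → W) (y : X) (c : ℝ) (u u' : X) :
    fderiv ℝ f y (c • u + u') = c • fderiv ℝ f y u + fderiv ℝ f y u' :=
  clm_smul_add _ _ _ _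

theorem fderiv_smul {X W : Type*}
    [NormedAddCommGroup X] [NormedSpace ℝ X] [NormedAddCommGroup W] [NormedSpace ℝ W]
    (f : X → W) (y : X) (c : ℝ) (u : X) : fderiv ℝ f y (c • u) = c • fderiv ℝ f y u :=
  map_smul _ _ _

section Riem

variable {E : Type*} [NormedAddCommGroup E] [NormedSpace ℝ E]

theorem contDiffAt_riem {Γ : E → E →L[ℝ] E →L[ℝ] E} {x u v w : ℝ → E} {t : ℝ}
    (hΓ : ContDiffAt ℝ ∞ Γ (x t)) (hx : ContDiffAt ℝ ∞ x t) (hu : ContDiffAt ℝ ∞ u t)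
    (hv : ContDiffAt ℝ ∞ v t) (hw : ContDiffAt ℝ ∞ w t) :
    ContDiffAt ℝ ∞ (fun s => riem Γ (x s) (u s) (v s) (w s)) t := by
  have h1 : ContDiffAt ℝ ∞ (fun s => Γ (x s)) t :=
    ContDiffAt.comp (G := E →L[ℝ] E →L[ℝ] E) (g := Γ) t hΓ hx
  exact (((contDiffAt_clm_apply₂ (contDiffAt_fderiv_comp_apply hΓ hx hu) hv hw).sub
    (contDiffAt_clm_apply₂ (contDiffAt_fderiv_comp_apply hΓ hx hv) hu hw)).add
    (contDiffAt_clm_apply₂ h1 hu (contDiffAt_clm_apply₂ h1 hv hw))).sub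
    (contDiffAt_clm_apply₂ h1 hv (contDiffAt_clm_apply₂ h1 hu hw))

theorem riem_smul_add (Γ : E → E →L[ℝ] E →L[ℝ] E) (y : E) (c : ℝ) (u u' v w : E) :
    riem Γ y (c • u + u') v w = c • riem Γ y u v w + riem Γ y u' v w := by
  have h1 : fderiv ℝ Γ y (c • u + u') v w = c • fderiv ℝ Γ y u v w + fderiv ℝ Γ y u' v w :=
    congrArg (fun L : E →L[ℝ] E →L[ℝ] E => L v w) (fderiv_smul_add Γ y c u u')
  have h2 : fderiv ℝ Γ y v (c • u + u') w = c • fderiv ℝ Γ y v u w + fderiv ℝ Γ y v u' w :=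
    congrArg (fun L : E →L[ℝ] E => L w) (clm_smul_add (fderiv ℝ Γ y v) c u u')
  unfold riem
  rw [h1, h2]
  simp only [map_add, map_smul, add_apply, smul_apply, smul_add, smul_sub]
  abel

theorem riem_smul_smul (Γ : E → E →L[ℝ] E →L[ℝ] E) (y : E) (c : ℝ) (u v w : E) :
    riem Γ y u (c • v) (c • w) = c • c • riem Γ y u v w := by
  have h1 : fderiv ℝ Γ y (c • v) u (c • w) = c • fderiv ℝ Γ y v u (c • w) :=
    congrArg (fun L : E →L[ℝ] E →L[ℝ] E => L u (c • w)) (fderiv_smul Γ y c v)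
  unfold riem
  rw [h1]
  simp only [map_smul, smul_apply, smul_add, smul_sub]

end Riem

variable {E : Type*} [NormedAddCommGroup E] [NormedSpace ℝ E] [FiniteDimensional ℝ E]
  {M : Type*} [TopologicalSpace M] [ChartedSpace E M] [IsManifold 𝓘(ℝ, E) ∞ M]
  {γ : ℝ → M} {t : ℝ} {g : SmoothMetric 𝓘(ℝ, E) M} {P : ℝ → E →L[ℝ] E}

theorem curvature_smul_add (p : M) (c : ℝ) (u u' v w : TangentSpace 𝓘(ℝ, E) p) :
    curvature g p (c • u + u') v w = c • curvature g p u v w + curvature g p u' v w := by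
  refine (curvature_eq_riem g p _ _ _).trans ((riem_smul_add (E := E) _ _ c u u' v w).trans ?_)
  exact congrArg₂ (fun x y : E => c • x + y) (curvature_eq_riem g p _ _ _).symm
    (curvature_eq_riem g p _ _ _).symm

theorem curvature_smul_smul (g : SmoothMetric 𝓘(ℝ, E) M) (p : M) (c : ℝ)
    (u v : TangentSpace 𝓘(ℝ, E) p) :
    curvature g p u (c • v) (c • v) = c • c • curvature g p u v v := by
  refine (curvature_eq_riem g p _ _ _).trans ((riem_smul_smul (E := E) _ _ c u v v).trans ?_)
  exact congrArg (fun x : E => c • c • x) (curvature_eq_riem g p _ _ _).symm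

theorem smoothFieldAt_curvature (hγ : ContMDiff 𝓘(ℝ, ℝ) 𝓘(ℝ, E) ∞ γ)
    {U V W : ∀ t, TangentSpace 𝓘(ℝ, E) (γ t)} (hU : SmoothFieldAt γ U t)
    (hV : SmoothFieldAt γ V t) (hW : SmoothFieldAt γ W t) :
    SmoothFieldAt γ (fun s => curvature g (γ s) (U s) (V s) (W s)) t := by
  have hp := mem_extChartAt_source (I := 𝓘(ℝ, E)) (γ t)
  rw [smoothFieldAt_iff (hγ t) hp] at *
  refine (contDiffAt_riem (contDiffAt_chris (isMetricOn_metricInChart g (γ t))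
    (mem_extChartAt_target (γ t))) (contDiffAt_chartCurve (hγ t) hp) hU hV hW).congr_of_eventuallyEq
    ?_
  filter_upwards [eventually_mem_source (hγ t).continuousAt hp] with s hs
  exact dchart_curvature g hs _ _ _

namespace IsParallelTransport

variable (hP : IsParallelTransport g γ P) (hγ : ContMDiff 𝓘(ℝ, ℝ) 𝓘(ℝ, E) ∞ γ)

include hP hγ

theorem inner_eq (t : ℝ) (a b : E) :
    g.inner (γ t) (P t a) (P t b) = g.inner (γ 0) a b := by
  have h := ParallelAt.inner_const hγ isOpen_univ isPreconnected_univ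
    (fun t _ => hP.parallel a t) (fun t _ => hP.parallel b t) (Set.mem_univ t) (Set.mem_univ 0)
  refine h.trans ?_
  exact congrArg₂ (fun x y : E => g.inner (γ 0) x y) (hP.zero a) (hP.zero b)

theorem injective (t : ℝ) : Function.Injective (P t) := by
  refine (injective_iff_map_eq_zero (P t)).2 fun a ha => ?_
  by_contra hne
  have h := hP.inner_eq hγ t a a
  have hpos : 0 < g.inner (γ 0) a a := g.pos (γ 0) a hne
  rw [← h, ha] at hpos
  exact lt_irrefl _ (lt_of_lt_of_eq hpos (map_zero (g.inner (γ t) (0 : E))))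

theorem surjective (t : ℝ) : Function.Surjective (P t) :=
  (LinearMap.injective_iff_surjective (f := (P t : E →ₗ[ℝ] E))).1 (hP.injective hγ t)

theorem hasDerivAt_coords {p : M} (hp : γ t ∈ (extChartAt 𝓘(ℝ, E) p).source) (a : E) :
    HasDerivAt (coords γ (fun s => P s a) p)
      (-chris (metricInChart g p) (chartCurve γ p t) (coords γ (velocity 𝓘(ℝ, E) γ) p t)
        (coords γ (fun s => P s a) p t)) t :=
  (parallelAt_iff hγ (hP.parallel a t).1 hp).1 (hP.parallel a t)

theorem contDiffAt_frame {p : M} (hp : γ t ∈ (extChartAt 𝓘(ℝ, E) p).source) :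
    ContDiffAt ℝ ∞ (fun s => (dchart p (γ s) : E →L[ℝ] E) ∘L P s) t :=
  contDiffAt_clm_of_apply fun a => (smoothFieldAt_iff (hγ t) hp).1 (hP.parallel a t).1

theorem isInvertible_frame {p : M} (hp : γ t ∈ (extChartAt 𝓘(ℝ, E) p).source) :
    ((dchart p (γ t) : E →L[ℝ] E) ∘L P t).IsInvertible := by
  have hinj : Function.Injective ((dchart p (γ t) : E →L[ℝ] E) ∘L P t) :=
    (dchart_injective hp).comp (hP.injective hγ t)
  exact ⟨(LinearEquiv.ofInjectiveEndo (((dchart p (γ t) : E →L[ℝ] E) ∘L P t : E →L[ℝ] E) :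
    E →ₗ[ℝ] E) hinj).toContinuousLinearEquiv, by ext; rfl⟩

theorem smoothFieldAt_iff (y : ℝ → E) :
    SmoothFieldAt γ (fun s => P s (y s)) t ↔ ContDiffAt ℝ ∞ y t := by
  have hp := mem_extChartAt_source (I := 𝓘(ℝ, E)) (γ t)
  have hf := hP.contDiffAt_frame hγ hp
  refine (RiemGeom.smoothFieldAt_iff (hγ t) hp).trans ?_
  constructor
  · intro h
    have h1 : ContDiffAt ℝ ∞ (fun s => ((dchart (γ t) (γ s) : E →L[ℝ] E) ∘L P s).inverse) t :=
      ContDiffAt.comp (g := ContinuousLinearMap.inverse) t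
        (hP.isInvertible_frame hγ hp).contDiffAt_map_inverse hf
    refine (h1.clm_apply h).congr_of_eventuallyEq ?_
    filter_upwards [eventually_mem_source (hγ t).continuousAt hp] with s hs
    obtain ⟨e, he⟩ := hP.isInvertible_frame hγ hs
    have h2 : coords γ (fun s => P s (y s)) (γ t) s =
      ((dchart (γ t) (γ s) : E →L[ℝ] E) ∘L P s) (y s) := rfl
    rw [h2, ← he, ContinuousLinearMap.inverse_equiv]
    exact (e.symm_apply_apply _).symm
  · exact fun h => hf.clm_apply h

theorem covDeriv_eq {y : ℝ → E} (hy : ContDiffAt ℝ ∞ y t) :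
    @Eq E (covDeriv g γ (fun s => P s (y s)) t) (P t (deriv y t)) := by
  have hp := mem_extChartAt_source (I := 𝓘(ℝ, E)) (γ t)
  refine dchart_injective (M := M) hp ?_
  refine (coords_covDeriv g hγ ((hP.smoothFieldAt_iff hγ y).2 hy) hp).trans ?_
  have hd := (((hP.contDiffAt_frame hγ hp).differentiableAt (by simp)).hasDerivAt)
  have hd' : ∀ a, deriv (fun s => (dchart (γ t) (γ s) : E →L[ℝ] E) ∘L P s) t a =
      (-chris (metricInChart g (γ t)) (chartCurve γ (γ t) t)
        (coords γ (velocity 𝓘(ℝ, E) γ) (γ t) t) (coords γ (fun s => P s a) (γ t) t)) := by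
    intro a
    have h1 := hd.clm_apply (hasDerivAt_const t a)
    have h2 := h1.unique (hP.hasDerivAt_coords hγ hp a)
    rwa [map_zero, add_zero] at h2
  have h3 : HasDerivAt (coords γ (fun s => P s (y s)) (γ t)) _ t :=
    hd.clm_apply (hy.differentiableAt (by simp)).hasDerivAt
  rw [h3.deriv, hd']
  have h4 : coords γ (fun s => P s (y t)) (γ t) t = coords γ (fun s => P s (y s)) (γ t) t := rfl
  rw [h4, neg_add_eq_sub, sub_add_cancel]
  rfl

/-- The Jacobi operator `R(·, γ') γ'` in a parallel frame. -/
theorem exists_jacobiOperator : ∃ R : ℝ → E →L[ℝ] E, ContDiff ℝ ∞ R ∧ ∀ t w,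
    @Eq E (P t (R t w)) (curvature g (γ t) (P t w) (velocity 𝓘(ℝ, E) γ t)
      (velocity 𝓘(ℝ, E) γ t)) := by
  choose r hr using fun (t : ℝ) (w : E) => hP.surjective hγ t
    (curvature g (γ t) (P t w) (velocity 𝓘(ℝ, E) γ t) (velocity 𝓘(ℝ, E) γ t))
  have hlin : ∀ t (c : ℝ) (u w : E), r t (c • u + w) = c • r t u + r t w := by
    intro t c u w
    refine hP.injective hγ t ?_
    rw [map_add, map_smul, hr, hr, hr, map_add, map_smul]
    exact curvature_smul_add (γ t) c _ _ _ _
  have h0 : ∀ t, r t 0 = 0 := fun t => by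
    have := hlin t 1 0 0
    simpa using this
  let R : ℝ → E →ₗ[ℝ] E := fun t =>
    { toFun := r t
      map_add' := fun u w => by simpa using hlin t 1 u w
      map_smul' := fun c u => by simpa [h0] using hlin t c u 0 }
  refine ⟨fun t => LinearMap.toContinuousLinearMap (R t), ?_, hr⟩
  refine contDiff_iff_contDiffAt.2 fun t => contDiffAt_clm_of_apply fun w => ?_
  have h1 := smoothFieldAt_curvature (g := g) hγ (hP.parallel w t).1
    (smoothFieldAt_velocity hγ t) (smoothFieldAt_velocity hγ t)
  rw [← hP.smoothFieldAt_iff hγ]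
  exact h1.congr (Eventually.of_forall fun s => (hr s w).symm)

/-- The Jacobi equation in a parallel frame. -/
theorem isJacobiField_iff {R : ℝ → E →L[ℝ] E}
    (hR : ∀ t w, @Eq E (P t (R t w)) (curvature g (γ t) (P t w) (velocity 𝓘(ℝ, E) γ t)
      (velocity 𝓘(ℝ, E) γ t))) (y : ℝ → E) :
    IsJacobiField g γ (fun s => P s (y s)) ↔
      ContDiff ℝ ∞ y ∧ ∀ t, deriv (deriv y) t + R t (y t) = 0 := by
  have hsm : ContMDiff 𝓘(ℝ, ℝ) 𝓘(ℝ, E).tangent ∞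
      (fun t => (⟨γ t, P t (y t)⟩ : TangentBundle 𝓘(ℝ, E) M)) ↔ ContDiff ℝ ∞ y :=
    (forall_congr' fun t => hP.smoothFieldAt_iff hγ y).trans contDiff_iff_contDiffAt.symm
  unfold IsJacobiField
  rw [hsm]
  refine and_congr_right fun hy => forall_congr' fun t => ?_
  have hy' : ContDiff ℝ ∞ (deriv y) :=
    contDiff_iff_contDiffAt.2 fun s => contDiffAt_infty_deriv hy.contDiffAt
  have h1 : @Eq E (covDeriv g γ (covDeriv g γ (fun s => P s (y s))) t) (P t (deriv (deriv y) t)) :=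
    (covDeriv_congr g (Eventually.of_forall fun s => hP.covDeriv_eq hγ hy.contDiffAt)).trans
      (hP.covDeriv_eq hγ hy'.contDiffAt)
  have h2 := congrArg₂ (fun a b : E => a + b) h1 (hR t (y t)).symm
  have h3 := h2.trans (map_add (P t) (deriv (deriv y) t) (R t (y t))).symm
  constructor
  · intro h
    exact hP.injective hγ t (h3.symm.trans (Eq.trans h (map_zero (P t)).symm))
  · intro h
    exact h3.trans ((congrArg (P t) h).trans (map_zero (P t)))

end IsParallelTransport

end ParallelFrames

/-! ### Jacobi equations without conjugate points -/

section JacobiEquation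

variable {E : Type*} [NormedAddCommGroup E] [NormedSpace ℝ E]

/-- `y` solves the Jacobi equation `y'' + R y = 0`, and `z` is its derivative. -/
def IsJacobiSol (R : ℝ → E →L[ℝ] E) (y z : ℝ → E) : Prop :=
  ∀ t, HasDerivAt y (z t) t ∧ HasDerivAt z (-R t (y t)) t

/-- The first order system for `(y, y')` which is equivalent to the Jacobi equation. -/
def jacobiSystem (R : ℝ → E →L[ℝ] E) (t : ℝ) : E × E →L[ℝ] E × E :=
  (ContinuousLinearMap.snd ℝ E E).prod (-(R t ∘L ContinuousLinearMap.fst ℝ E E))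

variable {R : ℝ → E →L[ℝ] E} {y z y₁ z₁ : ℝ → E}

theorem contDiff_jacobiSystem (hR : ContDiff ℝ ∞ R) : ContDiff ℝ ∞ (jacobiSystem R) := by
  have h : ContDiff ℝ ∞ fun t => -(R t ∘L ContinuousLinearMap.fst ℝ E E) :=
    (hR.clm_comp contDiff_const).neg
  exact (ContinuousLinearMap.prodₗᵢ (𝕜 := ℝ) (E := E × E) (F := E) (G := E)
    ℝ).toContinuousLinearEquiv.contDiff.comp (contDiff_const.prodMk h)

theorem isJacobiSol_iff : IsJacobiSol R y z ↔
    ∀ t, HasDerivAt (fun t => (y t, z t)) (jacobiSystem R t (y t, z t)) t := by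
  refine forall_congr' fun t => ⟨fun h => h.1.prodMk h.2, fun h => ⟨?_, ?_⟩⟩
  · exact (ContinuousLinearMap.fst ℝ E E).hasFDerivAt.comp_hasDerivAt t h
  · exact (ContinuousLinearMap.snd ℝ E E).hasFDerivAt.comp_hasDerivAt t h

theorem IsJacobiSol.contDiff (h : IsJacobiSol R y z) (hR : ContDiff ℝ ∞ R) :
    ContDiff ℝ ∞ y ∧ ContDiff ℝ ∞ z := by
  have h1 : ContDiff ℝ ∞ fun t => (y t, z t) := by
    rw [← contDiffOn_univ]
    exact contDiffOn_of_linear_ode isOpen_univ (contDiff_jacobiSystem hR).contDiffOn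
      fun t _ => isJacobiSol_iff.1 h t
  exact ⟨contDiff_fst.comp h1, contDiff_snd.comp h1⟩

theorem isJacobiSol_of_deriv (hy : ContDiff ℝ ∞ y) (h : ∀ t, deriv (deriv y) t + R t (y t) = 0) :
    IsJacobiSol R y (deriv y) := by
  intro t
  refine ⟨(hy.differentiable (by simp) t).hasDerivAt, ?_⟩
  rw [← eq_neg_of_add_eq_zero_left (h t)]
  exact ((contDiffAt_infty_deriv hy.contDiffAt).differentiableAt (by simp)).hasDerivAt

theorem IsJacobiSol.deriv_deriv (h : IsJacobiSol R y z) (t : ℝ) :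
    deriv (deriv y) t + R t (y t) = 0 := by
  have h1 : deriv y = z := funext fun t => (h t).1.deriv
  rw [h1, (h t).2.deriv, neg_add_cancel]

theorem IsJacobiSol.add (h : IsJacobiSol R y z) (h₁ : IsJacobiSol R y₁ z₁) :
    IsJacobiSol R (fun t => y t + y₁ t) (fun t => z t + z₁ t) := fun t =>
  ⟨(h t).1.add (h₁ t).1, ((h t).2.add (h₁ t).2).congr_deriv (by rw [map_add, neg_add])⟩

theorem IsJacobiSol.smul (c : ℝ) (h : IsJacobiSol R y z) :
    IsJacobiSol R (fun t => c • y t) (fun t => c • z t) := fun t =>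
  ⟨(h t).1.const_smul c, ((h t).2.const_smul c).congr_deriv (by rw [map_smul, smul_neg])⟩

theorem IsJacobiSol.ext (hR : ContDiff ℝ ∞ R) (h : IsJacobiSol R y z) (h₁ : IsJacobiSol R y₁ z₁)
    {c : ℝ} (hy : y c = y₁ c) (hz : z c = z₁ c) (t : ℝ) : y t = y₁ t ∧ z t = z₁ t :=
  Prod.ext_iff.1 (linear_ode_unique_global (contDiff_jacobiSystem hR).continuous
    (isJacobiSol_iff.1 h) (isJacobiSol_iff.1 h₁) (c := c) (Prod.ext hy hz) t)

theorem exists_isJacobiSol [FiniteDimensional ℝ E] (hR : ContDiff ℝ ∞ R) (a b : E) :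
    ∃ y z, IsJacobiSol R y z ∧ y 0 = a ∧ z 0 = b := by
  obtain ⟨f, hf, hf0⟩ := exists_global_linear_ode (contDiff_jacobiSystem hR) (a, b)
  exact ⟨fun t => (f t).1, fun t => (f t).2, isJacobiSol_iff.2 hf,
    congrArg Prod.fst hf0, congrArg Prod.snd hf0⟩

/-- Solutions of the Jacobi equation depend linearly on their initial values. -/
theorem exists_jacobi_family [FiniteDimensional ℝ E] (hR : ContDiff ℝ ∞ R) (U V : E →L[ℝ] E) :
    ∃ A A' : ℝ → E →L[ℝ] E, (∀ w, IsJacobiSol R (fun t => A t w) (fun t => A' t w)) ∧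
      (∀ w, A 0 w = U w) ∧ ∀ w, A' 0 w = V w := by
  choose y z hs hy hz using fun w => exists_isJacobiSol hR (U w) (V w)
  have hadd := fun a b => ((hs a).add (hs b)).ext hR (hs (a + b)) (c := 0)
    (by rw [hy, hy, hy, map_add]) (by rw [hz, hz, hz, map_add])
  have hsmul := fun c a => ((hs a).smul c).ext hR (hs (c • a)) (c := 0)
    (by rw [hy, hy, map_smul]) (by rw [hz, hz, map_smul])
  let A : ℝ → E →ₗ[ℝ] E := fun t =>
    { toFun := fun w => y w t
      map_add' := fun a b => (hadd a b t).1.symm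
      map_smul' := fun c a => (hsmul c a t).1.symm }
  let A' : ℝ → E →ₗ[ℝ] E := fun t =>
    { toFun := fun w => z w t
      map_add' := fun a b => (hadd a b t).2.symm
      map_smul' := fun c a => (hsmul c a t).2.symm }
  exact ⟨fun t => LinearMap.toContinuousLinearMap (A t),
    fun t => LinearMap.toContinuousLinearMap (A' t), hs, hy, hz⟩

/-- A solution of the Jacobi equation that vanishes twice vanishes identically. -/
def NoConjugateTimes (R : ℝ → E →L[ℝ] E) : Prop :=
  ∀ y z, IsJacobiSol R y z → ∀ a b : ℝ, a ≠ b → y a = 0 → y b = 0 → ∀ t, y t = 0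

/-- `A` is the operator solution of the Jacobi equation with `A 0 = 1` and `A T = 0`, and `A'` is
its derivative. No sign of `T` is prescribed. -/
structure IsTensorTo (R : ℝ → E →L[ℝ] E) (T : ℝ) (A A' : ℝ → E →L[ℝ] E) : Prop where
  sol : ∀ w, IsJacobiSol R (fun t => A t w) (fun t => A' t w)
  apply_zero : ∀ w, A 0 w = w
  apply_end : ∀ w, A T w = 0

/-- With the fundamental solutions `C`, `S` (`C 0 = 1`, `C' 0 = 0`, `S 0 = 0`, `S' 0 = 1`) this is
`C - S (S T)⁻¹ (C T)`, where `S T` is injective because there are no conjugate times. -/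
theorem exists_isTensorTo [FiniteDimensional ℝ E] (hR : ContDiff ℝ ∞ R) (hn : NoConjugateTimes R)
    {T : ℝ} (hT : T ≠ 0) : ∃ A A', IsTensorTo R T A A' := by
  obtain ⟨C, C', hC, hC0, -⟩ := exists_jacobi_family hR 1 0
  obtain ⟨S, S', hS, hS0, hS'0⟩ := exists_jacobi_family hR 0 1
  have hinj : Function.Injective (S T) := by
    refine (injective_iff_map_eq_zero (S T)).2 fun a ha => ?_
    have h0 := hn _ _ (hS a) 0 T hT.symm (hS0 a) ha
    have h1 : HasDerivAt (fun t => S t a) 0 0 := by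
      have : (fun t => S t a) = fun _ => 0 := funext h0
      rw [this]
      exact hasDerivAt_const _ _
    have h2 := (hS a 0).1.unique h1
    exact (hS'0 a).symm.trans h2
  let e := (LinearEquiv.ofInjectiveEndo (S T : E →ₗ[ℝ] E) hinj).toContinuousLinearEquiv
  have he : ∀ x, S T (e.symm x) = x := fun x => e.apply_symm_apply x
  let U : E →L[ℝ] E := (-1 : ℝ) • ((e.symm : E →L[ℝ] E) ∘L C T)
  have hU : ∀ w, U w = (-1 : ℝ) • e.symm (C T w) := fun w => rfl
  refine ⟨fun t => C t + S t ∘L U, fun t => C' t + S' t ∘L U, fun w => (hC w).add (hS (U w)), ?_, ?_⟩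
  · intro w
    change C 0 w + S 0 (U w) = w
    rw [hC0, hS0]
    simp
  · intro w
    change C T w + S T (U w) = 0
    rw [hU, map_smul, he]
    simp

variable {B : E →L[ℝ] E →L[ℝ] ℝ}

/-- The Wronskian of two solutions is constant. -/
theorem wronskian_const (hsymm : ∀ t a b, B (R t a) b = B a (R t b)) (h : IsJacobiSol R y z)
    (h₁ : IsJacobiSol R y₁ z₁) (a b : ℝ) :
    B (z a) (y₁ a) - B (y a) (z₁ a) = B (z b) (y₁ b) - B (y b) (z₁ b) := by
  have hd : ∀ t, HasDerivAt (fun t => B (z t) (y₁ t) - B (y t) (z₁ t)) 0 t := by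
    intro t
    have e1 := (B.hasFDerivAt.comp_hasDerivAt t (h t).2).clm_apply (h₁ t).1
    have e2 := (B.hasFDerivAt.comp_hasDerivAt t (h t).1).clm_apply (h₁ t).2
    refine (e1.sub e2).congr_deriv ?_
    simp only [map_neg, neg_apply, hsymm, Function.comp_apply]
    ring
  exact is_const_of_deriv_eq_zero (fun t => (hd t).differentiableAt) (fun t => (hd t).deriv) a b

theorem wronskian_eq_zero (hsymm : ∀ t a b, B (R t a) b = B a (R t b)) (h : IsJacobiSol R y z)
    (h₁ : IsJacobiSol R y₁ z₁) {c : ℝ} (hy : y c = 0) (hy₁ : y₁ c = 0) (t : ℝ) :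
    B (z t) (y₁ t) = B (y t) (z₁ t) := by
  have h2 := wronskian_const hsymm h h₁ t c
  rw [hy, hy₁] at h2
  simp only [map_zero, zero_apply, sub_zero] at h2
  linarith

namespace IsTensorTo

variable {T σ : ℝ} {A A' D D' : ℝ → E →L[ℝ] E}

theorem symm (hA : IsTensorTo R T A A') (hsymm : ∀ t a b, B (R t a) b = B a (R t b)) (a b : E) :
    B (A' 0 a) b = B a (A' 0 b) := by
  have h := wronskian_eq_zero hsymm (hA.sol a) (hA.sol b) (hA.apply_end a) (hA.apply_end b) 0
  rwa [hA.apply_zero, hA.apply_zero] at h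

theorem injective (hD : IsTensorTo R σ D D') (hn : NoConjugateTimes R) {t : ℝ} (ht : t ≠ σ) :
    Function.Injective (D t) := by
  refine (injective_iff_map_eq_zero (D t)).2 fun a ha => ?_
  rw [← hD.apply_zero a]
  exact hn _ _ (hD.sol a) t σ ht ha (hD.apply_end a) 0

theorem hasDerivAt [FiniteDimensional ℝ E] (hD : IsTensorTo R σ D D') (hR : ContDiff ℝ ∞ R)
    (t : ℝ) : HasDerivAt D (D' t) t := by
  have h : DifferentiableAt ℝ D t := (contDiffAt_clm_of_apply (n := ∞) fun a =>
    ((hD.sol a).contDiff hR).1.contDiffAt).differentiableAt (by simp)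
  refine h.hasDerivAt.congr_deriv (ContinuousLinearMap.ext fun a => ?_)
  have h1 := (h.hasDerivAt.clm_apply (hasDerivAt_const t a)).unique (hD.sol a t).1
  rwa [map_zero, add_zero] at h1

/-- Comparison of the solution `A` which vanishes at `T` with a solution `D` which vanishes outside of
`[0, T]`. If `A = D Z`, the quadratic form `B(D Z' w, D Z w)` is nondecreasing on `[0, T]`, because its
derivative is `B(D Z' w, D Z' w)`, and it vanishes at `T`. -/
theorem form_le [FiniteDimensional ℝ E] (hR : ContDiff ℝ ∞ R) (hn : NoConjugateTimes R)
    (hsymm : ∀ t a b, B (R t a) b = B a (R t b)) (hpos : ∀ a, a ≠ 0 → 0 < B a a) (hT : 0 < T)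
    (hA : IsTensorTo R T A A') (hD : IsTensorTo R σ D D') (hσ : σ ∉ Set.Icc 0 T) (w : E) :
    B (A' 0 w) w ≤ B (D' 0 w) w := by
  have hnonneg : ∀ a, 0 ≤ B a a := fun a => by
    by_cases h : a = 0
    · simp [h]
    · exact (hpos a h).le
  have hinv : ∀ t, t ≠ σ → (D t).IsInvertible := fun t ht =>
    ⟨(LinearEquiv.ofInjectiveEndo (D t : E →ₗ[ℝ] E)
      (hD.injective hn ht)).toContinuousLinearEquiv, by ext; rfl⟩
  have hne : ∀ t ∈ Set.Icc 0 T, t ≠ σ := fun t ht h => hσ (h ▸ ht)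
  let ζ : ℝ → E := fun t => (D t).inverse (A t w)
  have hev : ∀ t ∈ Set.Icc 0 T, ∀ᶠ s in 𝓝 t, D s (ζ s) = A s w := by
    intro t ht
    filter_upwards [isOpen_ne.mem_nhds (hne t ht)] with s hs
    obtain ⟨e, he⟩ := hinv s hs
    simp only [ζ]
    rw [← he, ContinuousLinearMap.inverse_equiv]
    exact e.apply_symm_apply _
  have hDζ : ∀ t ∈ Set.Icc 0 T, D t (ζ t) = A t w := fun t ht => (hev t ht).self_of_nhds
  have hζ : ∀ t ∈ Set.Icc 0 T, HasDerivAt ζ (deriv ζ t) t := by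
    intro t ht
    have h1 : DifferentiableAt ℝ (fun t => (D t).inverse) t :=
      ((hinv t (hne t ht)).contDiffAt_map_inverse (n := ∞) |>.differentiableAt (by simp)).comp t
        (hD.hasDerivAt hR t).differentiableAt
    exact (h1.clm_apply (hA.sol w t).1.differentiableAt).hasDerivAt
  have hA' : ∀ t ∈ Set.Icc 0 T, A' t w = D' t (ζ t) + D t (deriv ζ t) := by
    intro t ht
    have h1 := (hD.hasDerivAt hR t).clm_apply (hζ t ht)
    exact ((h1.congr_of_eventuallyEq (EventuallyEq.symm (hev t ht))).unique (hA.sol w t).1).symm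
  have hD'd : ∀ t ∈ Set.Icc 0 T, HasDerivAt (fun t => D' t (ζ t))
      (-R t (D t (ζ t)) + D' t (deriv ζ t)) t := by
    intro t ht
    have h : DifferentiableAt ℝ D' t := (contDiffAt_clm_of_apply (n := ∞) fun a =>
      ((hD.sol a).contDiff hR).2.contDiffAt).differentiableAt (by simp)
    have h1 := (h.hasDerivAt.clm_apply (hasDerivAt_const t (ζ t))).unique (hD.sol (ζ t) t).2
    rw [map_zero, add_zero] at h1
    rw [← h1]
    exact h.hasDerivAt.clm_apply (hζ t ht)
  -- `ζ = Z w`, and `A' w - D' ζ = D ζ'` by `hA'`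
  let φ : ℝ → ℝ := fun t => B (A' t w - D' t (ζ t)) (A t w)
  have hφ : ∀ t ∈ Set.Icc 0 T, HasDerivAt φ (B (D t (deriv ζ t)) (D t (deriv ζ t))) t := by
    intro t ht
    have h1 := (B.hasFDerivAt.comp_hasDerivAt t ((hA.sol w t).2.sub (hD'd t ht))).clm_apply
      (hA.sol w t).1
    refine h1.congr_deriv ?_
    have hw := wronskian_eq_zero hsymm (hD.sol (deriv ζ t)) (hD.sol (ζ t))
      (hD.apply_end _) (hD.apply_end _) t
    simp only [Function.comp_apply, Pi.sub_apply]
    rw [hA' t ht, ← hDζ t ht]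
    simp only [map_add, map_sub, map_neg, add_apply, sub_apply, neg_apply]
    linarith
  have hmono : MonotoneOn φ (Set.Icc 0 T) := by
    refine monotoneOn_of_deriv_nonneg (convex_Icc 0 T)
      (fun t ht => (hφ t ht).continuousAt.continuousWithinAt)
      (fun t ht => (hφ t (interior_subset ht)).differentiableAt.differentiableWithinAt) ?_
    intro t ht
    rw [(hφ t (interior_subset ht)).deriv]
    exact hnonneg _
  have h0 : (0 : ℝ) ∈ Set.Icc 0 T := ⟨le_rfl, hT.le⟩
  have h1 := hmono h0 ⟨hT.le, le_rfl⟩ hT.le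
  have hζ0 : ζ 0 = w := by
    have := hDζ 0 h0
    rwa [hD.apply_zero, hA.apply_zero] at this
  simp only [φ] at h1
  rw [hA.apply_end, map_zero, hζ0, hA.apply_zero, map_sub, sub_apply] at h1
  linarith

/-- Along a parallel direction in the kernel of `R` the solution is affine. -/
theorem form_deriv (hA : IsTensorTo R T A A') (hsymm : ∀ t a b, B (R t a) b = B a (R t b)) {v : E}
    (hv : ∀ t, R t v = 0) (hT : T ≠ 0) (w : E) : B (A' 0 w) v = -B w v / T := by
  have hconst : ∀ t, B (A' t w) v = B (A' 0 w) v := by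
    intro t
    refine is_const_of_deriv_eq_zero (f := fun t => B (A' t w) v) ?_ ?_ t 0
    all_goals
      intro t
      have h1 := (B.hasFDerivAt.comp_hasDerivAt t (hA.sol w t).2).clm_apply (hasDerivAt_const t v)
      have h2 := h1.congr_deriv (g' := 0) (by simp [hsymm, hv])
    · exact h2.differentiableAt
    · exact h2.deriv
  have hlin : ∀ t, HasDerivAt (fun t => B (A t w) v - t * B (A' 0 w) v) 0 t := by
    intro t
    have h1 := (B.hasFDerivAt.comp_hasDerivAt t (hA.sol w t).1).clm_apply (hasDerivAt_const t v)
    refine (h1.sub ((hasDerivAt_id t).mul_const (B (A' 0 w) v))).congr_deriv ?_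
    rw [map_zero, add_zero, hconst, one_mul, sub_self]
  have h := is_const_of_deriv_eq_zero (fun t => (hlin t).differentiableAt)
    (fun t => (hlin t).deriv) T 0
  simp only [hA.apply_end, hA.apply_zero, map_zero, zero_apply, zero_mul, sub_zero] at h
  field_simp
  linarith

end IsTensorTo

/-- In finite dimension, convergence can be tested by pairing with a positive definite form. -/
theorem tendsto_of_form_tendsto [FiniteDimensional ℝ E] (hpos : ∀ a, a ≠ 0 → 0 < B a a)
    {x : ℝ → E} {l : Filter ℝ} [l.NeBot] (h : ∀ b, ∃ c, Tendsto (fun t => B (x t) b) l (𝓝 c)) :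
    ∃ a, Tendsto x l (𝓝 a) := by
  let b := Module.finBasis ℝ E
  let f : E →ₗ[ℝ] (Fin (Module.finrank ℝ E) → ℝ) := LinearMap.pi fun i => (B.flip (b i)).toLinearMap
  have hf : ∀ a i, f a i = B a (b i) := fun a i => rfl
  have hinj : Function.Injective f := by
    refine (injective_iff_map_eq_zero f).2 fun a ha => ?_
    by_contra hne
    have h0 : (B a).toLinearMap = 0 := b.ext fun i => by
      have := congrFun ha i
      rwa [hf] at this
    have := hpos a hne
    rw [show B a a = (B a).toLinearMap a from rfl, h0] at this
    exact lt_irrefl _ this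
  have hemb := LinearMap.isClosedEmbedding_of_injective (LinearMap.ker_eq_bot.2 hinj)
  choose c hc using fun i => h (b i)
  have hlim : Tendsto (fun t => f (x t)) l (𝓝 c) := tendsto_pi_nhds.2 hc
  obtain ⟨a, ha⟩ := hemb.isClosed_range.mem_of_tendsto hlim
    (Eventually.of_forall fun t => Set.mem_range_self (x t))
  refine ⟨a, hemb.isInducing.tendsto_nhds_iff.2 ?_⟩
  rw [ha]
  exact hlim

/-- Green's theorem on the stable Jacobi tensor: the operators `A_T' 0` converge as `T → ∞`. If `v` is
in the kernel of all `R t`, as the velocity of a geodesic is, the limit takes its values in the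
orthogonal complement of `v`. -/
theorem exists_stable_limit [FiniteDimensional ℝ E] (hR : ContDiff ℝ ∞ R) (hn : NoConjugateTimes R)
    (hsymm : ∀ t a b, B (R t a) b = B a (R t b)) (hB : ∀ a b, B a b = B b a)
    (hpos : ∀ a, a ≠ 0 → 0 < B a a) {v : E} (hv : ∀ t, R t v = 0) :
    ∃ A A' : ℝ → ℝ → E →L[ℝ] E, (∀ T > 0, IsTensorTo R T (A T) (A' T)) ∧ ∃ L : E →ₗ[ℝ] E,
      (∀ w, Tendsto (fun T => A' T 0 w) atTop (𝓝 (L w))) ∧ ∀ w, B v (L w) = 0 := by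
  have hex : ∀ T : ℝ, ∃ A A', T ≠ 0 → IsTensorTo R T A A' := by
    intro T
    by_cases hT : T = 0
    · exact ⟨0, 0, fun h => absurd hT h⟩
    · obtain ⟨A, A', h⟩ := exists_isTensorTo hR hn hT
      exact ⟨A, A', fun _ => h⟩
  choose A A' hA using hex
  have hquad : ∀ w, ∃ c, Tendsto (fun T => B (A' T 0 w) w) atTop (𝓝 c) := by
    intro w
    -- replacing `T` by `max T 1` gives a function which is monotone on the whole line; it is bounded
    -- by comparison with the solution which vanishes at `-1`
    let f : ℝ → ℝ := fun s => B (A' (max s 1) 0 w) w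
    have hm1 : ∀ s : ℝ, 0 < max s 1 := fun s => lt_of_lt_of_le one_pos (le_max_right s 1)
    have hmono : Monotone f := by
      intro s s' hs
      rcases (max_le_max_right (1 : ℝ) hs).eq_or_lt with h | h
      · simp only [f]
        rw [h]
      · exact (hA _ (hm1 s).ne').form_le hR hn hsymm hpos (hm1 s) (hA _ (hm1 s').ne')
          (fun h' => h.not_ge h'.2) w
    have hbdd : BddAbove (Set.range f) := by
      refine ⟨B (A' (-1) 0 w) w, ?_⟩
      rintro _ ⟨s, rfl⟩
      exact (hA _ (hm1 s).ne').form_le hR hn hsymm hpos (hm1 s) (hA (-1) (by norm_num))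
        (fun h' => by linarith [h'.1]) w
    refine ⟨_, (tendsto_atTop_ciSup hmono hbdd).congr' ?_⟩
    filter_upwards [eventually_ge_atTop (1 : ℝ)] with s hs
    simp only [f]
    rw [max_eq_left hs]
  have hlim : ∀ w, ∃ a, Tendsto (fun T => A' T 0 w) atTop (𝓝 a) := by
    intro w
    refine tendsto_of_form_tendsto hpos fun b => ?_
    -- polarization
    obtain ⟨c₁, h₁⟩ := hquad (w + b)
    obtain ⟨c₂, h₂⟩ := hquad w
    obtain ⟨c₃, h₃⟩ := hquad b
    refine ⟨_, (((h₁.sub h₂).sub h₃).div_const 2).congr' ?_⟩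
    filter_upwards [eventually_gt_atTop (0 : ℝ)] with T hT
    have hs := (hA T hT.ne').symm hsymm b w
    have hs' := hB b (A' T 0 w)
    simp only [map_add, add_apply]
    linarith
  choose L hL using hlim
  let L' : E →ₗ[ℝ] E :=
    { toFun := L
      map_add' := fun a b => tendsto_nhds_unique (hL (a + b))
        (((hL a).add (hL b)).congr fun T => (map_add _ a b).symm)
      map_smul' := fun c a => tendsto_nhds_unique (hL (c • a))
        (((hL a).const_smul c).congr fun T => (map_smul _ c a).symm) }
  refine ⟨A, A', fun T hT => hA T hT.ne', L', hL, fun w => ?_⟩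
  have h1 : Tendsto (fun T => B v (A' T 0 w)) atTop (𝓝 (B v (L w))) :=
    ((B v).continuous.tendsto _).comp (hL w)
  have h2 : Tendsto (fun T : ℝ => -B w v / T) atTop (𝓝 0) := tendsto_const_nhds.div_atTop tendsto_id
  refine tendsto_nhds_unique h1 (h2.congr' ?_)
  filter_upwards [eventually_gt_atTop (0 : ℝ)] with T hT
  rw [hB v, (hA T hT.ne').form_deriv hsymm hv hT.ne']

end JacobiEquation

/-! ### Uniqueness of geodesics -/

section Geodesics

variable {E : Type*} [NormedAddCommGroup E] [NormedSpace ℝ E] [FiniteDimensional ℝ E]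
  {M : Type*} [TopologicalSpace M] [ChartedSpace E M] [IsManifold 𝓘(ℝ, E) ∞ M]
  {γ σ : ℝ → M} {t : ℝ} {g : SmoothMetric 𝓘(ℝ, E) M}

/-- The geodesic equation in a chart, as a first order system. -/
def geodesicSpray (g : SmoothMetric 𝓘(ℝ, E) M) (p : M) (x : E × E) : E × E :=
  (x.2, -chris (metricInChart g p) x.1 x.2 x.2)

theorem contDiffAt_geodesicSpray {p : M} {x : E × E} (hx : x.1 ∈ (extChartAt 𝓘(ℝ, E) p).target) :
    ContDiffAt ℝ 1 (geodesicSpray g p) x := by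
  have h1 : ContDiffAt ℝ 1 (chris (metricInChart g p)) x.1 :=
    (contDiffAt_chris (isMetricOn_metricInChart g p) hx).of_le (by exact_mod_cast le_top)
  have h2 : ContDiffAt ℝ 1 (fun z : E × E => chris (metricInChart g p) z.1) x :=
    ContDiffAt.comp (G := E →L[ℝ] E →L[ℝ] E) (g := chris (metricInChart g p)) (f := Prod.fst) x h1
      contDiffAt_fst
  exact contDiffAt_snd.prodMk (contDiffAt_clm_apply₂ h2 contDiffAt_snd contDiffAt_snd).neg

theorem IsGeodesic.hasDerivAt_chart (hγ : IsGeodesic g γ) {p : M}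
    (hp : γ t ∈ (extChartAt 𝓘(ℝ, E) p).source) :
    HasDerivAt (fun s => (chartCurve (E := E) γ p s, coords γ (velocity 𝓘(ℝ, E) γ) p s))
      (geodesicSpray g p (chartCurve γ p t, coords γ (velocity 𝓘(ℝ, E) γ) p t)) t :=
  (hasDerivAt_chartCurve ((hγ.1 t).mdifferentiableAt (by simp)) hp).prodMk
    ((parallelAt_iff hγ.1 (smoothFieldAt_velocity hγ.1 t) hp).1
      ⟨smoothFieldAt_velocity hγ.1 t, hγ.2 t⟩)

theorem IsGeodesic.eventuallyEq (hγ : IsGeodesic g γ) (hσ : IsGeodesic g σ) (h0 : γ t = σ t)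
    {p : M} (hp : γ t ∈ (extChartAt 𝓘(ℝ, E) p).source)
    (h1 : coords γ (velocity 𝓘(ℝ, E) γ) p t = coords σ (velocity 𝓘(ℝ, E) σ) p t) :
    γ =ᶠ[𝓝 t] σ := by
  have hγs := eventually_mem_source (hγ.1 t).continuousAt hp
  have hσs := eventually_mem_source (hσ.1 t).continuousAt (h0 ▸ hp)
  obtain ⟨K, U, hU, hK⟩ := (contDiffAt_geodesicSpray (g := g) (p := p)
    (x := (chartCurve γ p t, coords γ (velocity 𝓘(ℝ, E) γ) p t))
    ((extChartAt 𝓘(ℝ, E) p).map_source hp)).exists_lipschitzOnWith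
  have heq : (chartCurve (E := E) γ p t, coords γ (velocity 𝓘(ℝ, E) γ) p t) =
      (chartCurve σ p t, coords σ (velocity 𝓘(ℝ, E) σ) p t) :=
    Prod.ext (congrArg (extChartAt 𝓘(ℝ, E) p) h0) h1
  have key := ODE_solution_unique_of_eventually (v := fun _ => geodesicSpray g p)
    (s := fun _ => U) (K := K) (t₀ := t)
    (f := fun s => (chartCurve (E := E) γ p s, coords γ (velocity 𝓘(ℝ, E) γ) p s))
    (g := fun s => (chartCurve (E := E) σ p s, coords σ (velocity 𝓘(ℝ, E) σ) p s))
    (Eventually.of_forall fun _ => hK) ?_ ?_ heq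
  · filter_upwards [key, hγs, hσs] with s hs h2 h3
    exact (extChartAt 𝓘(ℝ, E) p).injOn h2 h3 (congrArg Prod.fst hs)
  · filter_upwards [hγs, (hγ.hasDerivAt_chart hp).continuousAt.preimage_mem_nhds hU] with s hs h2
    exact ⟨hγ.hasDerivAt_chart hs, h2⟩
  · filter_upwards [hσs, (hσ.hasDerivAt_chart (h0 ▸ hp)).continuousAt.preimage_mem_nhds
      (heq ▸ hU)] with s hs h2
    exact ⟨hσ.hasDerivAt_chart hs, h2⟩

/-- A geodesic is determined by its initial velocity. -/
theorem IsGeodesic.eq [T2Space M] (hγ : IsGeodesic g γ) (hσ : IsGeodesic g σ)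
    (h : (⟨γ 0, velocity 𝓘(ℝ, E) γ 0⟩ : TangentBundle 𝓘(ℝ, E) M) = ⟨σ 0, velocity 𝓘(ℝ, E) σ 0⟩) :
    γ = σ := by
  have hsub : (Set.univ : Set ℝ) ⊆ {t | γ =ᶠ[𝓝 t] σ} := by
    refine isPreconnected_univ.subset_of_closure_inter_subset isOpen_setOfPred_eventually_nhds
      ⟨0, Set.mem_univ 0, ?_⟩ ?_
    · have h0 : γ 0 = σ 0 := congrArg Bundle.TotalSpace.proj h
      exact hγ.eventuallyEq hσ h0 (mem_extChartAt_source (γ 0))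
        (congrArg (fun v : TangentBundle 𝓘(ℝ, E) M => (dchart (γ 0) v.1 v.2 : E)) h)
    · rintro t ⟨ht, -⟩
      have hf := mem_closure_iff_frequently.1 ht
      have h0 : γ t = σ t := tendsto_nhds_unique_of_frequently_eq (hγ.1 t).continuousAt
        (hσ.1 t).continuousAt (hf.mono fun s hs => EventuallyEq.eq_of_nhds hs)
      have hp := mem_extChartAt_source (I := 𝓘(ℝ, E)) (γ t)
      have hp' : σ t ∈ (extChartAt 𝓘(ℝ, E) (γ t)).source := by
        rw [← h0]
        exact hp
      refine hγ.eventuallyEq hσ h0 hp ?_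
      refine tendsto_nhds_unique_of_frequently_eq (hγ.hasDerivAt_chart hp).continuousAt.snd
        (hσ.hasDerivAt_chart hp').continuousAt.snd ?_
      refine (hf.and_eventually ((eventually_mem_source (hγ.1 t).continuousAt hp).and
        (eventually_mem_source (hσ.1 t).continuousAt hp'))).mono ?_
      rintro s ⟨hs, h2, h3⟩
      have e : chartCurve (E := E) γ (γ t) =ᶠ[𝓝 s] chartCurve σ (γ t) :=
        (show γ =ᶠ[𝓝 s] σ from hs).fun_comp (extChartAt 𝓘(ℝ, E) (γ t))
      exact (hasDerivAt_chartCurve ((hγ.1 s).mdifferentiableAt (by simp)) h2).unique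
        ((hasDerivAt_chartCurve ((hσ.1 s).mdifferentiableAt (by simp)) h3).congr_of_eventuallyEq e)
  exact funext fun t => EventuallyEq.eq_of_nhds (hsub (Set.mem_univ t))

end Geodesics

/-! ### Stable Jacobi tensors -/

section Stable

section General

variable {E : Type*} [NormedAddCommGroup E] [NormedSpace ℝ E]
  {H : Type*} [TopologicalSpace H] {I : ModelWithCorners ℝ E H}
  {M : Type*} [TopologicalSpace M] [ChartedSpace H M] [IsManifold I ∞ M]

/-- The operators `E_T'(0)` along `γ` converge as `T → ∞` to `L`, defined on the whole tangent space
at `p`, and `L` takes its values in the orthogonal complement of `v`. Here `γ` is the geodesic with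
initial velocity `v` at `p`. -/
def IsStableLimit (g : SmoothMetric I M) (γ : ℝ → M) (p : M) (v : TangentSpace I p)
    (L : TangentSpace I p →ₗ[ℝ] TangentSpace I p) : Prop :=
  ∃ A : ℝ → ∀ t, TangentSpace I p →ₗ[ℝ] TangentSpace I (γ t),
    (∀ T > 0, IsJacobiTensorTo g γ p T (A T)) ∧
    (∀ w, Tendsto (fun T => (covDeriv g γ (fun t => A T t w) 0 : TangentSpace I p)) atTop
      (𝓝 (L w : TangentSpace I p))) ∧
    ∀ w, g.inner p v (L w) = 0

/-- The trace of the stable Riccati solution is the trace of the limit operator on the whole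
tangent space. -/
theorem trStable_eq_trace [FiniteDimensional ℝ E] {g : SmoothMetric I M} {γ : ℝ → M} {p : M}
    {v : TangentSpace I p} {L : TangentSpace I p →ₗ[ℝ] TangentSpace I p} (hγ : IsGeodesic g γ)
    (hv : (⟨γ 0, velocity I γ 0⟩ : TangentBundle I M) = ⟨p, v⟩)
    (hgeo : ∀ σ, IsGeodesic g σ → (⟨σ 0, velocity I σ 0⟩ : TangentBundle I M) = ⟨p, v⟩ → σ = γ)
    (htens : ∀ T > 0, ∀ A A', IsJacobiTensorTo g γ p T A → IsJacobiTensorTo g γ p T A' →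
      ∀ t w, A t w = A' t w) (hL : IsStableLimit g γ p v L) :
    trStable g p v = LinearMap.trace ℝ (TangentSpace I p) L := by
  obtain ⟨A, hA, hlim, hperp⟩ := hL
  have hmem : ∀ w, L w ∈ perp g p v := fun w => hperp w
  have hU : IsStableRiccati g p v (L.restrict fun w _ => hmem w) := by
    intro σ hσ hσv
    obtain rfl := hgeo σ hσ hσv
    exact ⟨A, hA, fun w => hlim w⟩
  have hex : ∃ U, IsStableRiccati g p v U := ⟨_, hU⟩
  have hchoose : hex.choose = L.restrict fun w _ => hmem w := by
    obtain ⟨A', hA', hlim'⟩ := hex.choose_spec γ hγ hv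
    refine LinearMap.ext fun w => Subtype.ext ?_
    refine tendsto_nhds_unique (X := E) (hlim' w) ((hlim w).congr' ?_)
    filter_upwards [eventually_gt_atTop (0 : ℝ)] with T hT
    have := funext fun t => htens T hT _ _ (hA T hT) (hA' T hT) t w
    rw [this]
  unfold trStable stableRiccati
  rw [dif_pos hex, hchoose]
  have : Module.Finite ℝ (TangentSpace I p) := inferInstanceAs (Module.Finite ℝ E)
  have : Module.Free ℝ (TangentSpace I p) := inferInstanceAs (Module.Free ℝ E)
  exact LinearMap.trace_restrict_eq_of_forall_mem (M := TangentSpace I p) (perp g p v) L hmem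

end General

end Stable

/-! ### Existence of the stable limit -/

section StableExistence

set_option linter.unusedSectionVars false

variable {E : Type*} [NormedAddCommGroup E] [NormedSpace ℝ E] [FiniteDimensional ℝ E]
  {M : Type*} [TopologicalSpace M] [ChartedSpace E M] [IsManifold 𝓘(ℝ, E) ∞ M]
  {γ : ℝ → M} {g : SmoothMetric 𝓘(ℝ, E) M} {P R : ℝ → E →L[ℝ] E}

theorem IsParallelTransport.velocity_eq (hP : IsParallelTransport g γ P) (hγ : IsGeodesic g γ)
    (t : ℝ) : @Eq E (P t (velocity 𝓘(ℝ, E) γ 0)) (velocity 𝓘(ℝ, E) γ t) :=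
  ParallelAt.eq_of_eq hγ.1 isOpen_univ isPreconnected_univ
    (fun t _ => hP.parallel (velocity 𝓘(ℝ, E) γ 0) t)
    (fun t _ => ⟨smoothFieldAt_velocity hγ.1 t, hγ.2 t⟩) (Set.mem_univ 0) (Set.mem_univ t)
    (hP.zero _)

theorem IsParallelTransport.isJacobiField (hP : IsParallelTransport g γ P)
    (hγ : IsGeodesic g γ) (hRs : ContDiff ℝ ∞ R)
    (hR : ∀ t w, @Eq E (P t (R t w)) (curvature g (γ t) (P t w) (velocity 𝓘(ℝ, E) γ t)
      (velocity 𝓘(ℝ, E) γ t))) {y z : ℝ → E} (h : IsJacobiSol R y z) :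
    IsJacobiField g γ (fun s => P s (y s)) :=
  (hP.isJacobiField_iff hγ.1 hR y).2 ⟨(h.contDiff hRs).1, h.deriv_deriv⟩

theorem IsParallelTransport.noConjugateTimes (hP : IsParallelTransport g γ P)
    (hγ : IsGeodesic g γ) (hv : velocity 𝓘(ℝ, E) γ 0 ≠ 0) (hn : NoConjugatePoints g)
    (hRs : ContDiff ℝ ∞ R)
    (hR : ∀ t w, @Eq E (P t (R t w)) (curvature g (γ t) (P t w) (velocity 𝓘(ℝ, E) γ t)
      (velocity 𝓘(ℝ, E) γ t))) : NoConjugateTimes R := by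
  intro y z h a b hab ha hb t
  have h1 := hn γ hγ hv _ (hP.isJacobiField hγ hRs hR h) a b hab
    ((congrArg (P a) ha).trans (map_zero (P a))) ((congrArg (P b) hb).trans (map_zero (P b))) t
  exact hP.injective hγ.1 t (Eq.trans h1 (map_zero (P t)).symm)

/-- Without conjugate points, a Jacobi field is determined by its values at two times. -/
theorem IsJacobiField.eq_of_eq (hγ : IsGeodesic g γ) (hv : velocity 𝓘(ℝ, E) γ 0 ≠ 0)
    (hn : NoConjugatePoints g) {Y Z : ∀ t, TangentSpace 𝓘(ℝ, E) (γ t)} (hY : IsJacobiField g γ Y)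
    (hZ : IsJacobiField g γ Z) {a b : ℝ} (hab : a ≠ b) (ha : Y a = Z a) (hb : Y b = Z b) (t : ℝ) :
    Y t = Z t := by
  obtain ⟨P, hP⟩ := exists_parallelTransport g hγ.1
  obtain ⟨R, hRs, hR⟩ := hP.exists_jacobiOperator hγ.1
  have hn' := hP.noConjugateTimes hγ hv hn hRs hR
  choose y hy using fun t => hP.surjective hγ.1 t (Y t)
  choose z hz using fun t => hP.surjective hγ.1 t (Z t)
  obtain rfl : (fun t => P t (y t)) = Y := funext hy
  obtain rfl : (fun t => P t (z t)) = Z := funext hz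
  obtain ⟨hy1, hy2⟩ := (hP.isJacobiField_iff hγ.1 hR y).1 hY
  obtain ⟨hz1, hz2⟩ := (hP.isJacobiField_iff hγ.1 hR z).1 hZ
  have ha' : y a = z a := hP.injective hγ.1 a ha
  have hb' : y b = z b := hP.injective hγ.1 b hb
  have h := hn' _ _ ((isJacobiSol_of_deriv hy1 hy2).add ((isJacobiSol_of_deriv hz1 hz2).smul (-1)))
    a b hab (by rw [ha', neg_one_smul, add_neg_cancel]) (by rw [hb', neg_one_smul, add_neg_cancel])
    t
  rw [neg_one_smul, ← sub_eq_add_neg, sub_eq_zero] at h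
  exact congrArg (P t) h

/-- Jacobi fields with the same value at `0` which vanish at `T` agree. The form of the hypotheses is
that of `IsJacobiTensorTo`. -/
theorem IsJacobiTensorTo.unique (hγ : IsGeodesic g γ) {p : M} {v : TangentSpace 𝓘(ℝ, E) p}
    (h0 : (⟨γ 0, velocity 𝓘(ℝ, E) γ 0⟩ : TangentBundle 𝓘(ℝ, E) M) = ⟨p, v⟩) (hv : v ≠ 0)
    (hn : NoConjugatePoints g) {T : ℝ} (hT : 0 < T)
    {Y Z : ∀ t, TangentSpace 𝓘(ℝ, E) (γ t)} (hY : IsJacobiField g γ Y) (hZ : IsJacobiField g γ Z)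
    (hYZ : (⟨γ 0, Y 0⟩ : TangentBundle 𝓘(ℝ, E) M) = ⟨γ 0, Z 0⟩) (hYT : Y T = 0) (hZT : Z T = 0)
    (t : ℝ) : Y t = Z t := by
  cases h0
  refine IsJacobiField.eq_of_eq hγ hv hn hY hZ hT.ne ?_ (hYT.trans hZT.symm) t
  exact (Bundle.TotalSpace.mk_inj).1 hYZ

/-- The stable limit exists along any nonconstant geodesic, which need not have unit speed. -/
theorem IsGeodesic.exists_stableLimit (hγ : IsGeodesic g γ) {p : M} {v : TangentSpace 𝓘(ℝ, E) p}
    (h0 : (⟨γ 0, velocity 𝓘(ℝ, E) γ 0⟩ : TangentBundle 𝓘(ℝ, E) M) = ⟨p, v⟩) (hv : v ≠ 0)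
    (hn : NoConjugatePoints g) : ∃ L, IsStableLimit g γ p v L := by
  cases h0
  obtain ⟨P, hP⟩ := exists_parallelTransport g hγ.1
  obtain ⟨R, hRs, hR⟩ := hP.exists_jacobiOperator hγ.1
  have hn' := hP.noConjugateTimes hγ hv hn hRs hR
  let B : E →L[ℝ] E →L[ℝ] ℝ := g.inner (γ 0)
  have hker : ∀ t, R t (velocity 𝓘(ℝ, E) γ 0) = 0 := by
    intro t
    refine hP.injective hγ.1 t ((hR t _).trans (Eq.trans ?_ (map_zero (P t)).symm))
    have e := congrArg (fun u : E => (curvature g (γ t) u (velocity 𝓘(ℝ, E) γ t)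
      (velocity 𝓘(ℝ, E) γ t) : E)) (hP.velocity_eq hγ t)
    exact e.trans (curvature_self g _ _ _)
  have hsymm : ∀ t a b, B (R t a) b = B a (R t b) := by
    intro t a b
    refine (hP.inner_eq hγ.1 t _ _).symm.trans (Eq.trans ?_ (hP.inner_eq hγ.1 t _ _))
    have e1 := congrArg (fun u : E => (g.inner (γ t) u (P t b) : ℝ)) (hR t a)
    have e2 := congrArg (fun u : E => (g.inner (γ t) (P t a) u : ℝ)) (hR t b)
    exact e1.trans ((curvature_jacobi_symm g _ _ _ _).trans e2.symm)
  obtain ⟨A, A', hA, L, hL, hLv⟩ := exists_stable_limit (B := B) hRs hn' hsymm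
    (fun a b => g.symm (γ 0) a b) (fun a ha => g.pos (γ 0) a ha) hker
  refine ⟨L, fun T t => (P t ∘L A T t : E →L[ℝ] E).toLinearMap, fun T hT => ⟨fun w => ?_,
    fun w => ?_, fun w => ?_⟩, fun w => ?_, hLv⟩
  · exact hP.isJacobiField hγ hRs hR ((hA T hT).sol w)
  · have e : P 0 (A T 0 w) = w := (hP.zero _).trans ((hA T hT).apply_zero w)
    exact congrArg (fun u : E => (⟨γ 0, u⟩ : TangentBundle 𝓘(ℝ, E) M)) e
  · have e : P T (A T T w) = 0 := (congrArg (P T) ((hA T hT).apply_end w)).trans (map_zero _)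
    exact e
  · refine Tendsto.congr' ?_ (hL w)
    filter_upwards [eventually_gt_atTop (0 : ℝ)] with T hT
    have h1 := (((hA T hT).sol w).contDiff hRs).1
    refine Eq.symm ((hP.covDeriv_eq hγ.1 (h1.contDiffAt (x := 0))).trans ?_)
    exact (hP.zero _).trans ((hA T hT).sol w 0).1.deriv

end StableExistence

/-! ### Affine reparametrization -/

section Rescale

set_option linter.unusedSectionVars false

variable {E : Type*} [NormedAddCommGroup E] [NormedSpace ℝ E] [FiniteDimensional ℝ E]
  {M : Type*} [TopologicalSpace M] [ChartedSpace E M] [IsManifold 𝓘(ℝ, E) ∞ M]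
  {γ : ℝ → M} {g : SmoothMetric 𝓘(ℝ, E) M}

theorem velocity_rescale (hγ : ContMDiff 𝓘(ℝ, ℝ) 𝓘(ℝ, E) ∞ γ) (a t : ℝ) :
    @Eq E (velocity 𝓘(ℝ, E) (fun s => γ (a * s)) t) (a • velocity 𝓘(ℝ, E) γ (a * t)) := by
  have hd := (hγ (a * t)).mdifferentiableAt (by simp : (∞ : WithTop ℕ∞) ≠ 0)
  have h1 : HasMFDerivAt 𝓘(ℝ, ℝ) 𝓘(ℝ, ℝ) (fun s : ℝ => a * s) t
      (ContinuousLinearMap.toSpanSingleton ℝ a) := by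
    have : HasDerivAt (fun s : ℝ => a * s) a t := by
      simpa using (hasDerivAt_id t).const_mul a
    exact hasMFDerivAt_iff_hasFDerivAt.2 this.hasFDerivAt
  have h2 := (hd.hasMFDerivAt.comp t h1).mfderiv
  have h3 := congrArg (fun L : ℝ →L[ℝ] E => L (1 : ℝ)) h2
  refine h3.trans ?_
  change (mfderiv 𝓘(ℝ, ℝ) 𝓘(ℝ, E) γ (a * t) : ℝ →L[ℝ] E) ((1 : ℝ) • a) = _
  have h4 := map_smul (mfderiv 𝓘(ℝ, ℝ) 𝓘(ℝ, E) γ (a * t) : ℝ →L[ℝ] E) a (1 : ℝ)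
  simp only [smul_eq_mul, one_mul, mul_one] at h4 ⊢
  exact h4

theorem covDeriv_rescale (hγ : ContMDiff 𝓘(ℝ, ℝ) 𝓘(ℝ, E) ∞ γ)
    (Y : ∀ t, TangentSpace 𝓘(ℝ, E) (γ t)) (a t : ℝ) :
    @Eq E (covDeriv g (fun s => γ (a * s)) (fun s => Y (a * s)) t)
      (a • covDeriv g γ Y (a * t)) := by
  refine (covDeriv_eq g (fun s => γ (a * s)) (fun s => Y (a * s)) t).trans ?_
  have h1 := covDeriv_eq g γ Y (a * t)
  refine Eq.trans ?_ (congrArg (fun e : E => a • e) h1).symm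
  have h2 : coords (fun s => γ (a * s)) (fun s => Y (a * s)) (γ (a * t)) =
    fun s => coords γ Y (γ (a * t)) (a * s) := rfl
  have h3 : coords (fun s => γ (a * s)) (velocity 𝓘(ℝ, E) (fun s => γ (a * s))) (γ (a * t)) t =
      a • coords γ (velocity 𝓘(ℝ, E) γ) (γ (a * t)) (a * t) :=
    (congrArg (dchart (E := E) (γ (a * t)) (γ (a * t))) (velocity_rescale hγ a t)).trans
      (map_smul (dchart (E := E) (γ (a * t)) (γ (a * t))) a _)
  have h4 : deriv (fun s => coords γ Y (γ (a * t)) (a * s)) t =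
      a • deriv (coords γ Y (γ (a * t))) (a * t) := deriv_comp_mul_left _ _ _
  rw [h3, h2, h4, map_smul, smul_add]
  rfl

theorem covDeriv_const_smul (Y : ∀ t, TangentSpace 𝓘(ℝ, E) (γ t)) (c t : ℝ) :
    @Eq E (covDeriv g γ (fun s => c • Y s) t) (c • covDeriv g γ Y t) := by
  refine (covDeriv_eq g γ (fun s => c • Y s) t).trans ?_
  refine Eq.trans ?_ (congrArg (fun e : E => c • e) (covDeriv_eq g γ Y t)).symm
  have h1 : coords γ (fun s => c • Y s) (γ t) = c • coords γ Y (γ t) :=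
    funext fun s => map_smul _ _ _
  rw [h1, deriv_const_smul_field, Pi.smul_apply, map_smul, smul_add]

theorem IsGeodesic.rescale (hγ : IsGeodesic g γ) (a : ℝ) : IsGeodesic g (fun s => γ (a * s)) := by
  refine ⟨hγ.1.comp (contDiff_const.mul contDiff_id).contMDiff, fun t => ?_⟩
  have h1 : (velocity 𝓘(ℝ, E) (fun s => γ (a * s))) =
      fun s => a • (fun s => velocity 𝓘(ℝ, E) γ (a * s) : ∀ s, TangentSpace 𝓘(ℝ, E) (γ (a * s))) s :=
    funext fun s => velocity_rescale hγ.1 a s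
  rw [h1]
  refine (covDeriv_const_smul (E := E) (γ := fun s => γ (a * s)) _ a t).trans ?_
  refine (congrArg (fun e : E => a • e) (covDeriv_rescale (E := E) hγ.1 _ a t)).trans ?_
  refine (congrArg (fun e : E => a • a • e) (hγ.2 (a * t))).trans ?_
  exact (congrArg (fun e : E => a • e) (smul_zero a)).trans (smul_zero a)

theorem IsJacobiField.rescale (hγ : ContMDiff 𝓘(ℝ, ℝ) 𝓘(ℝ, E) ∞ γ)
    {Y : ∀ t, TangentSpace 𝓘(ℝ, E) (γ t)} (hY : IsJacobiField g γ Y) (a : ℝ) :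
    IsJacobiField g (fun s => γ (a * s)) (fun s => Y (a * s)) := by
  refine ⟨hY.1.comp (contDiff_const.mul contDiff_id).contMDiff, fun t => ?_⟩
  have h1 : covDeriv g (fun s => γ (a * s)) (fun s => Y (a * s)) =
      fun s => a • (fun s => covDeriv g γ Y (a * s) : ∀ s, TangentSpace 𝓘(ℝ, E) (γ (a * s))) s :=
    funext fun s => covDeriv_rescale hγ Y a s
  have h2 : @Eq E (covDeriv g (fun s => γ (a * s)) (covDeriv g (fun s => γ (a * s))
      (fun s => Y (a * s))) t) (a • a • covDeriv g γ (covDeriv g γ Y) (a * t)) := by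
    rw [h1]
    refine (covDeriv_const_smul (E := E) (γ := fun s => γ (a * s)) _ a t).trans ?_
    exact congrArg (fun e : E => a • e) (covDeriv_rescale (E := E) hγ _ a t)
  have h3 : @Eq E (curvature g (γ (a * t)) (Y (a * t))
      (velocity 𝓘(ℝ, E) (fun s => γ (a * s)) t) (velocity 𝓘(ℝ, E) (fun s => γ (a * s)) t))
      (a • a • curvature g (γ (a * t)) (Y (a * t)) (velocity 𝓘(ℝ, E) γ (a * t))
        (velocity 𝓘(ℝ, E) γ (a * t))) :=
    (congrArg (fun v : E => (curvature g (γ (a * t)) (Y (a * t)) v v : E))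
      (velocity_rescale hγ a t)).trans (curvature_smul_smul g _ a _ _)
  refine (congrArg₂ (fun x y : E => x + y) h2 h3).trans ?_
  have h4 : ∀ x y : E, x + y = 0 → a • a • x + a • a • y = 0 := fun x y h => by
    rw [← smul_add, ← smul_add, h, smul_zero, smul_zero]
  exact h4 _ _ (hY.2 (a * t))

/-- The Jacobi tensor along `s ↦ γ (a s)` which vanishes at `T` is `s ↦ A_{aT}(a s)`, where `A_T` are
those along `γ`. -/
theorem IsStableLimit.rescale (hγ : ContMDiff 𝓘(ℝ, ℝ) 𝓘(ℝ, E) ∞ γ) {p : M}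
    {v : TangentSpace 𝓘(ℝ, E) p} {L : TangentSpace 𝓘(ℝ, E) p →ₗ[ℝ] TangentSpace 𝓘(ℝ, E) p}
    (hL : IsStableLimit g γ p v L) {a : ℝ} (ha : 0 < a) :
    IsStableLimit g (fun s => γ (a * s)) p (a • v) (a • L) := by
  obtain ⟨A, hA, hlim, hv⟩ := hL
  refine ⟨fun T t => A (a * T) (a * t), fun T hT => ⟨fun w => ?_, fun w => ?_, fun w => ?_⟩,
    fun w => ?_, fun w => ?_⟩
  · exact ((hA _ (mul_pos ha hT)).1 w).rescale hγ a
  · exact (congrArg (fun t => (⟨γ t, A (a * T) t w⟩ : TangentBundle 𝓘(ℝ, E) M))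
      (mul_zero a)).trans ((hA _ (mul_pos ha hT)).2.1 w)
  · exact (hA _ (mul_pos ha hT)).2.2 w
  · have h1 := (hlim w).comp (tendsto_id.const_mul_atTop ha)
    refine Tendsto.congr ?_ (h1.const_smul a)
    intro T
    refine Eq.symm ((covDeriv_rescale (E := E) hγ (fun t => A (a * T) t w) a 0).trans ?_)
    exact congrArg (fun t => a • (covDeriv g γ (fun t => A (a * T) t w) t : E)) (mul_zero a)
  · have h1 : g.inner p (a • v) (a • L w) = a * (a * g.inner p v (L w)) := by
      rw [map_smul, map_smul]
      rfl
    exact h1.trans (by rw [hv w, mul_zero, mul_zero])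

/-- The initial velocity of a rescaled curve. -/
theorem base_rescale (hγ : ContMDiff 𝓘(ℝ, ℝ) 𝓘(ℝ, E) ∞ γ) {p : M} {v : TangentSpace 𝓘(ℝ, E) p}
    (h0 : (⟨γ 0, velocity 𝓘(ℝ, E) γ 0⟩ : TangentBundle 𝓘(ℝ, E) M) = ⟨p, v⟩) (a : ℝ) :
    (⟨γ (a * 0), velocity 𝓘(ℝ, E) (fun s => γ (a * s)) 0⟩ : TangentBundle 𝓘(ℝ, E) M) =
      ⟨p, a • v⟩ := by
  have h1 : (⟨γ (a * 0), velocity 𝓘(ℝ, E) (fun s => γ (a * s)) 0⟩ : TangentBundle 𝓘(ℝ, E) M) =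
      ⟨γ (a * 0), a • velocity 𝓘(ℝ, E) γ (a * 0)⟩ :=
    congrArg (fun u : E => (⟨γ (a * 0), u⟩ : TangentBundle 𝓘(ℝ, E) M)) (velocity_rescale hγ a 0)
  refine h1.trans ((congrArg (fun t => (⟨γ t, a • velocity 𝓘(ℝ, E) γ t⟩ :
    TangentBundle 𝓘(ℝ, E) M)) (mul_zero a)).trans ?_)
  exact congrArg (fun q : TangentBundle 𝓘(ℝ, E) M => (⟨q.1, a • q.2⟩ : TangentBundle 𝓘(ℝ, E) M)) h0

end Rescale

/-! ### Riemannian products -/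

section ProductChart

variable {E₁ : Type*} [NormedAddCommGroup E₁] [NormedSpace ℝ E₁] [FiniteDimensional ℝ E₁]
  {E₂ : Type*} [NormedAddCommGroup E₂] [NormedSpace ℝ E₂] [FiniteDimensional ℝ E₂]

theorem hasFDerivAt_prod_sum {F₁ F₂ : Type*} [NormedAddCommGroup F₁] [NormedSpace ℝ F₁]
    [NormedAddCommGroup F₂] [NormedSpace ℝ F₂] {f₁ : F₁ → ℝ} {f₂ : F₂ → ℝ} {y : F₁ × F₂}
    (h₁ : DifferentiableAt ℝ f₁ y.1) (h₂ : DifferentiableAt ℝ f₂ y.2) :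
    HasFDerivAt (fun x : F₁ × F₂ => f₁ x.1 + f₂ x.2)
      ((fderiv ℝ f₁ y.1) ∘L ContinuousLinearMap.fst ℝ F₁ F₂ +
        (fderiv ℝ f₂ y.2) ∘L ContinuousLinearMap.snd ℝ F₁ F₂) y :=
  (h₁.hasFDerivAt.comp y hasFDerivAt_fst).add (h₂.hasFDerivAt.comp y hasFDerivAt_snd)

/-- The Christoffel symbols of a product metric. -/
theorem chris_prod {G₁ : E₁ → E₁ →L[ℝ] E₁ →L[ℝ] ℝ} {G₂ : E₂ → E₂ →L[ℝ] E₂ →L[ℝ] ℝ} {U₁ : Set E₁}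
    {U₂ : Set E₂} (h₁ : IsMetricOn G₁ U₁) (h₂ : IsMetricOn G₂ U₂)
    {G : E₁ × E₂ → E₁ × E₂ →L[ℝ] E₁ × E₂ →L[ℝ] ℝ} {y : E₁ × E₂} (hy₁ : y.1 ∈ U₁) (hy₂ : y.2 ∈ U₂)
    (hG : ∀ᶠ x in 𝓝 y, ∀ v w, G x v w = G₁ x.1 v.1 w.1 + G₂ x.2 v.2 w.2) (v w : E₁ × E₂) :
    chris G y v w = (chris G₁ y.1 v.1 w.1, chris G₂ y.2 v.2 w.2) := by
  have hd₁ := (h₁.contDiffAt hy₁).differentiableAt (by simp)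
  have hd₂ := (h₂.contDiffAt hy₂).differentiableAt (by simp)
  have hev : ∀ v w, (fun x => G x v w) =ᶠ[𝓝 y] fun x => G₁ x.1 v.1 w.1 + G₂ x.2 v.2 w.2 :=
    fun v w => by filter_upwards [hG] with x hx using hx v w
  have hGd : DifferentiableAt ℝ G y := by
    refine (contDiffAt_clm_of_apply (n := ∞) fun v => contDiffAt_clm_of_apply fun w => ?_
      ).differentiableAt (by simp)
    refine ContDiffAt.congr_of_eventuallyEq ?_ (hev v w)
    have e₁ : ContDiffAt ℝ ∞ (fun x => G₁ x v.1 w.1) y.1 :=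
      contDiffAt_clm_apply₂ (h₁.contDiffAt hy₁) contDiffAt_const contDiffAt_const
    have e₂ : ContDiffAt ℝ ∞ (fun x => G₂ x v.2 w.2) y.2 :=
      contDiffAt_clm_apply₂ (h₂.contDiffAt hy₂) contDiffAt_const contDiffAt_const
    exact (e₁.comp y contDiffAt_fst).add (e₂.comp y contDiffAt_snd)
  have hD : ∀ u v w, fderiv ℝ G y u v w =
      fderiv ℝ G₁ y.1 u.1 v.1 w.1 + fderiv ℝ G₂ y.2 u.2 v.2 w.2 := by
    intro u v w
    rw [← fderiv_clm_apply_const₂ hGd, (hev v w).fderiv_eq, ← fderiv_clm_apply_const₂ hd₁,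
      ← fderiv_clm_apply_const₂ hd₂]
    rw [(hasFDerivAt_prod_sum (y := y) (f₁ := fun x => G₁ x v.1 w.1) (f₂ := fun x => G₂ x v.2 w.2)
      (differentiableAt_clm_apply₂ hd₁ (differentiableAt_const _) (differentiableAt_const _))
      (differentiableAt_clm_apply₂ hd₂ (differentiableAt_const _) (differentiableAt_const _))
      ).fderiv]
    rfl
  have hGy := hG.self_of_nhds
  rw [chris_apply]
  refine inverse_unique (isInvertible_of_pos fun v hv => ?_) fun z => ?_
  · rw [hGy]
    have n₁ : ∀ a, 0 ≤ G₁ y.1 a a := fun a => by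
      by_cases h : a = 0
      · simp [h]
      · exact (h₁.pos _ hy₁ _ h).le
    have n₂ : ∀ a, 0 ≤ G₂ y.2 a a := fun a => by
      by_cases h : a = 0
      · simp [h]
      · exact (h₂.pos _ hy₂ _ h).le
    by_cases h : v.1 = 0
    · have h' : v.2 ≠ 0 := fun h' => hv (Prod.ext h h')
      linarith [h₂.pos _ hy₂ _ h', n₁ v.1]
    · linarith [h₁.pos _ hy₁ _ h, n₂ v.2]
  · rw [hGy, chrisFirst_apply, hD, hD, hD]
    have k₁ := h₁.koszul hy₁ v.1 w.1 z.1
    have k₂ := h₂.koszul hy₂ v.2 w.2 z.2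
    dsimp only
    rw [k₁, k₂]
    ring

end ProductChart

section Product

set_option linter.unusedSectionVars false

variable {E₁ : Type*} [NormedAddCommGroup E₁] [NormedSpace ℝ E₁]
  {M₁ : Type*} [TopologicalSpace M₁] [ChartedSpace E₁ M₁] [IsManifold 𝓘(ℝ, E₁) ∞ M₁]
  {E₂ : Type*} [NormedAddCommGroup E₂] [NormedSpace ℝ E₂]
  {M₂ : Type*} [TopologicalSpace M₂] [ChartedSpace E₂ M₂] [IsManifold 𝓘(ℝ, E₂) ∞ M₂]

theorem hasMFDerivAt_prodMk_space {E : Type*} [NormedAddCommGroup E] [NormedSpace ℝ E]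
    {H : Type*} [TopologicalSpace H] {I : ModelWithCorners ℝ E H} {M : Type*} [TopologicalSpace M]
    [ChartedSpace H M] {x : M} {f₁ : M → E₁} {f₂ : M → E₂} {L₁ : TangentSpace I x →L[ℝ] E₁}
    {L₂ : TangentSpace I x →L[ℝ] E₂} (h₁ : HasMFDerivAt I 𝓘(ℝ, E₁) f₁ x L₁)
    (h₂ : HasMFDerivAt I 𝓘(ℝ, E₂) f₂ x L₂) :
    HasMFDerivAt I 𝓘(ℝ, E₁ × E₂) (fun y => (f₁ y, f₂ y)) x (L₁.prod L₂) :=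
  ⟨h₁.1.prodMk h₂.1, HasFDerivWithinAt.prodMk h₁.2 h₂.2⟩

theorem mfderiv_extChartAt_prod {p x : M₁ × M₂}
    (h₁ : x.1 ∈ (extChartAt 𝓘(ℝ, E₁) p.1).source) (h₂ : x.2 ∈ (extChartAt 𝓘(ℝ, E₂) p.2).source)
    (v : TangentSpace (𝓘(ℝ, E₁).prod 𝓘(ℝ, E₂)) x) :
    @Eq (E₁ × E₂) (mfderiv (𝓘(ℝ, E₁).prod 𝓘(ℝ, E₂)) 𝓘(ℝ, E₁ × E₂)
      (extChartAt (𝓘(ℝ, E₁).prod 𝓘(ℝ, E₂)) p) x v)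
      (dchart p.1 x.1 (tangentFst x v), dchart p.2 x.2 (tangentSnd x v)) := by
  have d₁ : HasMFDerivAt 𝓘(ℝ, E₁) 𝓘(ℝ, E₁) (extChartAt 𝓘(ℝ, E₁) p.1) x.1 (dchart p.1 x.1) :=
    (mdifferentiableAt_extChartAt (by simpa using h₁)).hasMFDerivAt
  have d₂ : HasMFDerivAt 𝓘(ℝ, E₂) 𝓘(ℝ, E₂) (extChartAt 𝓘(ℝ, E₂) p.2) x.2 (dchart p.2 x.2) :=
    (mdifferentiableAt_extChartAt (by simpa using h₂)).hasMFDerivAt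
  have d := hasMFDerivAt_prodMk_space (d₁.comp x (hasMFDerivAt_fst x))
    (d₂.comp x (hasMFDerivAt_snd x))
  have e : (extChartAt (𝓘(ℝ, E₁).prod 𝓘(ℝ, E₂)) p : M₁ × M₂ → E₁ × E₂) = fun y =>
      ((extChartAt 𝓘(ℝ, E₁) p.1 ∘ Prod.fst) y, (extChartAt 𝓘(ℝ, E₂) p.2 ∘ Prod.snd) y) := by
    rw [extChartAt_prod]
    rfl
  rw [← e] at d
  exact congrArg (fun L : E₁ × E₂ →L[ℝ] E₁ × E₂ => L v) d.mfderiv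

theorem mfderiv_extChartAt_symm_prod {p : M₁ × M₂} {y : E₁ × E₂}
    (h₁ : y.1 ∈ (extChartAt 𝓘(ℝ, E₁) p.1).target) (h₂ : y.2 ∈ (extChartAt 𝓘(ℝ, E₂) p.2).target)
    (v : E₁ × E₂) :
    @Eq (E₁ × E₂) (mfderiv 𝓘(ℝ, E₁ × E₂) (𝓘(ℝ, E₁).prod 𝓘(ℝ, E₂))
      (extChartAt (𝓘(ℝ, E₁).prod 𝓘(ℝ, E₂)) p).symm y v)
      (dsymm p.1 y.1 v.1, dsymm p.2 y.2 v.2) := by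
  have d₁ : HasMFDerivAt 𝓘(ℝ, E₁) 𝓘(ℝ, E₁) (extChartAt 𝓘(ℝ, E₁) p.1).symm y.1 (dsymm p.1 y.1) :=
    (mdifferentiableAt_symm h₁).hasMFDerivAt
  have d₂ : HasMFDerivAt 𝓘(ℝ, E₂) 𝓘(ℝ, E₂) (extChartAt 𝓘(ℝ, E₂) p.2).symm y.2 (dsymm p.2 y.2) :=
    (mdifferentiableAt_symm h₂).hasMFDerivAt
  have f₁ : HasMFDerivAt 𝓘(ℝ, E₁ × E₂) 𝓘(ℝ, E₁) (Prod.fst : E₁ × E₂ → E₁) y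
    (ContinuousLinearMap.fst ℝ E₁ E₂) := hasMFDerivAt_iff_hasFDerivAt.2 hasFDerivAt_fst
  have f₂ : HasMFDerivAt 𝓘(ℝ, E₁ × E₂) 𝓘(ℝ, E₂) (Prod.snd : E₁ × E₂ → E₂) y
    (ContinuousLinearMap.snd ℝ E₁ E₂) := hasMFDerivAt_iff_hasFDerivAt.2 hasFDerivAt_snd
  have d := (d₁.comp y f₁).prodMk (d₂.comp y f₂)
  have e : ((extChartAt (𝓘(ℝ, E₁).prod 𝓘(ℝ, E₂)) p).symm : E₁ × E₂ → M₁ × M₂) = fun y =>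
      (((extChartAt 𝓘(ℝ, E₁) p.1).symm ∘ Prod.fst) y,
        ((extChartAt 𝓘(ℝ, E₂) p.2).symm ∘ Prod.snd) y) := by
    rw [extChartAt_prod]
    rfl
  rw [← e] at d
  exact congrArg (fun L : E₁ × E₂ →L[ℝ] E₁ × E₂ => L v) d.mfderiv

variable (g₁ : SmoothMetric 𝓘(ℝ, E₁) M₁) (g₂ : SmoothMetric 𝓘(ℝ, E₂) M₂)

theorem metricInChart_prod {p : M₁ × M₂} {y : E₁ × E₂}
    (h₁ : y.1 ∈ (extChartAt 𝓘(ℝ, E₁) p.1).target) (h₂ : y.2 ∈ (extChartAt 𝓘(ℝ, E₂) p.2).target)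
    (v w : E₁ × E₂) : metricInChart (prodMetric g₁ g₂) p y v w =
      metricInChart g₁ p.1 y.1 v.1 w.1 + metricInChart g₂ p.2 y.2 v.2 w.2 := by
  have hv := mfderiv_extChartAt_symm_prod h₁ h₂ v
  have hw := mfderiv_extChartAt_symm_prod h₁ h₂ w
  have hx : (extChartAt (𝓘(ℝ, E₁).prod 𝓘(ℝ, E₂)) p).symm y =
      ((extChartAt 𝓘(ℝ, E₁) p.1).symm y.1, (extChartAt 𝓘(ℝ, E₂) p.2).symm y.2) := by
    rw [extChartAt_prod]
    rfl
  have e₁ := congrArg₂ (fun a b : E₁ × E₂ => ((prodMetric g₁ g₂).inner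
    ((extChartAt (𝓘(ℝ, E₁).prod 𝓘(ℝ, E₂)) p).symm y) a b : ℝ)) hv hw
  refine Eq.trans (show _ = _ from e₁) ?_
  exact congrArg (fun x : M₁ × M₂ => ((prodMetric g₁ g₂).inner x
    ((dsymm p.1 y.1 v.1, dsymm p.2 y.2 v.2) : E₁ × E₂)
    ((dsymm p.1 y.1 w.1, dsymm p.2 y.2 w.2) : E₁ × E₂) : ℝ)) hx

variable [FiniteDimensional ℝ E₁] [FiniteDimensional ℝ E₂]

theorem christoffel_prod {p : M₁ × M₂} {y : E₁ × E₂}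
    (h₁ : y.1 ∈ (extChartAt 𝓘(ℝ, E₁) p.1).target) (h₂ : y.2 ∈ (extChartAt 𝓘(ℝ, E₂) p.2).target)
    (v w : E₁ × E₂) : christoffel (prodMetric g₁ g₂) p y v w =
      (christoffel g₁ p.1 y.1 v.1 w.1, christoffel g₂ p.2 y.2 v.2 w.2) := by
  rw [christoffel_eq_chris, christoffel_eq_chris, christoffel_eq_chris]
  refine chris_prod (isMetricOn_metricInChart g₁ p.1) (isMetricOn_metricInChart g₂ p.2) h₁ h₂ ?_ v w
  filter_upwards [((isOpen_target (E := E₁) p.1).prod (isOpen_target (E := E₂) p.2)).mem_nhds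
    (⟨h₁, h₂⟩ : y ∈ _ ×ˢ _)] with x hx v w
  exact metricInChart_prod g₁ g₂ hx.1 hx.2 v w

theorem curvature_prod (x : M₁ × M₂) (u v w : TangentSpace (𝓘(ℝ, E₁).prod 𝓘(ℝ, E₂)) x) :
    @Eq (E₁ × E₂) (curvature (prodMetric g₁ g₂) x u v w)
      (curvature g₁ x.1 (tangentFst x u) (tangentFst x v) (tangentFst x w),
        curvature g₂ x.2 (tangentSnd x u) (tangentSnd x v) (tangentSnd x w)) := by
  have h₁ := mem_extChartAt_target (I := 𝓘(ℝ, E₁)) x.1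
  have h₂ := mem_extChartAt_target (I := 𝓘(ℝ, E₂)) x.2
  have hy : extChartAt (𝓘(ℝ, E₁).prod 𝓘(ℝ, E₂)) x x =
      (extChartAt 𝓘(ℝ, E₁) x.1 x.1, extChartAt 𝓘(ℝ, E₂) x.2 x.2) := by
    rw [extChartAt_prod]
    rfl
  have hd₁ : DifferentiableAt ℝ (chris (metricInChart g₁ x.1)) (extChartAt 𝓘(ℝ, E₁) x.1 x.1) :=
    (contDiffAt_chris (isMetricOn_metricInChart g₁ x.1) h₁).differentiableAt (by simp)
  have hd₂ : DifferentiableAt ℝ (chris (metricInChart g₂ x.2)) (extChartAt 𝓘(ℝ, E₂) x.2 x.2) :=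
    (contDiffAt_chris (isMetricOn_metricInChart g₂ x.2) h₂).differentiableAt (by simp)
  have hf : ∀ a b c : E₁ × E₂, fderiv ℝ (fun z => christoffel (prodMetric g₁ g₂) x z a b)
      (extChartAt 𝓘(ℝ, E₁) x.1 x.1, extChartAt 𝓘(ℝ, E₂) x.2 x.2) c =
      (fderiv ℝ (fun z => christoffel g₁ x.1 z a.1 b.1) (extChartAt 𝓘(ℝ, E₁) x.1 x.1) c.1,
        fderiv ℝ (fun z => christoffel g₂ x.2 z a.2 b.2) (extChartAt 𝓘(ℝ, E₂) x.2 x.2) c.2) := by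
    intro a b c
    have k₁ : DifferentiableAt ℝ (fun z => christoffel g₁ x.1 z a.1 b.1)
        (extChartAt 𝓘(ℝ, E₁) x.1 x.1) :=
      differentiableAt_clm_apply₂ hd₁ (differentiableAt_const a.1) (differentiableAt_const b.1)
    have k₂ : DifferentiableAt ℝ (fun z => christoffel g₂ x.2 z a.2 b.2)
        (extChartAt 𝓘(ℝ, E₂) x.2 x.2) :=
      differentiableAt_clm_apply₂ hd₂ (differentiableAt_const a.2) (differentiableAt_const b.2)
    have k := HasFDerivAt.prodMap (extChartAt 𝓘(ℝ, E₁) x.1 x.1, extChartAt 𝓘(ℝ, E₂) x.2 x.2)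
      k₁.hasFDerivAt k₂.hasFDerivAt
    have hev : (fun z => christoffel (prodMetric g₁ g₂) x z a b) =ᶠ[𝓝 (extChartAt 𝓘(ℝ, E₁) x.1 x.1,
        extChartAt 𝓘(ℝ, E₂) x.2 x.2)] fun z => (christoffel g₁ x.1 z.1 a.1 b.1,
        christoffel g₂ x.2 z.2 a.2 b.2) := by
      filter_upwards [((isOpen_target (E := E₁) x.1).prod (isOpen_target (E := E₂) x.2)).mem_nhds
        (⟨h₁, h₂⟩ : (extChartAt 𝓘(ℝ, E₁) x.1 x.1, extChartAt 𝓘(ℝ, E₂) x.2 x.2) ∈ _ ×ˢ _)] with z hz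
      exact christoffel_prod g₁ g₂ hz.1 hz.2 a b
    exact congrArg (fun L : E₁ × E₂ →L[ℝ] E₁ × E₂ => L c) (hev.fderiv_eq.trans k.fderiv)
  have hc : ∀ a b : E₁ × E₂, christoffel (prodMetric g₁ g₂) x
      (extChartAt 𝓘(ℝ, E₁) x.1 x.1, extChartAt 𝓘(ℝ, E₂) x.2 x.2) a b =
      (christoffel g₁ x.1 (extChartAt 𝓘(ℝ, E₁) x.1 x.1) a.1 b.1,
        christoffel g₂ x.2 (extChartAt 𝓘(ℝ, E₂) x.2 x.2) a.2 b.2) :=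
    fun a b => christoffel_prod (p := x) g₁ g₂ h₁ h₂ a b
  have key : ∀ u v w : E₁ × E₂,
      fderiv ℝ (fun z => christoffel (prodMetric g₁ g₂) x z v w)
          (extChartAt 𝓘(ℝ, E₁) x.1 x.1, extChartAt 𝓘(ℝ, E₂) x.2 x.2) u
        - fderiv ℝ (fun z => christoffel (prodMetric g₁ g₂) x z u w)
          (extChartAt 𝓘(ℝ, E₁) x.1 x.1, extChartAt 𝓘(ℝ, E₂) x.2 x.2) v
        + christoffel (prodMetric g₁ g₂) x
          (extChartAt 𝓘(ℝ, E₁) x.1 x.1, extChartAt 𝓘(ℝ, E₂) x.2 x.2) u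
          (christoffel (prodMetric g₁ g₂) x
            (extChartAt 𝓘(ℝ, E₁) x.1 x.1, extChartAt 𝓘(ℝ, E₂) x.2 x.2) v w)
        - christoffel (prodMetric g₁ g₂) x
          (extChartAt 𝓘(ℝ, E₁) x.1 x.1, extChartAt 𝓘(ℝ, E₂) x.2 x.2) v
          (christoffel (prodMetric g₁ g₂) x
            (extChartAt 𝓘(ℝ, E₁) x.1 x.1, extChartAt 𝓘(ℝ, E₂) x.2 x.2) u w) =
      (curvature g₁ x.1 u.1 v.1 w.1, curvature g₂ x.2 u.2 v.2 w.2) := by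
    intro u v w
    rw [hf, hf, hc, hc, hc, hc]
    rfl
  unfold curvature
  dsimp only
  rw [hy]
  exact key u v w

end Product

/-! ### Curves and Jacobi fields in a product -/

section ProductCurves

set_option linter.unusedSectionVars false

variable {E₁ : Type*} [NormedAddCommGroup E₁] [NormedSpace ℝ E₁]
  {M₁ : Type*} [TopologicalSpace M₁] [ChartedSpace E₁ M₁] [IsManifold 𝓘(ℝ, E₁) ∞ M₁]
  {E₂ : Type*} [NormedAddCommGroup E₂] [NormedSpace ℝ E₂]
  {M₂ : Type*} [TopologicalSpace M₂] [ChartedSpace E₂ M₂] [IsManifold 𝓘(ℝ, E₂) ∞ M₂]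
  {γ : ℝ → M₁ × M₂} {Y : ∀ t, TangentSpace (𝓘(ℝ, E₁).prod 𝓘(ℝ, E₂)) (γ t)} {t : ℝ}

/-- The first component of a vector field along a curve in the product. -/
def fieldFst (γ : ℝ → M₁ × M₂) (Y : ∀ t, TangentSpace (𝓘(ℝ, E₁).prod 𝓘(ℝ, E₂)) (γ t)) (t : ℝ) :
    TangentSpace 𝓘(ℝ, E₁) (γ t).1 :=
  tangentFst (γ t) (Y t)

/-- The second component of a vector field along a curve in the product. -/
def fieldSnd (γ : ℝ → M₁ × M₂) (Y : ∀ t, TangentSpace (𝓘(ℝ, E₁).prod 𝓘(ℝ, E₂)) (γ t)) (t : ℝ) :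
    TangentSpace 𝓘(ℝ, E₂) (γ t).2 :=
  tangentSnd (γ t) (Y t)

theorem contMDiff_field_iff :
    ContMDiff 𝓘(ℝ, ℝ) (𝓘(ℝ, E₁).prod 𝓘(ℝ, E₂)).tangent ∞
      (fun t => (⟨γ t, Y t⟩ : TangentBundle (𝓘(ℝ, E₁).prod 𝓘(ℝ, E₂)) (M₁ × M₂))) ↔
    ContMDiff 𝓘(ℝ, ℝ) 𝓘(ℝ, E₁).tangent ∞
      (fun t => (⟨(γ t).1, fieldFst γ Y t⟩ : TangentBundle 𝓘(ℝ, E₁) M₁)) ∧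
    ContMDiff 𝓘(ℝ, ℝ) 𝓘(ℝ, E₂).tangent ∞
      (fun t => (⟨(γ t).2, fieldSnd γ Y t⟩ : TangentBundle 𝓘(ℝ, E₂) M₂)) := by
  constructor
  · intro h
    have h1 := (contMDiff_equivTangentBundleProd (n := ∞) (I := 𝓘(ℝ, E₁)) (M := M₁)
      (I' := 𝓘(ℝ, E₂)) (M' := M₂)).comp h
    exact ⟨h1.fst, h1.snd⟩
  · rintro ⟨h1, h2⟩
    exact (contMDiff_equivTangentBundleProd_symm (n := ∞) (I := 𝓘(ℝ, E₁)) (M := M₁)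
      (I' := 𝓘(ℝ, E₂)) (M' := M₂)).comp (h1.prodMk h2)

theorem velocity_prod (h₁ : ContMDiff 𝓘(ℝ, ℝ) 𝓘(ℝ, E₁) ∞ fun t => (γ t).1)
    (h₂ : ContMDiff 𝓘(ℝ, ℝ) 𝓘(ℝ, E₂) ∞ fun t => (γ t).2) (t : ℝ) :
    @Eq (E₁ × E₂) (velocity (𝓘(ℝ, E₁).prod 𝓘(ℝ, E₂)) γ t)
      (velocity 𝓘(ℝ, E₁) (fun t => (γ t).1) t, velocity 𝓘(ℝ, E₂) (fun t => (γ t).2) t) :=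
  congrArg (fun L : ℝ →L[ℝ] E₁ × E₂ => L (1 : ℝ))
    (mfderiv_prodMk ((h₁ t).mdifferentiableAt (by simp)) ((h₂ t).mdifferentiableAt (by simp)))

variable [FiniteDimensional ℝ E₁] [FiniteDimensional ℝ E₂]
  {g₁ : SmoothMetric 𝓘(ℝ, E₁) M₁} {g₂ : SmoothMetric 𝓘(ℝ, E₂) M₂}

theorem covDeriv_prod (h₁ : ContMDiff 𝓘(ℝ, ℝ) 𝓘(ℝ, E₁) ∞ fun t => (γ t).1)
    (h₂ : ContMDiff 𝓘(ℝ, ℝ) 𝓘(ℝ, E₂) ∞ fun t => (γ t).2)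
    (hY₁ : SmoothFieldAt (fun t => (γ t).1) (fieldFst γ Y) t)
    (hY₂ : SmoothFieldAt (fun t => (γ t).2) (fieldSnd γ Y) t) :
    @Eq (E₁ × E₂) (covDeriv (prodMetric g₁ g₂) γ Y t)
      (covDeriv g₁ (fun t => (γ t).1) (fieldFst γ Y) t,
        covDeriv g₂ (fun t => (γ t).2) (fieldSnd γ Y) t) := by
  have m₁ := mem_extChartAt_source (I := 𝓘(ℝ, E₁)) (γ t).1
  have m₂ := mem_extChartAt_source (I := 𝓘(ℝ, E₂)) (γ t).2
  have hev : (fun s => (mfderiv (𝓘(ℝ, E₁).prod 𝓘(ℝ, E₂)) 𝓘(ℝ, E₁ × E₂)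
      (extChartAt (𝓘(ℝ, E₁).prod 𝓘(ℝ, E₂)) (γ t)) (γ s) (Y s) : E₁ × E₂)) =ᶠ[𝓝 t] fun s =>
      (coords (fun t => (γ t).1) (fieldFst γ Y) (γ t).1 s,
        coords (fun t => (γ t).2) (fieldSnd γ Y) (γ t).2 s) := by
    filter_upwards [eventually_mem_source (h₁ t).continuousAt m₁,
      eventually_mem_source (h₂ t).continuousAt m₂] with s hs₁ hs₂
    exact mfderiv_extChartAt_prod hs₁ hs₂ (Y s)
  have d₁ := ((smoothFieldAt_iff (h₁ t) m₁).1 hY₁).differentiableAt (by simp) |>.hasDerivAt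
  have d₂ := ((smoothFieldAt_iff (h₂ t) m₂).1 hY₂).differentiableAt (by simp) |>.hasDerivAt
  have hd := hev.deriv_eq.trans (d₁.prodMk d₂).deriv
  have hy : extChartAt (𝓘(ℝ, E₁).prod 𝓘(ℝ, E₂)) (γ t) (γ t) =
      (extChartAt 𝓘(ℝ, E₁) (γ t).1 (γ t).1, extChartAt 𝓘(ℝ, E₂) (γ t).2 (γ t).2) := by
    rw [extChartAt_prod]
    rfl
  have hc : ∀ v w : E₁ × E₂, christoffel (prodMetric g₁ g₂) (γ t)
      (extChartAt (𝓘(ℝ, E₁).prod 𝓘(ℝ, E₂)) (γ t) (γ t)) v w =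
      (christoffel g₁ (γ t).1 (extChartAt 𝓘(ℝ, E₁) (γ t).1 (γ t).1) v.1 w.1,
        christoffel g₂ (γ t).2 (extChartAt 𝓘(ℝ, E₂) (γ t).2 (γ t).2) v.2 w.2) := by
    rw [hy]
    exact christoffel_prod (p := γ t) g₁ g₂ (mem_extChartAt_target (γ t).1)
      (mem_extChartAt_target (γ t).2)
  have hv := congrArg (fun v : E₁ × E₂ => christoffel (prodMetric g₁ g₂) (γ t)
      (extChartAt (𝓘(ℝ, E₁).prod 𝓘(ℝ, E₂)) (γ t) (γ t)) v (Y t)) (velocity_prod h₁ h₂ t)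
  exact congrArg₂ (fun a b : E₁ × E₂ => a + b) hd (hv.trans (hc _ _))

theorem isJacobiField_prod_iff (h₁ : ContMDiff 𝓘(ℝ, ℝ) 𝓘(ℝ, E₁) ∞ fun t => (γ t).1)
    (h₂ : ContMDiff 𝓘(ℝ, ℝ) 𝓘(ℝ, E₂) ∞ fun t => (γ t).2) :
    IsJacobiField (prodMetric g₁ g₂) γ Y ↔ IsJacobiField g₁ (fun t => (γ t).1) (fieldFst γ Y) ∧
      IsJacobiField g₂ (fun t => (γ t).2) (fieldSnd γ Y) := by
  unfold IsJacobiField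
  rw [contMDiff_field_iff, and_and_and_comm]
  refine and_congr_right fun ⟨hY₁, hY₂⟩ => ?_
  rw [← forall_and]
  refine forall_congr' fun t => ?_
  have e : ∀ s, @Eq (E₁ × E₂) (covDeriv (prodMetric g₁ g₂) γ Y s)
      (covDeriv g₁ (fun t => (γ t).1) (fieldFst γ Y) s,
        covDeriv g₂ (fun t => (γ t).2) (fieldSnd γ Y) s) :=
    fun s => covDeriv_prod h₁ h₂ (hY₁ s) (hY₂ s)
  have e₁ : fieldFst γ (covDeriv (prodMetric g₁ g₂) γ Y) =
      covDeriv g₁ (fun t => (γ t).1) (fieldFst γ Y) := funext fun s => congrArg Prod.fst (e s)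
  have e₂ : fieldSnd γ (covDeriv (prodMetric g₁ g₂) γ Y) =
      covDeriv g₂ (fun t => (γ t).2) (fieldSnd γ Y) := funext fun s => congrArg Prod.snd (e s)
  have k := covDeriv_prod (g₁ := g₁) (g₂ := g₂) (Y := covDeriv (prodMetric g₁ g₂) γ Y) (t := t)
    h₁ h₂ (by rw [e₁]; exact smoothFieldAt_covDeriv g₁ h₁ (Eventually.of_forall hY₁))
    (by rw [e₂]; exact smoothFieldAt_covDeriv g₂ h₂ (Eventually.of_forall hY₂))
  rw [e₁, e₂] at k
  have c := (congrArg (fun v : E₁ × E₂ => (curvature (prodMetric g₁ g₂) (γ t) (Y t) v v : E₁ × E₂))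
    (velocity_prod h₁ h₂ t)).trans (curvature_prod g₁ g₂ (γ t) _ _ _)
  have s := congrArg₂ (fun a b : E₁ × E₂ => a + b) k c
  constructor
  · intro h
    have h' := s.symm.trans h
    exact ⟨congrArg Prod.fst h', congrArg Prod.snd h'⟩
  · rintro ⟨a, b⟩
    exact s.trans (Prod.ext a b)

theorem IsGeodesic.fst_snd (h : IsGeodesic (prodMetric g₁ g₂) γ) :
    IsGeodesic g₁ (fun t => (γ t).1) ∧ IsGeodesic g₂ (fun t => (γ t).2) := by
  have h₁ : ContMDiff 𝓘(ℝ, ℝ) 𝓘(ℝ, E₁) ∞ fun t => (γ t).1 := h.1.fst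
  have h₂ : ContMDiff 𝓘(ℝ, ℝ) 𝓘(ℝ, E₂) ∞ fun t => (γ t).2 := h.1.snd
  have e₁ : fieldFst γ (velocity (𝓘(ℝ, E₁).prod 𝓘(ℝ, E₂)) γ) =
      velocity 𝓘(ℝ, E₁) (fun t => (γ t).1) :=
    funext fun s => congrArg Prod.fst (velocity_prod h₁ h₂ s)
  have e₂ : fieldSnd γ (velocity (𝓘(ℝ, E₁).prod 𝓘(ℝ, E₂)) γ) =
      velocity 𝓘(ℝ, E₂) (fun t => (γ t).2) :=
    funext fun s => congrArg Prod.snd (velocity_prod h₁ h₂ s)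
  have k := fun t => covDeriv_prod (g₁ := g₁) (g₂ := g₂)
    (Y := velocity (𝓘(ℝ, E₁).prod 𝓘(ℝ, E₂)) γ) (t := t)
    h₁ h₂ (by rw [e₁]; exact smoothFieldAt_velocity h₁ t)
    (by rw [e₂]; exact smoothFieldAt_velocity h₂ t)
  rw [e₁, e₂] at k
  exact ⟨⟨h₁, fun t => congrArg Prod.fst ((k t).symm.trans (h.2 t))⟩,
    ⟨h₂, fun t => congrArg Prod.snd ((k t).symm.trans (h.2 t))⟩⟩

theorem tangentBundle_prod_ext {x y : M₁ × M₂} {v : TangentSpace (𝓘(ℝ, E₁).prod 𝓘(ℝ, E₂)) x}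
    {w : TangentSpace (𝓘(ℝ, E₁).prod 𝓘(ℝ, E₂)) y} :
    (⟨x, v⟩ : TangentBundle (𝓘(ℝ, E₁).prod 𝓘(ℝ, E₂)) (M₁ × M₂)) = ⟨y, w⟩ ↔
    (⟨x.1, tangentFst x v⟩ : TangentBundle 𝓘(ℝ, E₁) M₁) = ⟨y.1, tangentFst y w⟩ ∧
    (⟨x.2, tangentSnd x v⟩ : TangentBundle 𝓘(ℝ, E₂) M₂) = ⟨y.2, tangentSnd y w⟩ :=
  (equivTangentBundleProd 𝓘(ℝ, E₁) M₁ 𝓘(ℝ, E₂) M₂).injective.eq_iff.symm.trans Prod.ext_iff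

end ProductCurves

/-! ### The stable Riccati solution of a product -/

section FactorTrace

set_option linter.unusedSectionVars false

variable {E : Type*} [NormedAddCommGroup E] [NormedSpace ℝ E] [FiniteDimensional ℝ E]
  {M : Type*} [TopologicalSpace M] [T2Space M] [ChartedSpace E M] [IsManifold 𝓘(ℝ, E) ∞ M]
  {g : SmoothMetric 𝓘(ℝ, E) M}

/-- On a complete manifold without conjugate points the trace of the stable Riccati solution is the
trace of a genuine limit. -/
theorem exists_stableLimit_trace (hc : IsComplete g) (hn : NoConjugatePoints g) {p : M}
    {v : TangentSpace 𝓘(ℝ, E) p} (hv : v ≠ 0) :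
    ∃ (γ : ℝ → M) (L : TangentSpace 𝓘(ℝ, E) p →ₗ[ℝ] TangentSpace 𝓘(ℝ, E) p), IsGeodesic g γ ∧
      (⟨γ 0, velocity 𝓘(ℝ, E) γ 0⟩ : TangentBundle 𝓘(ℝ, E) M) = ⟨p, v⟩ ∧
      IsStableLimit g γ p v L ∧ trStable g p v = LinearMap.trace ℝ (TangentSpace 𝓘(ℝ, E) p) L := by
  obtain ⟨γ, hγ, h0⟩ := hc p v
  obtain ⟨L, hL⟩ := hγ.exists_stableLimit h0 hv hn
  refine ⟨γ, L, hγ, h0, hL, trStable_eq_trace hγ h0 (fun σ hσ h => hσ.eq hγ (h.trans h0.symm)) ?_ hL⟩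
  intro T hT A A' hA hA' t w
  refine IsJacobiTensorTo.unique hγ h0 hv hn hT (hA.1 w) (hA'.1 w)
    ((hA.2.1 w).trans (hA'.2.1 w).symm) (hA.2.2 w) (hA'.2.2 w) t

theorem exists_unit_vector [Nontrivial E] (g : SmoothMetric 𝓘(ℝ, E) M) (p : M) :
    ∃ v : TangentSpace 𝓘(ℝ, E) p, g.inner p v v = 1 := by
  obtain ⟨w, hw⟩ := exists_ne (0 : E)
  have hpos : 0 < g.inner p w w := g.pos p w hw
  set c : ℝ := g.inner p w w with hc
  have h : ∀ r : ℝ, g.inner p (r • w : E) (r • w : E) = r * (r * c) := by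
    intro r
    have h1 : g.inner p (r • w : E) = r • g.inner p w := map_smul (g.inner p) r w
    have h2 : g.inner p w (r • w : E) = r • g.inner p w w := map_smul (g.inner p w) r w
    rw [h1]
    exact congrArg (fun x : ℝ => r * x) h2
  refine ⟨((Real.sqrt c)⁻¹ • w : E), (h _).trans ?_⟩
  have hs := Real.sqrt_pos.2 hpos
  have hs2 := Real.mul_self_sqrt hpos.le
  field_simp
  nlinarith

end FactorTrace

section ProductTrace

set_option linter.unusedSectionVars false

variable {E₁ : Type*} [NormedAddCommGroup E₁] [NormedSpace ℝ E₁]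
  {M₁ : Type*} [TopologicalSpace M₁] [ChartedSpace E₁ M₁] [IsManifold 𝓘(ℝ, E₁) ∞ M₁]
  {E₂ : Type*} [NormedAddCommGroup E₂] [NormedSpace ℝ E₂]
  {M₂ : Type*} [TopologicalSpace M₂] [ChartedSpace E₂ M₂] [IsManifold 𝓘(ℝ, E₂) ∞ M₂]

/-- The linear map between tangent spaces of a product which acts componentwise. -/
def tangentProdMap (x y : M₁ × M₂) (L₁ : TangentSpace 𝓘(ℝ, E₁) x.1 →ₗ[ℝ] TangentSpace 𝓘(ℝ, E₁) y.1)
    (L₂ : TangentSpace 𝓘(ℝ, E₂) x.2 →ₗ[ℝ] TangentSpace 𝓘(ℝ, E₂) y.2) :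
    TangentSpace (𝓘(ℝ, E₁).prod 𝓘(ℝ, E₂)) x →ₗ[ℝ] TangentSpace (𝓘(ℝ, E₁).prod 𝓘(ℝ, E₂)) y :=
  LinearMap.prodMap (M := E₁) (M₂ := E₂) (M₃ := E₁) (M₄ := E₂) L₁ L₂

variable [FiniteDimensional ℝ E₁] [FiniteDimensional ℝ E₂]

theorem trace_tangentProdMap (x : M₁ × M₂)
    (L₁ : TangentSpace 𝓘(ℝ, E₁) x.1 →ₗ[ℝ] TangentSpace 𝓘(ℝ, E₁) x.1)
    (L₂ : TangentSpace 𝓘(ℝ, E₂) x.2 →ₗ[ℝ] TangentSpace 𝓘(ℝ, E₂) x.2) :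
    LinearMap.trace ℝ (TangentSpace (𝓘(ℝ, E₁).prod 𝓘(ℝ, E₂)) x) (tangentProdMap x x L₁ L₂) =
      LinearMap.trace ℝ (TangentSpace 𝓘(ℝ, E₁) x.1) L₁ +
      LinearMap.trace ℝ (TangentSpace 𝓘(ℝ, E₂) x.2) L₂ := by
  have h : ∀ (A : E₁ →ₗ[ℝ] E₁) (B : E₂ →ₗ[ℝ] E₂), LinearMap.trace ℝ (E₁ × E₂) (A.prodMap B) =
    LinearMap.trace ℝ E₁ A + LinearMap.trace ℝ E₂ B := LinearMap.trace_prodMap'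
  exact h L₁ L₂

variable {g₁ : SmoothMetric 𝓘(ℝ, E₁) M₁} {g₂ : SmoothMetric 𝓘(ℝ, E₂) M₂} {γ : ℝ → M₁ × M₂}
  {x : M₁ × M₂} {v : TangentSpace (𝓘(ℝ, E₁).prod 𝓘(ℝ, E₂)) x}
  {L₁ : TangentSpace 𝓘(ℝ, E₁) x.1 →ₗ[ℝ] TangentSpace 𝓘(ℝ, E₁) x.1}
  {L₂ : TangentSpace 𝓘(ℝ, E₂) x.2 →ₗ[ℝ] TangentSpace 𝓘(ℝ, E₂) x.2}

/-- The initial velocities of the components of a geodesic in the product. -/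
theorem base_prod (hγ : IsGeodesic (prodMetric g₁ g₂) γ)
    (h0 : (⟨γ 0, velocity (𝓘(ℝ, E₁).prod 𝓘(ℝ, E₂)) γ 0⟩ :
      TangentBundle (𝓘(ℝ, E₁).prod 𝓘(ℝ, E₂)) (M₁ × M₂)) = ⟨x, v⟩) :
    (⟨(γ 0).1, velocity 𝓘(ℝ, E₁) (fun t => (γ t).1) 0⟩ : TangentBundle 𝓘(ℝ, E₁) M₁) =
      ⟨x.1, tangentFst x v⟩ ∧
    (⟨(γ 0).2, velocity 𝓘(ℝ, E₂) (fun t => (γ t).2) 0⟩ : TangentBundle 𝓘(ℝ, E₂) M₂) =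
      ⟨x.2, tangentSnd x v⟩ := by
  obtain ⟨h₁, h₂⟩ := hγ.fst_snd
  have hv := velocity_prod h₁.1 h₂.1 0
  obtain ⟨e₁, e₂⟩ := tangentBundle_prod_ext.1 h0
  exact ⟨(congrArg (fun u : E₁ × E₂ => (⟨(γ 0).1, u.1⟩ : TangentBundle 𝓘(ℝ, E₁) M₁))
    hv).symm.trans e₁, (congrArg (fun u : E₁ × E₂ => (⟨(γ 0).2, u.2⟩ :
    TangentBundle 𝓘(ℝ, E₂) M₂)) hv).symm.trans e₂⟩

/-- Stable limits of a product are direct sums. -/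
theorem IsStableLimit.prod (hγ : IsGeodesic (prodMetric g₁ g₂) γ)
    (h₁ : IsStableLimit g₁ (fun t => (γ t).1) x.1 (tangentFst x v) L₁)
    (h₂ : IsStableLimit g₂ (fun t => (γ t).2) x.2 (tangentSnd x v) L₂) :
    IsStableLimit (prodMetric g₁ g₂) γ x v (tangentProdMap x x L₁ L₂) := by
  obtain ⟨A₁, hA₁, hl₁, hv₁⟩ := h₁
  obtain ⟨A₂, hA₂, hl₂, hv₂⟩ := h₂
  obtain ⟨hγ₁, hγ₂⟩ := hγ.fst_snd
  have hJ : ∀ T > 0, ∀ w : TangentSpace (𝓘(ℝ, E₁).prod 𝓘(ℝ, E₂)) x,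
      IsJacobiField (prodMetric g₁ g₂) γ (fun t => tangentProdMap x (γ t) (A₁ T t) (A₂ T t) w) :=
    fun T hT w => (isJacobiField_prod_iff hγ₁.1 hγ₂.1).2
      ⟨(hA₁ T hT).1 (tangentFst x w), (hA₂ T hT).1 (tangentSnd x w)⟩
  refine ⟨fun T t => tangentProdMap x (γ t) (A₁ T t) (A₂ T t), fun T hT => ⟨hJ T hT, fun w => ?_,
    fun w => ?_⟩, fun w => ?_, fun w => ?_⟩
  · exact tangentBundle_prod_ext.2 ⟨(hA₁ T hT).2.1 (tangentFst x w),
      (hA₂ T hT).2.1 (tangentSnd x w)⟩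
  · exact Prod.ext ((hA₁ T hT).2.2 (tangentFst x w)) ((hA₂ T hT).2.2 (tangentSnd x w))
  · have hl := (hl₁ (tangentFst x w)).prodMk_nhds (hl₂ (tangentSnd x w))
    refine Tendsto.congr' ?_ hl
    filter_upwards [eventually_gt_atTop (0 : ℝ)] with T hT
    exact (covDeriv_prod (g₁ := g₁) (g₂ := g₂)
      (Y := fun t => tangentProdMap x (γ t) (A₁ T t) (A₂ T t) w) hγ₁.1 hγ₂.1
      (((hA₁ T hT).1 (tangentFst x w)).1 0) (((hA₂ T hT).1 (tangentSnd x w)).1 0)).symm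
  · have e₁ := hv₁ (tangentFst x w)
    have e₂ := hv₂ (tangentSnd x w)
    exact (congrArg₂ (fun a b : ℝ => a + b) e₁ e₂).trans (add_zero 0)

/-- The trace of the stable Riccati solution of a product in a direction with nonzero components.. -/
theorem trStable_prod [T2Space M₁] [T2Space M₂] (hc₁ : IsComplete g₁) (hc₂ : IsComplete g₂)
    (hc : IsComplete (prodMetric g₁ g₂)) (hn₁ : NoConjugatePoints g₁) (hn₂ : NoConjugatePoints g₂)
    {p₁ : M₁} {p₂ : M₂} {v₁ : TangentSpace 𝓘(ℝ, E₁) p₁} {v₂ : TangentSpace 𝓘(ℝ, E₂) p₂}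
    (hv₁ : v₁ ≠ 0) (hv₂ : v₂ ≠ 0) {a b : ℝ} (ha : 0 < a) (hb : 0 < b) :
    trStable (prodMetric g₁ g₂) (p₁, p₂)
      (show TangentSpace (𝓘(ℝ, E₁).prod 𝓘(ℝ, E₂)) (p₁, p₂) from ((a • v₁, b • v₂) : E₁ × E₂)) =
      a * trStable g₁ p₁ v₁ + b * trStable g₂ p₂ v₂ := by
  obtain ⟨σ₁, L₁, hσ₁, h01, hL₁, ht₁⟩ := exists_stableLimit_trace hc₁ hn₁ hv₁
  obtain ⟨σ₂, L₂, hσ₂, h02, hL₂, ht₂⟩ := exists_stableLimit_trace hc₂ hn₂ hv₂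
  obtain ⟨γ, hγ, h0⟩ := hc (p₁, p₂) (show TangentSpace (𝓘(ℝ, E₁).prod 𝓘(ℝ, E₂)) (p₁, p₂) from
    ((a • v₁, b • v₂) : E₁ × E₂))
  obtain ⟨hγ₁, hγ₂⟩ := hγ.fst_snd
  obtain ⟨b₁, b₂⟩ := base_prod hγ h0
  have e₁ : (fun t => (γ t).1) = fun t => σ₁ (a * t) :=
    hγ₁.eq (hσ₁.rescale a) (b₁.trans (base_rescale hσ₁.1 h01 a).symm)
  have e₂ : (fun t => (γ t).2) = fun t => σ₂ (b * t) :=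
    hγ₂.eq (hσ₂.rescale b) (b₂.trans (base_rescale hσ₂.1 h02 b).symm)
  have k₁ := hL₁.rescale hσ₁.1 ha
  have k₂ := hL₂.rescale hσ₂.1 hb
  rw [← e₁] at k₁
  rw [← e₂] at k₂
  have hL := IsStableLimit.prod (x := (p₁, p₂)) (v := ((a • v₁, b • v₂) : E₁ × E₂)) hγ k₁ k₂
  have hne₁ : a • v₁ ≠ 0 := smul_ne_zero ha.ne' hv₁
  have hne₂ : b • v₂ ≠ 0 := smul_ne_zero hb.ne' hv₂
  rw [trStable_eq_trace hγ h0 ?_ ?_ hL, trace_tangentProdMap, map_smul, map_smul, ht₁, ht₂]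
  · rfl
  · intro τ hτ hτ0
    obtain ⟨hτ₁, hτ₂⟩ := hτ.fst_snd
    obtain ⟨c₁, c₂⟩ := base_prod hτ hτ0
    have f₁ := hτ₁.eq hγ₁ (c₁.trans b₁.symm)
    have f₂ := hτ₂.eq hγ₂ (c₂.trans b₂.symm)
    exact funext fun t => Prod.ext (congrFun f₁ t) (congrFun f₂ t)
  · intro T hT A A' hA hA' t w
    obtain ⟨j₁, j₂⟩ := (isJacobiField_prod_iff hγ₁.1 hγ₂.1).1 (hA.1 w)
    obtain ⟨j₁', j₂'⟩ := (isJacobiField_prod_iff hγ₁.1 hγ₂.1).1 (hA'.1 w)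
    obtain ⟨i₁, i₂⟩ := tangentBundle_prod_ext.1 ((hA.2.1 w).trans (hA'.2.1 w).symm)
    exact Prod.ext
      (IsJacobiTensorTo.unique hγ₁ b₁ hne₁ hn₁ hT j₁ j₁' i₁ (congrArg Prod.fst (hA.2.2 w))
        (congrArg Prod.fst (hA'.2.2 w)) t)
      (IsJacobiTensorTo.unique hγ₂ b₂ hne₂ hn₂ hT j₂ j₂' i₂ (congrArg Prod.snd (hA.2.2 w))
        (congrArg Prod.snd (hA'.2.2 w)) t)

end ProductTrace

end RiemGeom

end

theorem lemma3p2
    {E₁ : Type*} [NormedAddCommGroup E₁] [NormedSpace ℝ E₁] [FiniteDimensional ℝ E₁]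
    [Nontrivial E₁]
    {M₁ : Type*} [TopologicalSpace M₁] [T2Space M₁] [Nonempty M₁] [ChartedSpace E₁ M₁]
    [IsManifold 𝓘(ℝ, E₁) ∞ M₁]
    {E₂ : Type*} [NormedAddCommGroup E₂] [NormedSpace ℝ E₂] [FiniteDimensional ℝ E₂]
    [Nontrivial E₂]
    {M₂ : Type*} [TopologicalSpace M₂] [T2Space M₂] [Nonempty M₂] [ChartedSpace E₂ M₂]
    [IsManifold 𝓘(ℝ, E₂) ∞ M₂]
    (g₁ : RiemGeom.SmoothMetric 𝓘(ℝ, E₁) M₁) (g₂ : RiemGeom.SmoothMetric 𝓘(ℝ, E₂) M₂)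
    (hc₁ : RiemGeom.IsComplete g₁) (hc₂ : RiemGeom.IsComplete g₂)
    (hn : RiemGeom.NoConjugatePoints (RiemGeom.prodMetric g₁ g₂))
    (hn₁ : RiemGeom.NoConjugatePoints g₁) (hn₂ : RiemGeom.NoConjugatePoints g₂)
    (h : RiemGeom.IsAsymptoticallyHarmonic (RiemGeom.prodMetric g₁ g₂)) :
    RiemGeom.IsAsymptoticallyHarmonic g₁ ∧ RiemGeom.IsAsymptoticallyHarmonic g₂ ∧
    (∀ (x : M₁ × M₂) (v : TangentSpace (𝓘(ℝ, E₁).prod 𝓘(ℝ, E₂)) x),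
      (RiemGeom.prodMetric g₁ g₂).inner x v v = 1 →
        RiemGeom.trStable (RiemGeom.prodMetric g₁ g₂) x v = 0) ∧
    (∀ (p : M₁) (v : TangentSpace 𝓘(ℝ, E₁) p), g₁.inner p v v = 1 →
      RiemGeom.trStable g₁ p v = 0) ∧
    (∀ (p : M₂) (v : TangentSpace 𝓘(ℝ, E₂) p), g₂.inner p v v = 1 →
      RiemGeom.trStable g₂ p v = 0) := by
  obtain ⟨hc, -, α, hα⟩ := h
  have key : ∀ (p₁ : M₁) (v₁ : TangentSpace 𝓘(ℝ, E₁) p₁) (p₂ : M₂)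
      (v₂ : TangentSpace 𝓘(ℝ, E₂) p₂), g₁.inner p₁ v₁ v₁ = 1 → g₂.inner p₂ v₂ v₂ = 1 →
      α = 0 ∧ RiemGeom.trStable g₁ p₁ v₁ = 0 ∧ RiemGeom.trStable g₂ p₂ v₂ = 0 := by
    intro p₁ v₁ p₂ v₂ h₁ h₂
    have hv₁ : v₁ ≠ 0 := by
      rintro rfl
      simp at h₁
    have hv₂ : v₂ ≠ 0 := by
      rintro rfl
      simp at h₂
    have hlin : ∀ a b : ℝ, 0 < a → 0 < b → a * a + b * b = 1 →
        a * RiemGeom.trStable g₁ p₁ v₁ + b * RiemGeom.trStable g₂ p₂ v₂ = α := by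
      intro a b ha hb hab
      rw [← RiemGeom.trStable_prod hc₁ hc₂ hc hn₁ hn₂ hv₁ hv₂ ha hb]
      refine hα _ _ ?_
      have e₁ : g₁.inner p₁ (a • v₁) (a • v₁) = a * a := by
        rw [map_smul, map_smul]
        change a * (a * g₁.inner p₁ v₁ v₁) = a * a
        rw [h₁, mul_one]
      have e₂ : g₂.inner p₂ (b • v₂) (b • v₂) = b * b := by
        rw [map_smul, map_smul]
        change b * (b * g₂.inner p₂ v₂ v₂) = b * b
        rw [h₂, mul_one]
      exact (congrArg₂ (fun s t : ℝ => s + t) e₁ e₂).trans hab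
    -- three Pythagorean pairs give three independent linear equations for `α` and the two traces
    have l₁ := hlin (3 / 5) (4 / 5) (by norm_num) (by norm_num) (by norm_num)
    have l₂ := hlin (4 / 5) (3 / 5) (by norm_num) (by norm_num) (by norm_num)
    have l₃ := hlin (5 / 13) (12 / 13) (by norm_num) (by norm_num) (by norm_num)
    exact ⟨by linarith, by linarith, by linarith⟩
  obtain ⟨q₁⟩ := ‹Nonempty M₁›
  obtain ⟨q₂⟩ := ‹Nonempty M₂›
  obtain ⟨u₁, hu₁⟩ := RiemGeom.exists_unit_vector g₁ q₁
  obtain ⟨u₂, hu₂⟩ := RiemGeom.exists_unit_vector g₂ q₂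
  have t₁ : ∀ (p : M₁) (v : TangentSpace 𝓘(ℝ, E₁) p), g₁.inner p v v = 1 →
      RiemGeom.trStable g₁ p v = 0 := fun p v hv => (key p v q₂ u₂ hv hu₂).2.1
  have t₂ : ∀ (p : M₂) (v : TangentSpace 𝓘(ℝ, E₂) p), g₂.inner p v v = 1 →
      RiemGeom.trStable g₂ p v = 0 := fun p v hv => (key q₁ u₁ p v hu₁ hv).2.2
  refine ⟨⟨hc₁, hn₁, 0, t₁⟩, ⟨hc₂, hn₂, 0, t₂⟩, fun x v hv => ?_, t₁, t₂⟩
  rw [hα x v hv, (key q₁ u₁ q₂ u₂ hu₁ hu₂).1]
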